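/- **Corollary 4 (Cauchy).** Let $U\subset\mathbb C$ be a simply connected domain, let $M_1,\dots,M_r\subset U$ be pairwise disjoint open sets covering $U$ up to a set of Lebesgue measure $0$, let $A_1,\dots,A_r$ be pairwise distinct analytic functions in $U$, and let $\Phi=\sum_{i=1}^r A_i\chi_{M_i}$ a.e. in $U$ (a piecewise analytic function). Assume that $\partial\Phi/\partial\bar z\ge 0$ in $U$ in the sense of distributions, and that $p\in U$ satisfies (i) $p\in\overline{M_i}$ for $1\le i\le r$; (ii) $A_i(p)-A_k(p)\notin\mathbb R\,(A_j(p)-A_k(p))$ for all triples of distinct indices $(i,j,k)$; (iii) $A_i(p)\ne A_k(p)$ for all $i\ne k$. For $z\in U$ let $H_i(z)=\operatorname{Re}\int_p^z A_i(w)\,dw$ (well defined, since $U$ is simply connected). Then the distribution $\nu:=\partial\Phi/\partial\bar z$ is a positive measure on $U$, finite on compact sets, and the following hold. (a) For every open neighborhood $N(p)$ of $p$ whose closure is compact and contained in $U$, put $\tilde\nu:=\chi_{\overline{N(p)}}\cdot\nu$, a finite positive measure on $\mathbb C$. There is an analytic function $A$ in $N(p)$ such that $\Phi=C_{\tilde\nu}+A$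 a.e. in $N(p)$, where $C_{\tilde\nu}(z)=\frac1\pi\int\frac{d\tilde\nu(w)}{z-w}$ is the Cauchy transform of $\tilde\nu$ (the integral converges absolutely for a.e. $z\in N(p)$). There is moreover an open neighborhood $V\subset U$ of $p$ such that (b) and (c) hold. (b) There are finitely many segments (compact simple regular real analytic arcs in $U$) of level curves $\{H_i-H_j=0\}$, $i\ne j$, such that for every $N(p)$ as in (a) with $\overline{N(p)}\subset V$ the support of $\tilde\nu$ is contained in their union. (c) Let $\Gamma=\operatorname{supp}\nu$ and let $\Gamma^d$ be the set of points of $\Gamma$ near which $\Gamma$ is not a $C^1$ curve with a normal, i.e. not of the form $\{g=0\}$ with $g$ real-valued, $C^1$, and $dg\ne0$ at the point. Then $\Gamma^d\cap V$ is finite and $\nu(\Gamma^d\cap V)=0$. Every $z\in V\cap(\Gamma\setminus\Gamma^d)$ has a neighborhood $N(z)\subset V$ and indices $i\ne j$ such that $N(z)\setminus\Gamma$ has exactly two components, with $\Phi=A_i$ a.e. in one and $\Phi=A_j$ a.e. in the other; $N(z)\cap\Gamma$ is a simple regular real analytic curve contained in the level curve $\{H_i-H_j=0\}$; and in $N(z)$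 $$\nu=\frac{|A_i-A_j|\,ds}{2},$$ where $ds$ denotes length measure on $N(z)\cap\Gamma$. -/

import Mathlib

open MeasureTheory Set TopologicalSpace Topology
open scoped Distributions LineDeriv ENNReal

noncomputable section

namespace PiecewiseAnalytic

/-- The distribution `g ↦ ∫ g Φ` on `U` defined by a locally integrable function `Φ`
(Lebesgue measure on `ℂ`). -/
def ofFunction (U : Opens ℂ) (Φ : ℂ → ℂ) : 𝓓'(U, ℂ) :=
  ContinuousLinearMap.toUniformConvergenceCLM _ _ _
    (TestFunction.integralAgainstBilinCLM (ContinuousLinearMap.lsmul ℝ ℝ) volume Φ)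

theorem ofFunction_apply {U : Opens ℂ} {Φ : ℂ → ℂ} (h : LocallyIntegrableOn Φ U volume)
    (g : 𝓓(U, ℝ)) : ofFunction U Φ g = ∫ z, (g z : ℂ) * Φ z := by
  simp [ofFunction, h]

/-- The distributional derivative `∂T/∂z̄ = (∂T/∂x + i ∂T/∂y) / 2`. -/
def dbar {U : Opens ℂ} (T : 𝓓'(U, ℂ)) : 𝓓'(U, ℂ) :=
  Distribution.mapCLM (ContinuousLinearMap.mul ℝ ℂ (1 / 2)) (∂_{(1 : ℂ)} T) +
    Distribution.mapCLM (ContinuousLinearMap.mul ℝ ℂ (Complex.I / 2)) (∂_{Complex.I} T)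

theorem dbar_apply {U : Opens ℂ} (T : 𝓓'(U, ℂ)) (g : 𝓓(U, ℝ)) :
    dbar T g = -(1 / 2) * (T (∂_{(1 : ℂ)} g) + Complex.I * T (∂_{Complex.I} g)) := by
  simp only [dbar, add_apply, Distribution.mapCLM_apply,
    Distribution.lineDerivOp_apply_apply, ContinuousLinearMap.mul_apply', map_neg]
  ring

/-- `T ∈ Σ(U)`: the distribution `∂T/∂z̄` is nonnegative. -/
def MemSigma {U : Opens ℂ} (T : 𝓓'(U, ℂ)) : Prop :=
  ∀ g : 𝓓(U, ℝ), (∀ z, 0 ≤ g z) → 0 ≤ (dbar T g).re ∧ (dbar T g).im = 0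

/-- The Borel measure `ν`, carried by `U` and finite on the compact subsets of `U`,
is the distribution `T` on `U`. -/
structure IsMeasureOf {U : Opens ℂ} (T : 𝓓'(U, ℂ)) (ν : Measure ℂ) : Prop where
  carried : ν (U : Set ℂ)ᶜ = 0
  finite_compact : ∀ K : Set ℂ, IsCompact K → K ⊆ U → ν K < ∞
  eq_integral : ∀ g : 𝓓(U, ℝ), T g = ((∫ z, g z ∂ν : ℝ) : ℂ)

/-- `Φ` is a piecewise analytic function on `U`, with decomposition
`Φ = ∑ i, A i * χ_{M i}` almost everywhere in `U`. -/
structure IsPiecewiseAnalytic {r : ℕ} (U : Opens ℂ) (M : Fin r → Set ℂ) (A : Fin r → ℂ → ℂ)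
    (Φ : ℂ → ℂ) : Prop where
  isOpen : ∀ i, IsOpen (M i)
  subset : ∀ i, M i ⊆ U
  disjoint : ∀ i j, i ≠ j → Disjoint (M i) (M j)
  null : volume ((U : Set ℂ) \ ⋃ i, M i) = 0
  analytic : ∀ i, AnalyticOnNhd ℂ (A i) U
  distinct : ∀ i j, i ≠ j → ¬ EqOn (A i) (A j) U
  eq_sum : ∀ᵐ z ∂(volume.restrict (U : Set ℂ)), Φ z = ∑ i, (M i).indicator (A i) z

/-- `F z = ∫_p^z A(w) dw` for `z ∈ U`: the primitive of `A` on `U` that vanishes at `p`. -/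
def IsPrimitiveFrom (U : Opens ℂ) (p : ℂ) (A F : ℂ → ℂ) : Prop :=
  F p = 0 ∧ ∀ z ∈ U, HasDerivAt F (A z) z

/-- The Cauchy transform `C_μ = (1 / (π z)) * μ` (convolution). -/
def cauchyTransform (μ : Measure ℂ) (z : ℂ) : ℂ :=
  ∫ w, 1 / ((Real.pi : ℂ) * (z - w)) ∂μ

/-- `γ` is a regular simple real analytic parametrization of a curve on the interval `I`. -/
structure IsRegularArc (γ : ℝ → ℂ) (I : Set ℝ) : Prop where
  analytic : AnalyticOnNhd ℝ γ I
  deriv_ne_zero : ∀ t ∈ I, deriv γ t ≠ 0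
  injOn : InjOn γ I

/-- `S` is a segment (compact simple arc) in `U` of the level curve `h₁ - h₂ = 0`. -/
def IsLevelSegment (U : Opens ℂ) (h₁ h₂ : ℂ → ℝ) (S : Set ℂ) : Prop :=
  ∃ γ : ℝ → ℂ, IsRegularArc γ (Icc 0 1) ∧ γ '' Icc 0 1 = S ∧
    S ⊆ U ∧ ∀ z ∈ S, h₁ z - h₂ z = 0

/-- Length measure `ds` on the simple curve parametrized by `γ` on `I`: the image under `γ`
of `|γ'(t)| dt`. -/
def lengthMeasure (γ : ℝ → ℂ) (I : Set ℝ) : Measure ℂ :=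
  ((volume.restrict I).withDensity fun t ↦ ENNReal.ofReal ‖deriv γ t‖).map γ

/-- `Γ` has a normal at `z ∈ Γ`: near `z` it is a `C¹` curve, given by an equation
`g = 0` with `dg(z) ≠ 0`. -/
def HasNormalAt (Γ : Set ℂ) (z : ℂ) : Prop :=
  ∃ (W : Set ℂ) (g : ℂ → ℝ), IsOpen W ∧ z ∈ W ∧ z ∈ Γ ∧ ContDiffOn ℝ 1 g W ∧
    fderiv ℝ g z ≠ 0 ∧ Γ ∩ W = {w ∈ W | g w = 0}

/-- The local description of `ν` and `Φ` at the point `z` in terms of `Γ`: in a neighborhood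
`N ⊆ V` of `z`, the set `N \ Γ` has exactly two components, on which `Φ = A i` and `Φ = A j`,
the curve `N ∩ Γ` is contained in the level curve `H i - H j = 0`, and
`ν = |A i - A j| ds / 2`, where `ds` is length measure on `N ∩ Γ`. -/
def LocallyDescribedAt {r : ℕ} (A : Fin r → ℂ → ℂ) (H : Fin r → ℂ → ℝ) (Φ : ℂ → ℂ)
    (ν : Measure ℂ) (Γ V : Set ℂ) (z : ℂ) : Prop :=
  ∃ i j : Fin r, i ≠ j ∧ ∃ N Ni Nj : Set ℂ,
    IsOpen N ∧ z ∈ N ∧ N ⊆ V ∧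
    (IsOpen Ni ∧ IsConnected Ni ∧ IsOpen Nj ∧ IsConnected Nj ∧ Disjoint Ni Nj ∧
      N \ Γ = Ni ∪ Nj) ∧
    (∀ᵐ w ∂(volume.restrict Ni), Φ w = A i w) ∧
    (∀ᵐ w ∂(volume.restrict Nj), Φ w = A j w) ∧
    (∀ w ∈ N ∩ Γ, H i w - H j w = 0) ∧
    ∃ γ : ℝ → ℂ, IsRegularArc γ (Ioo (-1) 1) ∧ γ '' Ioo (-1) 1 = N ∩ Γ ∧
      ν.restrict N = (lengthMeasure γ (Ioo (-1) 1)).withDensity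
        fun w ↦ ENNReal.ofReal (‖A i w - A j w‖ / 2)

end PiecewiseAnalytic

end

/-! Positivity of `∂Φ/∂z̄` first yields a measure `ν` by Riesz extension and Riesz representation.
Part (a) is then the fundamental-solution argument: `∂(χΦ)/∂z̄ = χν + Φ ∂χ/∂z̄` for a cutoff `χ`
equal to `1` near the closure of `N`, and convolution with `1/(πz)` leaves an error produced by
sources outside `N`, hence analytic in `N`.

Parts (b) and (c) rest on a potential. Because `ν` is real, the form `Re(Φ dz)` is closed, so near
`p` it has a continuous primitive `Ψ` with `Ψ p = 0` (`exists_isPotential`). It satisfies `ΔΨ = 2ν ≥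
0`, so `Ψ` is subharmonic, and on `M i` it differs from `Re (F i)` by a locally constant function,
`F i` being the primitive of `A i` that vanishes at `p`. The central claim is that near `p` one has
`Ψ = max Re (F i)`, and that `Re (F k)` attains this maximum at the points of `M k`
(`LocalPotential.exists_ball_forall_le`). It is proved in three stages.

If `A i p` is a vertex of the convex hull of the values `A j p`, then `Re (F i) - Ψ` is
superharmonic and nondecreasing along a cone of directions exposing that vertex. It is constant near
a point of `M i`, so the minimum principle makes it constant on the whole forward cone of that
point. All forward cones issuing from points close to `p` share a point, so one constant serves for
all of `M i` near `p`, and `p ∈ closure (M i)` identifies it as `0`. Thus `Re (F i) ≤ Ψ`, with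
equality on `M i` (`exists_le_of_isExposed`).

Next, `Ψ` agrees everywhere near `p` with some exposed `Re (F i)`. On the open set where it exceeds
all of them only nonexposed pieces occur, and in every direction these grow strictly more slowly
than some exposed piece, so the excess cannot build up along a segment from `p`
(`exists_forall_exists_eq`).

Finally every index is exposed: otherwise at some point of `M k` near `p` the difference of `Re (F
k)` and an exposed `Re (F i)` has a local minimum, which forces `A k = A i` there, against (iii).

Hence `ν` near `p` lives where the maximum is attained at least twice. By (ii) a triple tie occurs
only at `p`. At a double tie, the holomorphic coordinate `F i - F j` straightens the curve to a
piece of the imaginary axis, where the jump of `Φ` can be integrated explicitly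
(`locallyDescribedAt_of_isLevelChart`). With three or more indices `p` has no normal: of three
exposing directions two lie on the same side of any tangent line, yet the regions of two different
indices cannot be joined without crossing the support (`false_of_same_side`). The point `p` has no
mass because `Φ` is bounded near it. -/

noncomputable section

namespace PiecewiseAnalytic

open Filter Metric
open scoped ContDiff

/-! ### The operator `∂/∂z̄` on functions and integration by parts -/

/-- The Wirtinger derivative `∂g/∂z̄`. -/
def wbar (g : ℂ → ℂ) (z : ℂ) : ℂ :=
  (fderiv ℝ g z 1 + Complex.I * fderiv ℝ g z Complex.I) / 2

theorem continuous_wbar {g : ℂ → ℂ} (hg : ContDiff ℝ 1 g) : Continuous (wbar g) := by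
  have h := hg.continuous_fderiv one_ne_zero
  unfold wbar
  fun_prop

theorem tsupport_wbar_subset (g : ℂ → ℂ) : tsupport (wbar g) ⊆ tsupport g := by
  refine closure_minimal (fun z hz ↦ ?_) (isClosed_tsupport g)
  by_contra hzg
  apply hz
  have : fderiv ℝ g z = 0 := by
    by_contra h
    exact hzg (support_fderiv_subset ℝ h)
  simp [wbar, this]

theorem hasCompactSupport_wbar {g : ℂ → ℂ} (hg : HasCompactSupport g) :
    HasCompactSupport (wbar g) :=
  hg.of_isClosed_subset (isClosed_tsupport _) (tsupport_wbar_subset g)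

theorem wbar_mul {a b : ℂ → ℂ} {z : ℂ} (ha : DifferentiableAt ℝ a z)
    (hb : DifferentiableAt ℝ b z) :
    wbar (fun w ↦ a w * b w) z = a z * wbar b z + wbar a z * b z := by
  unfold wbar
  rw [fderiv_fun_mul ha hb]
  simp only [add_apply, smul_apply, smul_eq_mul]
  ring

/-- In the Wirtinger chain rule the term with `∂S/∂z̄` vanishes and only the conjugate of `S'`
survives. Used for rescaling and for the conformal change of variables. -/
theorem wbar_comp_holomorphic {g S : ℂ → ℂ} {s z : ℂ} (hS : HasDerivAt S s z)
    (hg : DifferentiableAt ℝ g (S z)) :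
    wbar (fun w ↦ g (S w)) z = (starRingEnd ℂ) s * wbar g (S z) := by
  have hS' : HasFDerivAt S ((ContinuousLinearMap.toSpanSingleton ℂ s).restrictScalars ℝ) z :=
    hS.hasFDerivAt.restrictScalars ℝ
  have h := (hg.hasFDerivAt.comp z hS').fderiv
  unfold wbar
  change (fderiv ℝ (g ∘ S) z 1 + Complex.I * fderiv ℝ (g ∘ S) z Complex.I) / 2 = _
  rw [h]
  have key : ∀ v : ℂ, fderiv ℝ g (S z) v
      = v.re * fderiv ℝ g (S z) 1 + v.im * fderiv ℝ g (S z) Complex.I := by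
    intro v
    have : v = v.re • (1 : ℂ) + v.im • Complex.I := by
      apply Complex.ext <;> simp
    conv_lhs => rw [this, map_add, map_smul, map_smul]
    simp
  simp only [ContinuousLinearMap.comp_apply, ContinuousLinearMap.coe_restrictScalars',
    ContinuousLinearMap.toSpanSingleton_apply, smul_eq_mul, one_mul]
  rw [key s, key (Complex.I * s)]
  have hs : (starRingEnd ℂ) s = s.re - s.im * Complex.I := by
    apply Complex.ext <;> simp
  rw [hs]
  simp only [Complex.mul_re, Complex.I_re, Complex.I_im, Complex.mul_im]
  push_cast
  linear_combination ((fderiv ℝ g (S z) Complex.I * s.im) / 2) * Complex.I_sq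

theorem integrable_mul_of_locallyIntegrableOn {𝕜 : Type*} [RCLike 𝕜] {O : Set ℂ}
    {a h : ℂ → 𝕜} {μ : Measure ℂ} (ha : LocallyIntegrableOn a O μ) (hh : Continuous h)
    (hc : HasCompactSupport h) (hs : tsupport h ⊆ O) : Integrable (fun z ↦ a z * h z) μ := by
  suffices IntegrableOn (fun z ↦ a z * h z) (tsupport h) μ by
    rwa [integrableOn_iff_integrable_of_support_subset] at this
    exact fun x hx ↦ subset_tsupport h fun h0 ↦ hx (by simp [h0])
  exact (ha.integrableOn_compact_subset hs hc).mul_continuousOn hh.continuousOn hc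

theorem integral_mul_fderiv_of_continuousOn {𝕜 : Type*} [RCLike 𝕜] {O : Set ℂ} {a h : ℂ → 𝕜}
    {a' : ℂ → ℂ →L[ℝ] 𝕜} (hO : IsOpen O)
    (ha : ∀ z ∈ O, HasFDerivAt a (a' z) z) (ha' : ContinuousOn a' O) (hh : ContDiff ℝ 1 h)
    (hc : HasCompactSupport h) (hs : tsupport h ⊆ O) (v : ℂ) :
    ∫ z, a z * fderiv ℝ h z v = -∫ z, a' z v * h z := by
  have hac : ContinuousOn a O := fun z hz ↦ (ha z hz).continuousAt.continuousWithinAt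
  have hfc : Continuous fun z ↦ fderiv ℝ h z v := by
    have := hh.continuous_fderiv one_ne_zero
    fun_prop
  have hsub : tsupport (fun z ↦ fderiv ℝ h z v) ⊆ tsupport h := tsupport_fderiv_apply_subset ℝ v
  refine integral_bilinear_hasFDerivAt_right_eq_neg_left_of_integrable
    (B := ContinuousLinearMap.mul ℝ 𝕜) (f' := a') ?_ ?_ ?_ (fun z hz ↦ ha z (hs hz))
    (fun z _ ↦ (hh.differentiable one_ne_zero z).hasFDerivAt)
  · exact integrable_mul_of_locallyIntegrableOn
      ((ContinuousOn.clm_apply ha' continuousOn_const).locallyIntegrableOn hO.measurableSet)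
      hh.continuous hc hs
  · exact integrable_mul_of_locallyIntegrableOn (hac.locallyIntegrableOn hO.measurableSet)
      hfc (hc.of_isClosed_subset (isClosed_tsupport _) hsub) (hsub.trans hs)
  · exact integrable_mul_of_locallyIntegrableOn (hac.locallyIntegrableOn hO.measurableSet)
      hh.continuous hc hs

/-- Integration by parts moves `∂/∂z̄` onto `a`, where the Cauchy-Riemann equations kill it. -/
theorem integral_holomorphic_mul_wbar {O : Set ℂ} {a h : ℂ → ℂ} (hO : IsOpen O)
    (ha : DifferentiableOn ℂ a O) (hh : ContDiff ℝ 1 h)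
    (hc : HasCompactSupport h) (hs : tsupport h ⊆ O) :
    ∫ z, a z * wbar h z = 0 := by
  have hd : ∀ z ∈ O, DifferentiableAt ℂ a z := fun z hz ↦ ha.differentiableAt (hO.mem_nhds hz)
  have hC : ContDiffOn ℂ 1 a O := (ha.contDiffOn hO)
  have hcont : ContinuousOn (fun z ↦ (fderiv ℂ a z).restrictScalars ℝ) O :=
    (ContinuousLinearMap.restrictScalarsL ℂ ℂ ℂ ℝ ℝ).continuous.comp_continuousOn
      (hC.continuousOn_fderiv_of_isOpen hO le_rfl)
  have hac : ContinuousOn a O := ha.continuousOn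
  have key := integral_mul_fderiv_of_continuousOn hO
    (fun z hz ↦ (hd z hz).hasFDerivAt.restrictScalars ℝ) hcont hh hc hs
  have hfc : ∀ v, Integrable fun z ↦ a z * fderiv ℝ h z v := fun v ↦ by
    have hsub : tsupport (fun z ↦ fderiv ℝ h z v) ⊆ tsupport h := tsupport_fderiv_apply_subset ℝ v
    refine integrable_mul_of_locallyIntegrableOn (hac.locallyIntegrableOn hO.measurableSet)
      ?_ (hc.of_isClosed_subset (isClosed_tsupport _) hsub) (hsub.trans hs)
    have := hh.continuous_fderiv one_ne_zero
    fun_prop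
  have : ∀ z, a z * wbar h z = (1 / 2) * (a z * fderiv ℝ h z 1)
      + (Complex.I / 2) * (a z * fderiv ℝ h z Complex.I) := fun z ↦ by unfold wbar; ring
  simp_rw [this]
  rw [integral_add ((hfc _).const_mul _) ((hfc _).const_mul _), integral_const_mul,
    integral_const_mul, key, key]
  simp only [ContinuousLinearMap.coe_restrictScalars']
  have : ∀ z, fderiv ℂ a z Complex.I * h z = Complex.I * (fderiv ℂ a z 1 * h z) := fun z ↦ by
    rw [← mul_assoc, ← smul_eq_mul Complex.I, ← map_smul]; simp
  simp_rw [this]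
  rw [integral_const_mul]
  linear_combination (-(∫ z, fderiv ℂ a z 1 * h z) / 2) * Complex.I_sq

theorem fderiv_ofReal_comp {g : ℂ → ℝ} {z : ℂ} (hg : DifferentiableAt ℝ g z) (v : ℂ) :
    fderiv ℝ (fun w ↦ (g w : ℂ)) z v = (fderiv ℝ g z v : ℂ) := by
  have := (Complex.ofRealCLM.hasFDerivAt.comp z hg.hasFDerivAt).fderiv
  change fderiv ℝ (Complex.ofRealCLM ∘ g) z v = _
  rw [this]; simp

theorem contDiff_ofReal_comp {g : ℂ → ℝ} {n : ℕ∞} (hg : ContDiff ℝ n g) :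
    ContDiff ℝ n fun w ↦ (g w : ℂ) :=
  Complex.ofRealCLM.contDiff.comp hg

theorem tsupport_ofReal_comp (g : ℂ → ℝ) : tsupport (fun w ↦ (g w : ℂ)) = tsupport g := by
  unfold tsupport
  congr 1
  ext z
  simp

/-! ### Piecewise analytic functions as distributions -/

theorem exists_contDiff_cutoff {K U : Set ℂ} (hK : IsCompact K) (hU : IsOpen U) (hKU : K ⊆ U) :
    ∃ χ : ℂ → ℝ, ContDiff ℝ ∞ χ ∧ HasCompactSupport χ ∧ tsupport χ ⊆ U ∧
      (∀ᶠ z in 𝓝ˢ K, χ z = 1) ∧ ∀ z, χ z ∈ Icc (0 : ℝ) 1 := by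
  obtain ⟨L, hL, hKL, hLU⟩ := exists_compact_between hK hU hKU
  obtain ⟨f, h1, h0, hf⟩ := exists_contMDiffMap_one_nhds_of_subset_interior (n := ⊤)
    (modelWithCornersSelf ℝ ℂ) hK.isClosed hKL
  have hsub : tsupport f ⊆ L :=
    closure_minimal (fun x hx ↦ by_contra fun hxL ↦ hx (h0 x hxL)) hL.isClosed
  exact ⟨f, f.contMDiff.contDiff, hL.of_isClosed_subset (isClosed_tsupport _) hsub,
    hsub.trans hLU, h1, hf⟩

theorem IsPiecewiseAnalytic.locallyIntegrableOn {r : ℕ} {U : Opens ℂ} {M : Fin r → Set ℂ}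
    {A : Fin r → ℂ → ℂ} {Φ : ℂ → ℂ} (h : IsPiecewiseAnalytic U M A Φ) :
    LocallyIntegrableOn Φ U := by
  have h1 : LocallyIntegrableOn (fun z ↦ ∑ i, (M i).indicator (A i) z) U := by
    intro z hz
    obtain ⟨ε, hε, hsub⟩ := nhds_basis_closedBall.mem_iff.1 (U.isOpen.mem_nhds hz)
    refine ⟨closedBall z ε, mem_nhdsWithin_of_mem_nhds (closedBall_mem_nhds z hε), ?_⟩
    refine integrable_finsetSum _ fun i _ ↦ ?_
    refine Integrable.indicator ?_ (h.isOpen i).measurableSet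
    exact ((h.analytic i).continuousOn.mono hsub).integrableOn_compact (isCompact_closedBall z ε)
  intro z hz
  obtain ⟨s, hs, hs'⟩ := h1 z hz
  refine ⟨s ∩ U, inter_mem hs self_mem_nhdsWithin, ?_⟩
  refine (hs'.mono_set inter_subset_left).congr ?_
  have := h.eq_sum
  filter_upwards [ae_mono (Measure.restrict_mono inter_subset_right le_rfl) this] with w hw
  exact hw.symm

theorem dbar_ofFunction {U : Opens ℂ} {Φ : ℂ → ℂ} (h : LocallyIntegrableOn Φ U)
    (g : 𝓓(U, ℝ)) :
    dbar (ofFunction U Φ) g = -∫ z, Φ z * wbar (fun w ↦ (g w : ℂ)) z := by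
  have hd : ∀ (v z : ℂ), (∂_{v} g) z = fderiv ℝ g z v := fun v z ↦ by
    rw [TestFunction.lineDerivOp_eq_lineDerivCLM ℝ, TestFunction.lineDerivCLM_apply]
    simp only [le_refl, top_add, if_true]
    exact (g.contDiff.differentiable (by simp) z).lineDeriv_eq_fderiv
  have hi : ∀ v, Integrable fun z ↦ Φ z * fderiv ℝ (fun w ↦ (g w : ℂ)) z v := fun v ↦ by
    have hsub := tsupport_fderiv_apply_subset ℝ (f := fun w ↦ (g w : ℂ)) v
    have h1 : ContDiff ℝ 1 fun w ↦ (g w : ℂ) := (contDiff_ofReal_comp g.contDiff).of_le (by simp)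
    have h2 : tsupport (fun w ↦ (g w : ℂ)) = tsupport g := tsupport_ofReal_comp g
    refine integrable_mul_of_locallyIntegrableOn h ?_
      (g.hasCompactSupport.of_isClosed_subset (isClosed_tsupport _) (hsub.trans h2.subset))
      ((hsub.trans h2.subset).trans g.tsupport_subset)
    have := h1.continuous_fderiv one_ne_zero
    fun_prop
  have hi' : ∀ v, Integrable fun z ↦ (((∂_{v} g : 𝓓(U, ℝ)) z : ℝ) : ℂ) * Φ z := fun v ↦ by
    refine (hi v).congr (Eventually.of_forall fun z ↦ ?_)
    simp only
    rw [hd, fderiv_ofReal_comp (g.contDiff.differentiable (by simp) z), mul_comm]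
  rw [dbar_apply, ofFunction_apply h, ofFunction_apply h]
  have : ∀ z, Φ z * wbar (fun w ↦ (g w : ℂ)) z = (1 / 2) * (((∂_{(1 : ℂ)} g) z : ℂ) * Φ z)
      + (1 / 2) * (Complex.I * (((∂_{Complex.I} g) z : ℂ) * Φ z)) := fun z ↦ by
    unfold wbar
    rw [hd, hd, fderiv_ofReal_comp (g.contDiff.differentiable (by simp) z),
      fderiv_ofReal_comp (g.contDiff.differentiable (by simp) z)]
    ring
  simp_rw [this]
  rw [integral_add ((hi' _).const_mul _) (((hi' _).const_mul _).const_mul _), integral_const_mul,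
    integral_const_mul, integral_const_mul]
  ring

/-! ### Positive distributions are measures -/

section Riesz

open CompactlySupported

/-- Restriction of a test function on `U` to the space `U`. -/
def restrictTest (U : Opens ℂ) : 𝓓(U, ℝ) →ₗ[ℝ] C_c(U, ℝ) where
  toFun g :=
    { toFun := fun z ↦ g z
      continuous_toFun := g.continuous.comp continuous_subtype_val
      hasCompactSupport' := by
        have hc : IsCompact ((↑) ⁻¹' tsupport g : Set U) :=
          (IsInducing.subtypeVal.isCompact_preimage_iff (by
            rw [Subtype.range_coe]; exact g.tsupport_subset)).2 g.hasCompactSupport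
        refine hc.of_isClosed_subset (isClosed_tsupport _) (closure_minimal ?_ hc.isClosed)
        exact fun z hz ↦ subset_tsupport g hz }
  map_add' _ _ := rfl
  map_smul' _ _ := rfl

theorem restrictTest_apply {U : Opens ℂ} (g : 𝓓(U, ℝ)) (z : U) : restrictTest U g z = g z := rfl

theorem restrictTest_injective (U : Opens ℂ) : Function.Injective (restrictTest U) := by
  intro g h hgh
  ext z
  by_cases hz : z ∈ U
  · exact congr($hgh ⟨z, hz⟩)
  · rw [image_eq_zero_of_notMem_tsupport fun h' ↦ hz (g.tsupport_subset h'),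
      image_eq_zero_of_notMem_tsupport fun h' ↦ hz (h.tsupport_subset h')]

theorem exists_test_ge {U : Opens ℂ} (K : Set U) (hK : IsCompact K) :
    ∃ χ : 𝓓(U, ℝ), (∀ z, 0 ≤ χ z) ∧ ∀ z ∈ K, χ (z : ℂ) = 1 := by
  obtain ⟨χ, h1, h2, h3, h4, h5⟩ := exists_contDiff_cutoff (hK.image continuous_subtype_val)
    U.isOpen (by rintro _ ⟨z, -, rfl⟩; exact z.2)
  exact ⟨⟨χ, h1, h2, h3⟩, fun z ↦ (h5 z).1,
    fun z hz ↦ h4.self_of_nhdsSet _ (mem_image_of_mem _ hz)⟩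

/-- Test functions form a subspace of `C_c(U)` that is cofinal for the pointwise order, since every
compactly supported function is bounded by a multiple of a smooth cutoff. The Riesz extension
theorem therefore extends `T` positively to `C_c(U)`, with no continuity needed, and the
representation theorem gives the measure. -/
theorem exists_measure_of_nonneg {U : Opens ℂ} (T : 𝓓(U, ℝ) →ₗ[ℝ] ℝ)
    (hT : ∀ g : 𝓓(U, ℝ), (∀ z, 0 ≤ g z) → 0 ≤ T g) :
    ∃ ν : Measure ℂ, ν (U : Set ℂ)ᶜ = 0 ∧ (∀ K : Set ℂ, IsCompact K → K ⊆ U → ν K < ⊤) ∧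
      ∀ g : 𝓓(U, ℝ), T g = ∫ z, g z ∂ν := by
  have : LocallyCompactSpace U := U.isOpen.locallyCompactSpace
  let s : PointedCone ℝ C_c(U, ℝ) :=
    { carrier := {f | ∀ z, 0 ≤ f z}
      zero_mem' := fun _ ↦ le_rfl
      add_mem' := fun hf hg z ↦ add_nonneg (hf z) (hg z)
      smul_mem' := fun c _ hf z ↦ mul_nonneg c.2 (hf z) }
  let e := LinearEquiv.ofInjective (restrictTest U) (restrictTest_injective U)
  let f : C_c(U, ℝ) →ₗ.[ℝ] ℝ := ⟨(restrictTest U).range, T ∘ₗ e.symm.toLinearMap⟩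
  have hf : ∀ g : 𝓓(U, ℝ), f ⟨restrictTest U g, LinearMap.mem_range_self _ g⟩ = T g := by
    intro g
    change T (e.symm _) = T g
    congr 1
    rw [LinearEquiv.symm_apply_eq]
    rfl
  obtain ⟨Λ, hΛ, hpos⟩ := riesz_extension s f (by
    rintro ⟨x, g, rfl⟩ hx
    rw [hf]
    refine hT g fun z ↦ ?_
    by_cases hz : z ∈ U
    · exact hx ⟨z, hz⟩
    · exact (image_eq_zero_of_notMem_tsupport fun h' ↦ hz (g.tsupport_subset h')).ge) (by
    intro y
    obtain ⟨χ, h0, h1⟩ := exists_test_ge (tsupport y) y.hasCompactSupport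
    obtain ⟨C, hC⟩ := y.continuous.bounded_above_of_compact_support y.hasCompactSupport
    refine ⟨⟨restrictTest U (C • χ), LinearMap.mem_range_self _ _⟩, fun z ↦ ?_⟩
    change 0 ≤ C * χ z + y z
    have hCz : ‖y z‖ ≤ C := hC z
    rw [Real.norm_eq_abs, abs_le] at hCz
    by_cases hz : z ∈ tsupport y
    · rw [h1 z hz]; linarith
    · rw [image_eq_zero_of_notMem_tsupport hz] at hCz ⊢
      have := mul_nonneg (by linarith : 0 ≤ C) (h0 z)
      linarith)
  let Λ' : C_c(U, ℝ) →ₚ[ℝ] ℝ := PositiveLinearMap.mk₀ Λ fun x hx ↦ hpos x hx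
  have he : MeasurableEmbedding ((↑) : U → ℂ) :=
    MeasurableEmbedding.subtype_coe U.isOpen.measurableSet
  refine ⟨(RealRMK.rieszMeasure Λ').map (↑), ?_, ?_, fun g ↦ ?_⟩
  · rw [he.map_apply]
    have : ((↑) ⁻¹' (U : Set ℂ)ᶜ : Set U) = ∅ := by ext z; simp
    rw [this, measure_empty]
  · intro K hK hKU
    rw [he.map_apply]
    exact ((IsInducing.subtypeVal.isCompact_preimage_iff (by
      rw [Subtype.range_coe]; exact hKU)).2 hK).measure_lt_top
  · rw [he.integral_map]
    have := RealRMK.integral_rieszMeasure Λ' (restrictTest U g)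
    simp only [restrictTest_apply] at this
    rw [this]
    change T g = Λ _
    rw [hΛ ⟨restrictTest U g, LinearMap.mem_range_self _ g⟩, hf]

theorem MemSigma.exists_isMeasureOf {U : Opens ℂ} {T : 𝓓'(U, ℂ)} (hT : MemSigma T) :
    ∃ ν : Measure ℂ, IsMeasureOf (dbar T) ν := by
  have him : ∀ g : 𝓓(U, ℝ), (dbar T g).im = 0 := by
    intro g
    obtain ⟨χ, h1, h2, h3, h4, h5⟩ := exists_contDiff_cutoff g.hasCompactSupport U.isOpen
      g.tsupport_subset
    let c : 𝓓(U, ℝ) := ⟨χ, h1, h2, h3⟩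
    obtain ⟨C, hC⟩ := g.continuous.bounded_above_of_compact_support g.hasCompactSupport
    have hC0 : 0 ≤ C := (norm_nonneg _).trans (hC 0)
    -- `MemSigma` controls imaginary parts on nonnegative functions only; `g` is the difference of
    -- the nonnegative functions `g + C • c` and `C • c`.
    have e1 := (hT (C • c) fun z ↦ mul_nonneg hC0 (h5 z).1).2
    have e2 := (hT (g + C • c) fun z ↦ by
      change 0 ≤ g z + C * χ z
      have hCz := hC z
      rw [Real.norm_eq_abs, abs_le] at hCz
      by_cases hz : z ∈ tsupport g
      · rw [h4.self_of_nhdsSet z hz]; linarith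
      · rw [image_eq_zero_of_notMem_tsupport hz, zero_add]
        exact mul_nonneg hC0 (h5 z).1).2
    rw [map_add, Complex.add_im, e1, add_zero] at e2
    exact e2
  obtain ⟨ν, h1, h2, h3⟩ := exists_measure_of_nonneg
    (Complex.reLm ∘ₗ (dbar T : 𝓓(U, ℝ) →ₗ[ℝ] ℂ)) fun g hg ↦ (hT g hg).1
  refine ⟨ν, h1, h2, fun g ↦ ?_⟩
  rw [← h3 g]
  apply Complex.ext
  · rfl
  · rw [him]; rfl

end Riesz

theorem IsMeasureOf.locallyIntegrableOn {U : Opens ℂ} {T : 𝓓'(U, ℂ)} {ν : Measure ℂ}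
    (h : IsMeasureOf T ν) {a : ℂ → ℂ} (ha : ContinuousOn a U) : LocallyIntegrableOn a U ν := by
  intro z hz
  obtain ⟨ε, hε, hsub⟩ := nhds_basis_closedBall.mem_iff.1 (U.isOpen.mem_nhds hz)
  refine ⟨closedBall z ε, mem_nhdsWithin_of_mem_nhds (closedBall_mem_nhds z hε), ?_⟩
  exact (ha.mono hsub).integrableOn_of_subset_isCompact (isCompact_closedBall z ε)
    measurableSet_closedBall subset_rfl (h.finite_compact _ (isCompact_closedBall z ε) hsub).ne

/-- `∂Φ/∂z̄ = ν` in `U`, tested against complex valued functions. -/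
def IsWeakDbar (U : Set ℂ) (Φ : ℂ → ℂ) (ν : Measure ℂ) : Prop :=
  ∀ g : ℂ → ℂ, ContDiff ℝ ∞ g → HasCompactSupport g → tsupport g ⊆ U →
    ∫ z, Φ z * wbar g z = -∫ z, g z ∂ν

theorem IsMeasureOf.isWeakDbar {U : Opens ℂ} {Φ : ℂ → ℂ} {ν : Measure ℂ}
    (hΦ : LocallyIntegrableOn Φ U) (h : IsMeasureOf (dbar (ofFunction U Φ)) ν) :
    IsWeakDbar U Φ ν := by
  have hreal : ∀ g : ℂ → ℝ, ContDiff ℝ ∞ g → HasCompactSupport g → tsupport g ⊆ U →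
      ∫ z, Φ z * wbar (fun w ↦ (g w : ℂ)) z = -∫ z, (g z : ℂ) ∂ν := by
    intro g h1 h2 h3
    have := h.eq_integral ⟨g, h1, h2, h3⟩
    rw [dbar_ofFunction hΦ] at this
    rw [integral_complex_ofReal, ← neg_eq_iff_eq_neg]
    exact this
  intro g h1 h2 h3
  have hcs : ∀ {L : ℂ → ℝ}, L 0 = 0 → HasCompactSupport (fun z ↦ L (g z)) ∧
      tsupport (fun z ↦ L (g z)) ⊆ tsupport g := fun {L} hL ↦ by
    have : tsupport (fun z ↦ L (g z)) ⊆ tsupport g :=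
      closure_minimal (fun z hz ↦ subset_tsupport g fun h0 ↦ hz (by simp [h0, hL]))
        (isClosed_tsupport _)
    exact ⟨h2.of_isClosed_subset (isClosed_tsupport _) this, this⟩
  have hre := hcs (L := Complex.re) rfl
  have him := hcs (L := Complex.im) rfl
  have dre : ContDiff ℝ ∞ fun z ↦ (g z).re := Complex.reCLM.contDiff.comp h1
  have dim : ContDiff ℝ ∞ fun z ↦ (g z).im := Complex.imCLM.contDiff.comp h1
  have e1 := hreal _ dre hre.1 (hre.2.trans h3)
  have e2 := hreal _ dim him.1 (him.2.trans h3)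
  have c1 := contDiff_ofReal_comp (n := ⊤) dre
  have c2 := contDiff_ofReal_comp (n := ⊤) dim
  have hone : LocallyIntegrableOn (fun _ ↦ (1 : ℂ)) U ν := h.locallyIntegrableOn continuousOn_const
  have key : ∀ {L : ℂ → ℝ}, ContDiff ℝ ∞ (fun z ↦ L (g z)) →
      HasCompactSupport (fun z ↦ L (g z)) ∧ tsupport (fun z ↦ L (g z)) ⊆ tsupport g →
      Integrable (fun z ↦ Φ z * wbar (fun w ↦ ((L (g w) : ℝ) : ℂ)) z) ∧
      Integrable (fun z ↦ ((L (g z) : ℝ) : ℂ)) ν := by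
    intro L hd hs
    have hd' := contDiff_ofReal_comp (n := ⊤) hd
    have ht := tsupport_ofReal_comp (fun z ↦ L (g z))
    have hc' : HasCompactSupport (fun z ↦ ((L (g z) : ℝ) : ℂ)) := by
      unfold HasCompactSupport; rw [ht]; exact hs.1
    constructor
    · exact integrable_mul_of_locallyIntegrableOn hΦ (continuous_wbar (hd'.of_le (by simp)))
        (hasCompactSupport_wbar hc')
        ((tsupport_wbar_subset _).trans (ht.subset.trans (hs.2.trans h3)))
    · simpa using integrable_mul_of_locallyIntegrableOn hone hd'.continuous hc'
        (ht.subset.trans (hs.2.trans h3))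
  have k1 := key dre hre
  have k2 := key dim him
  have hw : ∀ z, Φ z * wbar g z = Φ z * wbar (fun w ↦ ((g w).re : ℂ)) z
      + Complex.I * (Φ z * wbar (fun w ↦ ((g w).im : ℂ)) z) := by
    intro z
    have hg : g = fun w ↦ ((g w).re : ℂ) + ((g w).im : ℂ) * Complex.I := by
      ext w; simp
    have d1 := c1.differentiable (by simp) z
    have d2 := (c2.differentiable (by simp) z).mul_const Complex.I
    conv_lhs => rw [hg]
    unfold wbar
    rw [fderiv_fun_add d1 d2, fderiv_mul_const (c2.differentiable (by simp) z)]
    simp only [add_apply, smul_apply, smul_eq_mul]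
    ring
  simp_rw [hw]
  rw [integral_add k1.1 (k2.1.const_mul _), integral_const_mul, e1, e2]
  have : ∀ z, g z = ((g z).re : ℂ) + Complex.I * ((g z).im : ℂ) := fun z ↦ by
    rw [mul_comm]; simp
  conv_rhs => enter [1, 2, z]; rw [this z]
  rw [integral_add k1.2 (k2.2.const_mul _), integral_const_mul]
  ring

/-! ### Measures determined by smooth test functions -/

/-- A smooth cutoff squeezed between `K` and its closed `ε`-thickening compares the two measures up
to the thickening, and the thickenings decrease to `K`. -/
theorem measure_isCompact_le_of_integral_contDiff_eq {N : Set ℂ} (hN : IsOpen N)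
    {μ₁ μ₂ : Measure ℂ} (h₁ : ∀ K, IsCompact K → K ⊆ N → μ₁ K < ⊤)
    (h₂ : ∀ K, IsCompact K → K ⊆ N → μ₂ K < ⊤)
    (h : ∀ g : ℂ → ℝ, ContDiff ℝ ∞ g → HasCompactSupport g → tsupport g ⊆ N →
      ∫ z, g z ∂μ₁ = ∫ z, g z ∂μ₂) {K : Set ℂ} (hK : IsCompact K) (hKN : K ⊆ N) :
    μ₁ K ≤ μ₂ K := by
  obtain ⟨δ, hδ, hδN⟩ := hK.exists_cthickening_subset_open hN hKN
  have ht : Tendsto (fun r ↦ μ₂ (cthickening r K)) (𝓝[>] 0) (𝓝 (μ₂ K)) :=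
    (tendsto_measure_cthickening_of_isClosed
      ⟨δ, hδ, (h₂ _ hK.cthickening hδN).ne⟩ hK.isClosed).mono_left nhdsWithin_le_nhds
  refine ge_of_tendsto ht ?_
  filter_upwards [Ioo_mem_nhdsGT hδ] with ε hε
  obtain ⟨χ, c1, c2, c3, c4, c5⟩ := exists_contDiff_cutoff hK (isOpen_thickening (δ := ε))
    (self_subset_thickening hε.1 K)
  have hsub : tsupport χ ⊆ N :=
    c3.trans ((thickening_subset_cthickening _ _).trans ((cthickening_mono hε.2.le _).trans hδN))
  have hint : ∀ μ : Measure ℂ, (∀ K, IsCompact K → K ⊆ N → μ K < ⊤) →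
      ∫⁻ z, ENNReal.ofReal (χ z) ∂μ = ENNReal.ofReal (∫ z, χ z ∂μ) := fun μ hμ ↦ by
    rw [ofReal_integral_eq_lintegral_ofReal _ (Eventually.of_forall fun z ↦ (c5 z).1)]
    rw [← integrableOn_iff_integrable_of_support_subset (subset_tsupport χ)]
    exact c1.continuous.continuousOn.integrableOn_of_subset_isCompact c2
      c2.isClosed.measurableSet subset_rfl (hμ _ c2 hsub).ne
  calc μ₁ K = ∫⁻ z, K.indicator 1 z ∂μ₁ := by
        rw [lintegral_indicator_one hK.isClosed.measurableSet]
    _ ≤ ∫⁻ z, ENNReal.ofReal (χ z) ∂μ₁ := by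
        refine lintegral_mono fun z ↦ ?_
        by_cases hz : z ∈ K
        · simp [hz, c4.self_of_nhdsSet z hz]
        · simp [hz]
    _ = ∫⁻ z, ENNReal.ofReal (χ z) ∂μ₂ := by
        rw [hint _ h₁, hint _ h₂, h χ c1 c2 hsub]
    _ ≤ ∫⁻ z, (cthickening ε K).indicator 1 z ∂μ₂ := by
        refine lintegral_mono fun z ↦ ?_
        by_cases hz : z ∈ cthickening ε K
        · simp [hz, (c5 z).2]
        · have : χ z = 0 := image_eq_zero_of_notMem_tsupport fun h' ↦
            hz (thickening_subset_cthickening _ _ (c3 h'))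
          simp [hz, this]
    _ = μ₂ (cthickening ε K) := by
        rw [lintegral_indicator_one isClosed_cthickening.measurableSet]

/-- Agreement on compact sets suffices: an open set is a countable union of compact pieces, and on
each piece closed sets form a generating π-system. -/
theorem restrict_eq_of_integral_contDiff_eq {N : Set ℂ} (hN : IsOpen N)
    {μ₁ μ₂ : Measure ℂ} (h₁ : ∀ K, IsCompact K → K ⊆ N → μ₁ K < ⊤)
    (h₂ : ∀ K, IsCompact K → K ⊆ N → μ₂ K < ⊤)
    (h : ∀ g : ℂ → ℝ, ContDiff ℝ ∞ g → HasCompactSupport g → tsupport g ⊆ N →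
      ∫ z, g z ∂μ₁ = ∫ z, g z ∂μ₂) : μ₁.restrict N = μ₂.restrict N := by
  have hcomp : ∀ K, IsCompact K → K ⊆ N → μ₁ K = μ₂ K := fun K hK hKN ↦ le_antisymm
    (measure_isCompact_le_of_integral_contDiff_eq hN h₁ h₂ h hK hKN)
    (measure_isCompact_le_of_integral_contDiff_eq hN h₂ h₁ (fun g a b c ↦ (h g a b c).symm) hK hKN)
  obtain ⟨K, hK, rfl⟩ : IsSigmaCompact N := by
    have : LocallyCompactSpace N := hN.locallyCompactSpace
    exact isSigmaCompact_iff_sigmaCompactSpace.2 inferInstance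
  rw [Measure.restrict_iUnion_congr]
  intro n
  have hn : K n ⊆ ⋃ i, K i := subset_iUnion K n
  have : IsFiniteMeasure (μ₁.restrict (K n)) :=
    ⟨by rw [Measure.restrict_apply_univ]; exact h₁ _ (hK n) hn⟩
  refine ext_of_generate_finite {s | IsClosed s} (by
    rw [← borel_eq_generateFrom_isClosed]; exact BorelSpace.measurable_eq) isPiSystem_isClosed
    (fun s hs ↦ ?_) ?_
  · rw [Measure.restrict_apply hs.measurableSet, Measure.restrict_apply hs.measurableSet]
    exact hcomp _ ((hK n).inter_left hs) (inter_subset_right.trans hn)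
  · rw [Measure.restrict_apply_univ, Measure.restrict_apply_univ]
    exact hcomp _ (hK n) hn

/-- Analytic functions are killed by `∂/∂z̄`, so `ν` integrates every test function supported in `N`
to zero. -/
theorem IsMeasureOf.restrict_eq_zero {U : Opens ℂ} {T : 𝓓'(U, ℂ)} {Φ : ℂ → ℂ} {ν : Measure ℂ}
    (h : IsMeasureOf T ν) (hw : IsWeakDbar U Φ ν) {N : Set ℂ} (hN : IsOpen N) (hNU : N ⊆ U)
    {A : ℂ → ℂ} (hA : DifferentiableOn ℂ A N) (hΦ : ∀ᵐ z ∂volume.restrict N, Φ z = A z) :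
    ν N = 0 := by
  have : ν.restrict N = (0 : Measure ℂ).restrict N := by
    refine restrict_eq_of_integral_contDiff_eq hN
      (fun K hK hKN ↦ h.finite_compact K hK (hKN.trans hNU)) (by simp) fun g g1 g2 g3 ↦ ?_
    have gt := tsupport_ofReal_comp g
    have gc : HasCompactSupport (fun z ↦ (g z : ℂ)) := by
      unfold HasCompactSupport; rw [gt]; exact g2
    have gd := contDiff_ofReal_comp (n := ⊤) g1
    have e1 := hw (fun z ↦ (g z : ℂ)) gd gc (gt.subset.trans (g3.trans hNU))
    have e2 := integral_holomorphic_mul_wbar hN hA (gd.of_le (by simp)) gc (gt.subset.trans g3)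
    have e3 : ∫ z, Φ z * wbar (fun z ↦ (g z : ℂ)) z = ∫ z, A z * wbar (fun z ↦ (g z : ℂ)) z := by
      refine integral_congr_ae ?_
      filter_upwards [(ae_restrict_iff' hN.measurableSet).1 hΦ] with z hz
      by_cases hzN : z ∈ N
      · rw [hz hzN]
      · have : wbar (fun z ↦ (g z : ℂ)) z = 0 := image_eq_zero_of_notMem_tsupport fun h' ↦
          hzN (g3 (gt.subset (tsupport_wbar_subset _ h')))
        simp [this]
    rw [e3, e2, integral_complex_ofReal, zero_eq_neg, Complex.ofReal_eq_zero] at e1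
    simpa using e1
  simpa using congr($this N)

/-- Scaling: a bump of radius `ε` equal to `1` at `p` has `∂/∂z̄` of size `1/ε` on a disc of area
`πε²`. Since `Φ` is bounded, the mass at `p` is `O(ε)`. -/
theorem IsMeasureOf.measure_singleton_eq_zero {U : Opens ℂ} {T : 𝓓'(U, ℂ)} {Φ : ℂ → ℂ}
    {ν : Measure ℂ} (h : IsMeasureOf T ν) (hw : IsWeakDbar U Φ ν) {p : ℂ} {R C : ℝ} (hR : 0 < R)
    (hRU : ball p R ⊆ U) (hΦ : ∀ᵐ z ∂volume.restrict (ball p R), ‖Φ z‖ ≤ C) : ν {p} = 0 := by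
  obtain ⟨g, g1, g2, g3, g4, g5⟩ := exists_contDiff_cutoff (isCompact_singleton (x := (0 : ℂ)))
    (isOpen_ball (x := (0 : ℂ)) (ε := 1)) (by simp)
  have gc1 := contDiff_ofReal_comp (n := ⊤) g1
  have gt := tsupport_ofReal_comp g
  have gcs : HasCompactSupport (fun z ↦ (g z : ℂ)) := by
    unfold HasCompactSupport; rw [gt]; exact g2
  have hg0 : g 0 = 1 := g4.self_of_nhdsSet 0 rfl
  obtain ⟨K, hK⟩ := (continuous_wbar (gc1.of_le (by simp))).bounded_above_of_compact_support
    (hasCompactSupport_wbar gcs)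
  have hK0 : 0 ≤ K := (norm_nonneg _).trans (hK 0)
  have hC0 : 0 ≤ |C| := abs_nonneg C
  have hfin : ν {p} < ⊤ := h.finite_compact _ isCompact_singleton
    (singleton_subset_iff.2 (hRU (mem_ball_self hR)))
  have key : ∀ ε ∈ Ioo 0 R, (ν {p}).toReal ≤ |C| * K * Real.pi * ε := by
    intro ε hε
    have hε0 : (ε : ℂ) ≠ 0 := by exact_mod_cast hε.1.ne'
    let S : ℂ → ℂ := fun z ↦ (z - p) / ε
    have hS : ∀ z, HasDerivAt S (1 / ε) z := fun z ↦ ((hasDerivAt_id z).sub_const p).div_const _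
    have hSc : ContDiff ℝ ∞ S := (contDiff_id.sub contDiff_const).div_const _
    let G : ℂ → ℂ := fun z ↦ (g (S z) : ℂ)
    have Gd : ContDiff ℝ ∞ G := gc1.comp hSc
    have Gsub : tsupport G ⊆ closedBall p ε := by
      refine closure_minimal (fun z hz ↦ ?_) isClosed_closedBall
      have : S z ∈ ball (0 : ℂ) 1 := g3 (subset_tsupport g fun h0 ↦ hz (by simp [G, h0]))
      rw [mem_ball_zero_iff, norm_div, Complex.norm_real, Real.norm_of_nonneg hε.1.le,
        div_lt_one hε.1] at this
      rw [mem_closedBall, dist_eq_norm]; exact this.le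
    have hεR : closedBall p ε ⊆ ball p R := closedBall_subset_ball hε.2
    have Gc : HasCompactSupport G :=
      (isCompact_closedBall p ε).of_isClosed_subset (isClosed_tsupport _) Gsub
    have e := hw G Gd Gc (Gsub.trans (hεR.trans hRU))
    have hwG : ∀ z, ‖wbar G z‖ ≤ K / ε := fun z ↦ by
      have := wbar_comp_holomorphic (g := fun z ↦ (g z : ℂ)) (hS z)
        (gc1.differentiable (by simp) _)
      change ‖wbar (fun w ↦ ((g (S w) : ℝ) : ℂ)) z‖ ≤ _
      rw [this, norm_mul, RCLike.norm_conj, norm_div, norm_one, Complex.norm_real,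
        Real.norm_of_nonneg hε.1.le, one_div, inv_mul_eq_div]
      exact div_le_div_of_nonneg_right (hK _) hε.1.le
    have e1 : ‖∫ z, Φ z * wbar G z‖ ≤ |C| * K * Real.pi * ε := by
      have : ∫ z, Φ z * wbar G z = ∫ z in closedBall p ε, Φ z * wbar G z := by
        refine (setIntegral_eq_integral_of_forall_compl_eq_zero fun z hz ↦ ?_).symm
        rw [image_eq_zero_of_notMem_tsupport fun h' ↦ hz (Gsub (tsupport_wbar_subset _ h')),
          mul_zero]
      rw [this]
      have hv : volume (closedBall p ε) < ⊤ := (isCompact_closedBall p ε).measure_lt_top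
      refine (norm_setIntegral_le_of_norm_le_const_ae (C := |C| * (K / ε)) hv ?_).trans ?_
      · filter_upwards [ae_mono (Measure.restrict_mono hεR le_rfl) hΦ] with z hz
        rw [norm_mul]
        exact mul_le_mul (hz.trans (le_abs_self C)) (hwG z) (norm_nonneg _) hC0
      · rw [measureReal_def, Complex.volume_closedBall]
        have : (ENNReal.ofReal ε ^ 2 * (NNReal.pi : ENNReal)).toReal = ε ^ 2 * Real.pi := by
          rw [ENNReal.toReal_mul, ENNReal.toReal_pow, ENNReal.toReal_ofReal hε.1.le]
          rfl
        rw [this]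
        have := hε.1.ne'
        apply le_of_eq
        field_simp
    rw [e, norm_neg] at e1
    have e2 : ∫ z, G z ∂ν = ((∫ z, g (S z) ∂ν : ℝ) : ℂ) := integral_complex_ofReal
    rw [e2, Complex.norm_real] at e1
    refine le_trans ?_ ((le_abs_self _).trans e1)
    have hint : Integrable (fun z ↦ g (S z)) ν := by
      have hone : LocallyIntegrableOn (fun _ ↦ (1 : ℂ)) U ν :=
        h.locallyIntegrableOn continuousOn_const
      have := (integrable_mul_of_locallyIntegrableOn hone Gd.continuous Gc
        (Gsub.trans (hεR.trans hRU))).re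
      simpa [G] using this
    calc (ν {p}).toReal = ∫ z, ({p} : Set ℂ).indicator 1 z ∂ν := by
          rw [integral_indicator_one (measurableSet_singleton p)]; rfl
      _ ≤ ∫ z, g (S z) ∂ν := by
          refine integral_mono ?_ hint fun z ↦ ?_
          · exact (integrable_indicator_iff (measurableSet_singleton p)).2
              (integrableOn_const hfin.ne)
          · by_cases hz : z = p
            · simp [hz, S, hg0]
            · simpa [hz] using (g5 (S z)).1
  have : (ν {p}).toReal ≤ 0 := by
    have ht : Tendsto (fun ε : ℝ ↦ |C| * K * Real.pi * ε) (𝓝[>] 0) (𝓝 0) := by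
      have : Tendsto (fun ε : ℝ ↦ |C| * K * Real.pi * ε) (𝓝 0) (𝓝 (|C| * K * Real.pi * 0)) :=
        (continuous_const.mul continuous_id).tendsto 0
      rw [mul_zero] at this
      exact this.mono_left nhdsWithin_le_nhds
    refine ge_of_tendsto ht ?_
    filter_upwards [Ioo_mem_nhdsGT hR] with ε hε using key ε hε
  have h0 := le_antisymm this ENNReal.toReal_nonneg
  exact ((ENNReal.toReal_eq_zero_iff _).1 h0).resolve_right hfin.ne

/-! ### The Cauchy kernel and the Cauchy-Pompeiu formula -/

/-- The fundamental solution `1 / (π z)` of `∂/∂z̄`. -/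
def cauchyKernel (z : ℂ) : ℂ := 1 / ((Real.pi : ℂ) * z)

theorem measurable_cauchyKernel : Measurable cauchyKernel := by
  unfold cauchyKernel; fun_prop

theorem cauchyKernel_neg (z : ℂ) : cauchyKernel (-z) = -cauchyKernel z := by
  simp [cauchyKernel]

theorem norm_cauchyKernel (z : ℂ) : ‖cauchyKernel z‖ = (Real.pi * ‖z‖)⁻¹ := by
  simp [cauchyKernel, abs_of_pos Real.pi_pos, mul_comm]

/-- In polar coordinates the Jacobian `ρ` cancels the pole. -/
theorem integrableOn_cauchyKernel_ball (R : ℝ) : IntegrableOn cauchyKernel (ball 0 R) := by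
  refine ⟨measurable_cauchyKernel.aestronglyMeasurable, ?_⟩
  rw [hasFiniteIntegral_iff_enorm, ← lintegral_indicator measurableSet_ball,
    ← Complex.lintegral_comp_polarCoord_symm]
  have hle : ∀ q ∈ polarCoord.target, ENNReal.ofReal q.1 • (ball (0 : ℂ) R).indicator
      (fun z ↦ ‖cauchyKernel z‖ₑ) (Complex.polarCoord.symm q) ≤
      (Ioo 0 R ×ˢ Ioo (-Real.pi) Real.pi).indicator (fun _ ↦ ENNReal.ofReal (Real.pi⁻¹)) q := by
    rintro ⟨ρ, θ⟩ ⟨hρ, hθ⟩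
    simp only [mem_Ioi] at hρ
    have hn : ‖Complex.polarCoord.symm (ρ, θ)‖ = ρ := by
      rw [Complex.norm_polarCoord_symm, abs_of_pos hρ]
    by_cases hb : ρ < R
    · rw [indicator_of_mem (by rw [mem_ball_zero_iff, hn]; exact hb),
        indicator_of_mem (show (ρ, θ) ∈ Ioo 0 R ×ˢ Ioo (-Real.pi) Real.pi from ⟨⟨hρ, hb⟩, hθ⟩),
        ← ofReal_norm, norm_cauchyKernel, hn, smul_eq_mul,
        ← ENNReal.ofReal_mul hρ.le]
      apply le_of_eq
      congr 1
      have := hρ.ne'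
      field_simp
    · rw [indicator_of_notMem (by rw [mem_ball_zero_iff, hn]; exact hb)]
      simp
  refine (setLIntegral_mono' polarCoord.open_target.measurableSet hle).trans_lt ?_
  refine (setLIntegral_le_lintegral _ _).trans_lt ?_
  rw [lintegral_indicator (measurableSet_Ioo.prod measurableSet_Ioo), setLIntegral_const,
    Measure.volume_eq_prod, Measure.prod_prod]
  simp only [Real.volume_Ioo]
  finiteness

theorem locallyIntegrable_cauchyKernel : LocallyIntegrable cauchyKernel := fun z ↦
  ⟨ball 0 (‖z‖ + 1), isOpen_ball.mem_nhds (by simp), integrableOn_cauchyKernel_ball _⟩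

theorem integrableOn_of_continuous_polar {F : ℝ × ℝ → ℂ} (hF : Continuous F) {R : ℝ}
    (h0 : ∀ q : ℝ × ℝ, R < q.1 → F q = 0) :
    IntegrableOn F (Ioi 0 ×ˢ Ioo (-Real.pi) Real.pi) := by
  have h1 : IntegrableOn F (Icc 0 R ×ˢ Icc (-Real.pi) Real.pi) :=
    hF.continuousOn.integrableOn_compact (isCompact_Icc.prod isCompact_Icc)
  refine h1.of_forall_sdiff_eq_zero (measurableSet_Ioi.prod measurableSet_Ioo) ?_
  rintro ⟨ρ, θ⟩ ⟨⟨hρ, hθ⟩, hn⟩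
  refine h0 _ ?_
  by_contra hle
  exact hn ⟨⟨le_of_lt hρ, not_lt.1 hle⟩, Ioo_subset_Icc_self hθ⟩

/-- The **Cauchy-Pompeiu formula** for compactly supported functions. -/
theorem integral_cauchyKernel_mul_wbar {g : ℂ → ℂ} (hg : ContDiff ℝ 1 g)
    (hc : HasCompactSupport g) (w : ℂ) :
    ∫ z, cauchyKernel z * wbar g (w - z) = g w := by
  obtain ⟨R, hR⟩ := hc.isBounded.subset_ball w
  let e : ℝ → ℂ := fun θ ↦ Complex.exp (θ * Complex.I)
  have he : Continuous e := by fun_prop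
  have hnorm : ∀ θ, ‖e θ‖ = 1 := fun θ ↦ Complex.norm_exp_ofReal_mul_I θ
  have hout : ∀ q : ℝ × ℝ, |R| < q.1 → w - q.1 * e q.2 ∉ tsupport g := by
    intro q hq h'
    have := hR h'
    rw [mem_ball, dist_eq_norm, sub_sub_cancel_left, norm_neg, norm_mul, hnorm, mul_one,
      Complex.norm_real] at this
    linarith [le_abs_self R, le_abs_self q.1, Real.norm_eq_abs q.1]
  have hfd := hg.continuous_fderiv one_ne_zero
  have hwb := continuous_wbar hg
  -- In polar coordinates around `w`, `F` is half of `P + iQ`. Here `P` is the radial derivative of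
  -- `-g`, which integrates to `g w` along each ray, and `Q` is `1/ρ` times its angular derivative,
  -- which integrates to zero over each circle.
  let F : ℝ × ℝ → ℂ := fun q ↦ (e q.2)⁻¹ * wbar g (w - q.1 * e q.2)
  let P : ℝ × ℝ → ℂ := fun q ↦ fderiv ℝ g (w - q.1 * e q.2) (e q.2)
  have hFc : Continuous F := by
    have h1 : Continuous fun q : ℝ × ℝ ↦ (e q.2)⁻¹ :=
      (he.comp continuous_snd).inv₀ fun q ↦ Complex.exp_ne_zero _
    have h2 : Continuous fun q : ℝ × ℝ ↦ w - q.1 * e q.2 := by fun_prop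
    exact h1.mul (hwb.comp h2)
  have hPc : Continuous P := by
    have h2 : Continuous fun q : ℝ × ℝ ↦ w - q.1 * e q.2 := by fun_prop
    exact (hfd.comp h2).clm_apply (he.comp continuous_snd)
  have hFi : IntegrableOn F (Ioi 0 ×ˢ Ioo (-Real.pi) Real.pi) :=
    integrableOn_of_continuous_polar hFc fun q hq ↦ by
      simp only [F]
      rw [image_eq_zero_of_notMem_tsupport fun h' ↦ hout q hq (tsupport_wbar_subset g h'),
        mul_zero]
  have hPi : IntegrableOn P (Ioi 0 ×ˢ Ioo (-Real.pi) Real.pi) :=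
    integrableOn_of_continuous_polar hPc fun q hq ↦ by
      simp only [P]
      rw [image_eq_zero_of_notMem_tsupport fun h' ↦ hout q hq (tsupport_fderiv_subset ℝ h')]
      rfl
  have hP : ∫ q in Ioi 0 ×ˢ Ioo (-Real.pi) Real.pi, P q = 2 * Real.pi * g w := by
    rw [Measure.volume_eq_prod, ← setIntegral_prod_swap, setIntegral_prod]
    · have : ∀ θ, ∫ ρ in Ioi (0 : ℝ), P (ρ, θ) = g w := by
        intro θ
        have hder : ∀ ρ ∈ Ici (0 : ℝ), HasDerivAt (fun ρ : ℝ ↦ -g (w - ρ * e θ)) (P (ρ, θ)) ρ := by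
          intro ρ _
          have h1 : HasDerivAt (fun ρ : ℝ ↦ w - ρ * e θ) (-(e θ)) ρ := by
            have := ((Complex.ofRealCLM.hasDerivAt (x := ρ)).mul_const (e θ)).const_sub w
            simpa using this
          have := ((hg.differentiable one_ne_zero _).hasFDerivAt.comp_hasDerivAt ρ h1).neg
          rw [map_neg, neg_neg] at this
          exact this
        have hi : IntegrableOn (fun ρ ↦ P (ρ, θ)) (Ioi 0) := by
          have h1 : IntegrableOn (fun ρ ↦ P (ρ, θ)) (Icc 0 |R|) :=
            (hPc.comp (by fun_prop : Continuous fun ρ : ℝ ↦ (ρ, θ))).continuousOn.integrableOn_compact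
              isCompact_Icc
          refine h1.of_forall_sdiff_eq_zero measurableSet_Ioi fun ρ hρ ↦ ?_
          simp only [P]
          rw [image_eq_zero_of_notMem_tsupport fun h' ↦ hout (ρ, θ) ?_ (tsupport_fderiv_subset ℝ h')]
          · rfl
          · by_contra hle
            exact hρ.2 ⟨le_of_lt hρ.1, not_lt.1 hle⟩
        have hlim : Tendsto (fun ρ : ℝ ↦ -g (w - ρ * e θ)) atTop (𝓝 0) := by
          refine tendsto_const_nhds.congr' ?_
          filter_upwards [eventually_gt_atTop |R|] with ρ hρ
          rw [image_eq_zero_of_notMem_tsupport (hout (ρ, θ) hρ), neg_zero]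
        rw [integral_Ioi_of_hasDerivAt_of_tendsto' hder hi hlim]
        simp
      simp only [Prod.swap_prod_mk, this]
      rw [setIntegral_const, measureReal_def, Real.volume_Ioo,
        ENNReal.toReal_ofReal (by linarith [Real.pi_pos])]
      rw [Complex.real_smul]; push_cast; ring
    · exact hPi.swap
  let Q : ℝ × ℝ → ℂ := fun q ↦ fderiv ℝ g (w - q.1 * e q.2) (Complex.I * e q.2)
  have hQc : Continuous Q := by
    have h2 : Continuous fun q : ℝ × ℝ ↦ w - q.1 * e q.2 := by fun_prop
    exact (hfd.comp h2).clm_apply (continuous_const.mul (he.comp continuous_snd))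
  have hQi : IntegrableOn Q (Ioi 0 ×ˢ Ioo (-Real.pi) Real.pi) :=
    integrableOn_of_continuous_polar hQc fun q hq ↦ by
      simp only [Q]
      rw [image_eq_zero_of_notMem_tsupport fun h' ↦ hout q hq (tsupport_fderiv_subset ℝ h')]
      rfl
  have hQ : ∫ q in Ioi 0 ×ˢ Ioo (-Real.pi) Real.pi, Q q = 0 := by
    rw [Measure.volume_eq_prod, setIntegral_prod _ hQi]
    refine setIntegral_eq_zero_of_forall_eq_zero fun ρ hρ ↦ ?_
    have hρ0 : (ρ : ℂ) ≠ 0 := by exact_mod_cast (ne_of_gt hρ)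
    have hder : ∀ θ ∈ uIcc (-Real.pi) Real.pi,
        HasDerivAt (fun θ : ℝ ↦ -(ρ : ℂ)⁻¹ * g (w - ρ * e θ)) (Q (ρ, θ)) θ := by
      intro θ _
      have h0 : HasDerivAt e (Complex.I * e θ) θ := by
        have := (((Complex.ofRealCLM.hasDerivAt (x := θ)).mul_const Complex.I)).cexp
        simp only [Complex.ofRealCLM_apply, Complex.ofReal_one, one_mul] at this
        rw [mul_comm Complex.I]
        exact this
      have h1 := (h0.const_mul (ρ : ℂ)).const_sub w
      have := ((hg.differentiable one_ne_zero _).hasFDerivAt.comp_hasDerivAt θ h1).const_mul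
        (-(ρ : ℂ)⁻¹)
      have hlin : fderiv ℝ g (w - ρ * e θ) (ρ * (Complex.I * e θ)) = ρ * Q (ρ, θ) := by
        have := (fderiv ℝ g (w - ρ * e θ)).map_smul ρ (Complex.I * e θ)
        rwa [Complex.real_smul, Complex.real_smul] at this
      rw [map_neg, hlin, neg_mul_neg, inv_mul_cancel_left₀ hρ0] at this
      exact this
    rw [← integral_Ioc_eq_integral_Ioo,
      ← intervalIntegral.integral_of_le (by linarith [Real.pi_pos]),
      intervalIntegral.integral_eq_sub_of_hasDerivAt hder]
    · have : e Real.pi = e (-Real.pi) := by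
        simp only [e]
        push_cast
        rw [Complex.exp_pi_mul_I, neg_mul, Complex.exp_neg, Complex.exp_pi_mul_I]
        norm_num
      rw [this, sub_self]
    · exact (hQc.comp (by fun_prop : Continuous fun θ : ℝ ↦ (ρ, θ))).intervalIntegrable _ _
  have hF : ∀ q, F q = (1 / 2) * P q + (Complex.I / 2) * Q q := by
    intro q
    have key : ∀ v : ℂ, fderiv ℝ g (w - q.1 * e q.2) v
        = v.re * fderiv ℝ g (w - q.1 * e q.2) 1
          + v.im * fderiv ℝ g (w - q.1 * e q.2) Complex.I := by
      intro v
      have : v = v.re • (1 : ℂ) + v.im • Complex.I := by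
        apply Complex.ext <;> simp
      conv_lhs => rw [this, map_add, map_smul, map_smul]
      simp
    have hinv : (e q.2)⁻¹ = (e q.2).re - (e q.2).im * Complex.I := by
      rw [Complex.inv_def, Complex.normSq_eq_norm_sq, hnorm]
      apply Complex.ext <;> simp
    simp only [F, P, Q, wbar]
    rw [key (e q.2), key (Complex.I * e q.2), hinv]
    simp only [Complex.mul_re, Complex.I_re, Complex.I_im, Complex.mul_im]
    push_cast
    linear_combination (-((e q.2).im * fderiv ℝ g (w - q.1 * e q.2) Complex.I) / 2) * Complex.I_sq
  have hFint : ∫ q in Ioi 0 ×ˢ Ioo (-Real.pi) Real.pi, F q = Real.pi * g w := by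
    simp_rw [hF]
    rw [integral_add (hPi.const_mul _) (hQi.const_mul _), integral_const_mul, integral_const_mul,
      hP, hQ]
    ring
  rw [← Complex.integral_comp_polarCoord_symm, polarCoord_target]
  have hpi : (Real.pi : ℂ) ≠ 0 := by exact_mod_cast Real.pi_ne_zero
  have : ∫ q in Ioi 0 ×ˢ Ioo (-Real.pi) Real.pi, q.1 • (cauchyKernel (Complex.polarCoord.symm q) *
      wbar g (w - Complex.polarCoord.symm q)) =
      ∫ q in Ioi 0 ×ˢ Ioo (-Real.pi) Real.pi, (Real.pi : ℂ)⁻¹ * F q := by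
    refine setIntegral_congr_fun (measurableSet_Ioi.prod measurableSet_Ioo) fun q hq ↦ ?_
    have hq0 : (q.1 : ℂ) ≠ 0 := by exact_mod_cast (ne_of_gt hq.1)
    have hs : Complex.polarCoord.symm q = q.1 * e q.2 := by
      rw [Complex.polarCoord_symm_apply]
      simp only [e]
      rw [Complex.exp_mul_I]
      push_cast; ring
    have he0 : e q.2 ≠ 0 := Complex.exp_ne_zero _
    simp only [F]
    rw [hs, cauchyKernel, Complex.real_smul]
    field_simp
  rw [this, integral_const_mul, hFint]
  field_simp

/-- The solution `G = (1 / (π z)) * g` of the equation `∂G/∂z̄ = g`. -/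
def cauchyConv (g : ℂ → ℂ) (w : ℂ) : ℂ := ∫ z, cauchyKernel (w - z) * g z

open scoped Convolution in
theorem cauchyConv_eq_convolution (g : ℂ → ℂ) :
    cauchyConv g = cauchyKernel ⋆[ContinuousLinearMap.mul ℝ ℂ, volume] g := by
  ext w
  rw [convolution_eq_swap]
  rfl

theorem contDiff_cauchyConv {g : ℂ → ℂ} (hg : ContDiff ℝ ∞ g) (hc : HasCompactSupport g) :
    ContDiff ℝ ∞ (cauchyConv g) := by
  rw [cauchyConv_eq_convolution]
  exact hc.contDiff_convolution_right _ locallyIntegrable_cauchyKernel hg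

theorem wbar_cauchyConv {g : ℂ → ℂ} (hg : ContDiff ℝ 1 g) (hc : HasCompactSupport g) (w : ℂ) :
    wbar (cauchyConv g) w = g w := by
  have h := (hc.hasFDerivAt_convolution_right (ContinuousLinearMap.mul ℝ ℂ) (μ := volume)
    locallyIntegrable_cauchyKernel hg w).fderiv
  rw [← integral_cauchyKernel_mul_wbar hg hc w, cauchyConv_eq_convolution]
  unfold wbar
  rw [h]
  have hi : ConvolutionExistsAt cauchyKernel (fderiv ℝ g) w
      (ContinuousLinearMap.precompR ℂ (ContinuousLinearMap.mul ℝ ℂ)) volume :=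
    (hc.fderiv ℝ).convolutionExists_right _ locallyIntegrable_cauchyKernel
      (hg.continuous_fderiv one_ne_zero) w
  have hv : ∀ v, (convolution cauchyKernel (fderiv ℝ g)
      (ContinuousLinearMap.precompR ℂ (ContinuousLinearMap.mul ℝ ℂ)) volume w) v =
      ∫ z, cauchyKernel z * fderiv ℝ g (w - z) v := fun v ↦ by
    rw [convolution_def, ContinuousLinearMap.integral_apply hi]
    rfl
  have hiv : ∀ v, Integrable fun z ↦ cauchyKernel z * fderiv ℝ g (w - z) v := fun v ↦
    ContinuousLinearMap.integrable_comp (ContinuousLinearMap.apply ℝ ℂ v) hi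
  rw [hv, hv, ← integral_const_mul, ← integral_add (hiv _) ((hiv _).const_mul _),
    ← integral_div]
  congr 1
  ext z
  ring

/-! ### Cauchy transforms -/

/-- Within distance `1` of the pole the kernel is integrable and `g` is bounded; farther away the
kernel is at most `1/π` and `g` has compact support. Uniformity in `w` is what makes Fubini's
theorem applicable against an arbitrary integrable density. -/
theorem lintegral_enorm_mul_cauchyKernel_le {g : ℂ → ℂ} (hg : Continuous g)
    (hc : HasCompactSupport g) :
    ∃ B : ENNReal, B ≠ ⊤ ∧ ∀ w, ∫⁻ z, ‖g z * cauchyKernel (z - w)‖ₑ ≤ B := by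
  obtain ⟨C, hC⟩ := hg.bounded_above_of_compact_support hc
  let k : ℂ → ENNReal := (ball 0 1).indicator fun z ↦ ‖cauchyKernel z‖ₑ
  have hk : Measurable k := measurable_cauchyKernel.enorm.indicator measurableSet_ball
  have hk1 : ∫⁻ z, k z < ⊤ := by
    rw [lintegral_indicator measurableSet_ball]
    exact (integrableOn_cauchyKernel_ball 1).2
  refine ⟨ENNReal.ofReal C * (∫⁻ z, k z) + ENNReal.ofReal (C * Real.pi⁻¹) * volume (tsupport g),
    ?_, fun w ↦ ?_⟩
  · have : volume (tsupport g) < ⊤ := hc.measure_lt_top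
    finiteness
  have hle : ∀ z, ‖g z * cauchyKernel (z - w)‖ₑ ≤ ENNReal.ofReal C * k (z - w) +
      (tsupport g).indicator (fun _ ↦ ENNReal.ofReal (C * Real.pi⁻¹)) z := by
    intro z
    have hCz : ‖g z‖ₑ ≤ ENNReal.ofReal C := by
      rw [← ofReal_norm]; exact ENNReal.ofReal_le_ofReal (hC z)
    by_cases hz : z ∈ tsupport g
    · by_cases hb : z - w ∈ ball (0 : ℂ) 1
      · simp only [k, indicator_of_mem hb, enorm_mul]
        exact le_add_right (mul_le_mul_left hCz _)
      · rw [indicator_of_mem hz]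
        refine le_add_left ?_
        rw [← ofReal_norm, norm_mul, norm_cauchyKernel]
        refine ENNReal.ofReal_le_ofReal ?_
        refine mul_le_mul (hC z) ?_ (by positivity) ((norm_nonneg _).trans (hC z))
        rw [mem_ball_zero_iff, not_lt] at hb
        refine inv_anti₀ Real.pi_pos ?_
        nlinarith [Real.pi_pos]
    · simp [image_eq_zero_of_notMem_tsupport hz]
  refine (lintegral_mono hle).trans ?_
  have hkw : Measurable fun z ↦ k (z - w) := hk.comp (measurable_sub_const w)
  rw [lintegral_add_left (hkw.const_mul _), lintegral_const_mul _ hkw,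
    lintegral_indicator hc.isClosed.measurableSet, setLIntegral_const,
    lintegral_sub_right_eq_self (fun z ↦ k z) w]

theorem integrable_prod_cauchyKernel {g h : ℂ → ℂ} {μ : Measure ℂ} [SFinite μ]
    (hg : Continuous g) (hc : HasCompactSupport g) (hh : Integrable h μ) :
    Integrable (fun q : ℂ × ℂ ↦ g q.1 * cauchyKernel (q.1 - q.2) * h q.2) (volume.prod μ) := by
  have hm : AEStronglyMeasurable
      (fun q : ℂ × ℂ ↦ g q.1 * cauchyKernel (q.1 - q.2) * h q.2) (volume.prod μ) := by
    refine AEStronglyMeasurable.mul ?_ hh.1.comp_snd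
    have : Measurable fun q : ℂ × ℂ ↦ g q.1 * cauchyKernel (q.1 - q.2) :=
      (hg.measurable.comp measurable_fst).mul
        (measurable_cauchyKernel.comp (measurable_fst.sub measurable_snd))
    exact this.aestronglyMeasurable
  refine ⟨hm, ?_⟩
  obtain ⟨B, hB, hle⟩ := lintegral_enorm_mul_cauchyKernel_le hg hc
  rw [hasFiniteIntegral_iff_enorm, lintegral_prod_symm _ hm.enorm]
  calc ∫⁻ w, ∫⁻ z, ‖g z * cauchyKernel (z - w) * h w‖ₑ ∂volume ∂μ
      ≤ ∫⁻ w, B * ‖h w‖ₑ ∂μ := by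
        refine lintegral_mono fun w ↦ ?_
        simp only [enorm_mul (_ * _) (h w)]
        rw [lintegral_mul_const]
        · exact mul_le_mul_left (hle w) _
        · exact (hg.measurable.mul (measurable_cauchyKernel.comp (measurable_sub_const w))).enorm
    _ = B * ∫⁻ w, ‖h w‖ₑ ∂μ := lintegral_const_mul' _ _ hB
    _ < ⊤ := ENNReal.mul_lt_top hB.lt_top hh.2

/-- The Cauchy transform of the complex measure `h dμ`. -/
def cauchyTransformWith (μ : Measure ℂ) (h : ℂ → ℂ) (z : ℂ) : ℂ :=
  ∫ w, cauchyKernel (z - w) * h w ∂μ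

/-- Fubini's theorem; the sign comes from the oddness of the kernel. -/
theorem integral_mul_cauchyTransformWith {g h : ℂ → ℂ} {μ : Measure ℂ} [SFinite μ]
    (hg : Continuous g) (hc : HasCompactSupport g) (hh : Integrable h μ) :
    ∫ z, g z * cauchyTransformWith μ h z = -∫ w, h w * cauchyConv g w ∂μ := by
  have hi := integrable_prod_cauchyKernel hg hc hh
  have h1 : ∀ z, g z * cauchyTransformWith μ h z =
      ∫ w, g z * cauchyKernel (z - w) * h w ∂μ := fun z ↦ by
    simp only [cauchyTransformWith, mul_assoc]
    rw [integral_const_mul]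
  have h2 : ∀ w, h w * cauchyConv g w = -∫ z, g z * cauchyKernel (z - w) * h w := fun w ↦ by
    simp only [cauchyConv]
    rw [← integral_const_mul, ← integral_neg]
    congr 1
    ext z
    rw [← neg_sub z w, cauchyKernel_neg]
    ring
  simp_rw [h1, h2]
  rw [integral_neg, neg_neg]
  exact integral_integral_swap hi

theorem ae_integrable_cauchyKernel {h : ℂ → ℂ} {μ : Measure ℂ} [SFinite μ]
    (hh : Integrable h μ) {K : Set ℂ} (hK : IsCompact K) :
    ∀ᵐ z, z ∈ K → Integrable (fun w ↦ cauchyKernel (z - w) * h w) μ := by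
  obtain ⟨χ, c1, c2, -, c4, -⟩ := exists_contDiff_cutoff hK isOpen_univ (subset_univ K)
  have c1' := contDiff_ofReal_comp (n := ⊤) c1
  have hc : HasCompactSupport fun z ↦ (χ z : ℂ) := by
    unfold HasCompactSupport; rw [tsupport_ofReal_comp]; exact c2
  filter_upwards [(integrable_prod_cauchyKernel c1'.continuous hc hh).prod_right_ae] with z hz hzK
  simpa [c4.self_of_nhdsSet z hzK] using hz

theorem locallyIntegrable_cauchyTransformWith {h : ℂ → ℂ} {μ : Measure ℂ} [SFinite μ]
    (hh : Integrable h μ) : LocallyIntegrable (cauchyTransformWith μ h) := by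
  refine locallyIntegrable_iff.2 fun K hK ↦ ?_
  obtain ⟨χ, c1, c2, -, c4, -⟩ := exists_contDiff_cutoff hK isOpen_univ (subset_univ K)
  have c1' := contDiff_ofReal_comp (n := ⊤) c1
  have hc : HasCompactSupport fun z ↦ (χ z : ℂ) := by
    unfold HasCompactSupport; rw [tsupport_ofReal_comp]; exact c2
  refine ((integrable_prod_cauchyKernel c1'.continuous hc hh).integral_prod_left.integrableOn
    (s := K)).congr_fun (fun z hz ↦ ?_) hK.isClosed.measurableSet
  simp [cauchyTransformWith, c4.self_of_nhdsSet z hz]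

theorem differentiableOn_cauchyTransformWith {h : ℂ → ℂ} {μ : Measure ℂ} (hh : Integrable h μ)
    {N : Set ℂ} (hN : IsOpen N) (hμ : ∀ᵐ w ∂μ, w ∉ N) :
    DifferentiableOn ℂ (cauchyTransformWith μ h) N := by
  intro z₀ hz₀
  obtain ⟨ε, hε, hsub⟩ := Metric.isOpen_iff.1 hN z₀ hz₀
  have hfar : ∀ w ∉ N, ∀ z ∈ ball z₀ (ε / 2), ε / 2 ≤ ‖z - w‖ := by
    intro w hw z hz
    have h1 : ε ≤ dist w z₀ := not_lt.1 fun h' ↦ hw (hsub h')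
    have h2 := mem_ball.1 hz
    rw [← dist_eq_norm, dist_comm z w]
    linarith [dist_triangle w z z₀]
  have hm : ∀ z, AEStronglyMeasurable (fun w ↦ cauchyKernel (z - w) * h w) μ := fun z ↦
    (measurable_cauchyKernel.comp (measurable_const_sub z)).aestronglyMeasurable.mul hh.1
  have hz₀b : z₀ ∈ ball z₀ (ε / 2) := mem_ball_self (by positivity)
  have := (hasDerivAt_integral_of_dominated_loc_of_deriv_le (μ := μ)
    (F := fun z w ↦ cauchyKernel (z - w) * h w)
    (F' := fun z w ↦ -(1 / (Real.pi * (z - w) ^ 2)) * h w)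
    (bound := fun w ↦ (Real.pi * (ε / 2) ^ 2)⁻¹ * ‖h w‖) (x₀ := z₀)
    (isOpen_ball.mem_nhds hz₀b) (Eventually.of_forall hm) ?_ ?_ ?_ ?_ ?_).2
  · exact this.differentiableAt.differentiableWithinAt
  · refine (hh.norm.const_mul (Real.pi * (ε / 2))⁻¹).mono' (hm z₀) ?_
    filter_upwards [hμ] with w hw
    rw [norm_mul, norm_cauchyKernel]
    refine mul_le_mul_of_nonneg_right (inv_anti₀ (by positivity) ?_) (norm_nonneg _)
    exact mul_le_mul_of_nonneg_left (hfar w hw z₀ hz₀b) Real.pi_pos.le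
  · refine AEStronglyMeasurable.mul ?_ hh.1
    have : Measurable fun w : ℂ ↦ -(1 / (Real.pi * (z₀ - w) ^ 2)) := by fun_prop
    exact this.aestronglyMeasurable
  · filter_upwards [hμ] with w hw z hz
    have hf := hfar w hw z hz
    rw [norm_mul, norm_neg, norm_div, norm_one, one_div, norm_mul, norm_pow, Complex.norm_real,
      Real.norm_of_nonneg Real.pi_pos.le]
    refine mul_le_mul_of_nonneg_right (inv_anti₀ (by positivity) ?_) (norm_nonneg _)
    exact mul_le_mul_of_nonneg_left (pow_le_pow_left₀ (by positivity) hf 2) Real.pi_pos.le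
  · exact hh.norm.const_mul _
  · filter_upwards [hμ] with w hw z hz
    have hne : z - w ≠ 0 := by
      have := hfar w hw z hz
      exact norm_pos_iff.1 (by linarith)
    have hpi : (Real.pi : ℂ) ≠ 0 := by exact_mod_cast Real.pi_ne_zero
    have h1 : HasDerivAt (fun z ↦ (Real.pi : ℂ) * (z - w)) Real.pi z := by
      simpa using ((hasDerivAt_id z).sub_const w).const_mul (Real.pi : ℂ)
    have h2 := (h1.inv (mul_ne_zero hpi hne)).mul_const (h w)
    have e1 : -(Real.pi : ℂ) / (Real.pi * (z - w)) ^ 2 * h w =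
        -(1 / (Real.pi * (z - w) ^ 2)) * h w := by
      field_simp
    rw [e1] at h2
    simpa only [cauchyKernel, one_div] using! h2

/-- Local representation of a function with `∂Φ/∂z̄ = ν` by the Cauchy transform of `ν`. -/
theorem IsMeasureOf.exists_eq_cauchyTransform_add {U : Opens ℂ} {T : 𝓓'(U, ℂ)} {Φ : ℂ → ℂ}
    {ν : Measure ℂ} (h : IsMeasureOf T ν) (hw : IsWeakDbar U Φ ν)
    (hΦ : LocallyIntegrableOn Φ U) {N : Set ℂ} (hN : IsOpen N)
    (hNc : IsCompact (closure N)) (hNU : closure N ⊆ U) :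
    ∃ a : ℂ → ℂ, AnalyticOnNhd ℂ a N ∧
      ∀ᵐ z ∂(volume.restrict N),
        Integrable (fun w : ℂ ↦ 1 / ((Real.pi : ℂ) * (z - w))) (ν.restrict (closure N)) ∧
        Φ z = cauchyTransform (ν.restrict (closure N)) z + a z := by
  obtain ⟨χ, c1, c2, c3, c4, c5⟩ := exists_contDiff_cutoff hNc U.isOpen hNU
  have d1 := contDiff_ofReal_comp (n := ⊤) c1
  have dt := tsupport_ofReal_comp χ
  have dc : HasCompactSupport fun z ↦ (χ z : ℂ) := by
    unfold HasCompactSupport; rw [dt]; exact c2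
  -- The part of `∂(χΦ)/∂z̄ = χν + Φ ∂χ/∂z̄` lying over the closure of `N` is `ν` itself, since `χ =
  -- 1` nearby. The remaining sources sit on `L`, which misses `N`; their Cauchy transforms `a₁` and
  -- `a₂` make up the analytic term.
  set L := tsupport χ \ closure N with hL
  have hNm : MeasurableSet (closure N) := isClosed_closure.measurableSet
  have hLm : MeasurableSet L := c2.isClosed.measurableSet.diff hNm
  have hLN : ∀ w ∈ L, w ∉ N := fun w hw hwN ↦ hw.2 (subset_closure hwN)
  have : IsFiniteMeasure (ν.restrict (closure N)) :=
    ⟨by rw [Measure.restrict_apply_univ]; exact h.finite_compact _ hNc hNU⟩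
  have : IsFiniteMeasure (ν.restrict L) :=
    ⟨by rw [Measure.restrict_apply_univ]
        exact (measure_mono sdiff_subset).trans_lt (h.finite_compact _ c2 c3)⟩
  let b : ℂ → ℂ := fun w ↦ Φ w * wbar (fun z ↦ (χ z : ℂ)) w
  have hwχ : ∀ w, w ∉ L → wbar (fun z ↦ (χ z : ℂ)) w = 0 := by
    intro w hw
    by_cases hwN : w ∈ closure N
    · have : (fun z ↦ (χ z : ℂ)) =ᶠ[𝓝 w] fun _ ↦ 1 := by
        filter_upwards [eventually_nhdsSet_iff_forall.1 c4 w hwN] with z hz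
        simp [hz]
      unfold wbar
      rw [this.fderiv_eq]
      simp
    · exact image_eq_zero_of_notMem_tsupport fun h' ↦
        hw ⟨dt.subset (tsupport_wbar_subset _ h'), hwN⟩
  have hb : Integrable b := integrable_mul_of_locallyIntegrableOn hΦ
    (continuous_wbar (d1.of_le (by simp))) (hasCompactSupport_wbar dc)
    ((tsupport_wbar_subset _).trans (dt.subset.trans c3))
  have hχL : Integrable (fun w ↦ (χ w : ℂ)) (ν.restrict L) :=
    Integrable.of_bound d1.continuous.aestronglyMeasurable 1 (Eventually.of_forall fun w ↦ by
      rw [Complex.norm_real, Real.norm_of_nonneg (c5 w).1]; exact (c5 w).2)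
  have h1N : Integrable (fun _ ↦ (1 : ℂ)) (ν.restrict (closure N)) := integrable_const _
  let a₁ := cauchyTransformWith (volume.restrict L) b
  let a₂ := cauchyTransformWith (ν.restrict L) fun w ↦ (χ w : ℂ)
  let C := cauchyTransformWith (ν.restrict (closure N)) fun _ ↦ 1
  have ha : ∀ μ : Measure ℂ, ∀ᵐ w ∂μ.restrict L, w ∉ N := fun μ ↦
    (ae_restrict_mem hLm).mono hLN
  refine ⟨fun z ↦ a₁ z + a₂ z, ?_, ?_⟩
  · exact DifferentiableOn.analyticOnNhd
      ((differentiableOn_cauchyTransformWith hb.integrableOn hN (ha _)).add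
        (differentiableOn_cauchyTransformWith hχL hN (ha _))) hN
  have hC : ∀ z, cauchyTransform (ν.restrict (closure N)) z = C z := fun z ↦ by
    simp [cauchyTransform, C, cauchyTransformWith, cauchyKernel]
  have hli₁ := locallyIntegrable_cauchyTransformWith (hb.integrableOn (s := L))
  have hli₂ := locallyIntegrable_cauchyTransformWith hχL
  have hli₃ := locallyIntegrable_cauchyTransformWith h1N
  have key : ∀ᵐ z, z ∈ N → Φ z - (C z + (a₁ z + a₂ z)) = 0 := by
    refine hN.ae_eq_zero_of_integral_contDiff_smul_eq_zero ?_ fun g g1 g2 g3 ↦ ?_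
    · exact (hΦ.mono_set (subset_closure.trans hNU)).sub
        ((hli₃.add (hli₁.add hli₂)).locallyIntegrableOn N)
    have e1 := contDiff_ofReal_comp (n := ⊤) g1
    have et := tsupport_ofReal_comp g
    have ec : HasCompactSupport fun z ↦ (g z : ℂ) := by
      unfold HasCompactSupport; rw [et]; exact g2
    set gc : ℂ → ℂ := fun z ↦ (g z : ℂ) with hgc
    -- Since `∂G/∂z̄ = g`, testing the weak equation with `χ G` produces `∫ Φ g`. The factor `χ` is
    -- needed because `G` need not have compact support.
    set G := cauchyConv gc with hG
    have hGd : ContDiff ℝ ∞ G := contDiff_cauchyConv e1 ec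
    have hχG : tsupport (fun z ↦ (χ z : ℂ) * G z) ⊆ tsupport χ :=
      (tsupport_mul_subset_left (f := fun z ↦ (χ z : ℂ))).trans dt.subset
    have hχGc : HasCompactSupport fun z ↦ (χ z : ℂ) * G z :=
      c2.of_isClosed_subset (isClosed_tsupport _) hχG
    have hweak := hw (fun z ↦ (χ z : ℂ) * G z) (d1.mul hGd) hχGc (hχG.trans c3)
    have hgN : ∀ z, z ∉ closure N → g z = 0 := fun z hz ↦
      image_eq_zero_of_notMem_tsupport fun h' ↦ hz (subset_closure (g3 h'))
    have hwm : ∀ z, Φ z * wbar (fun z ↦ (χ z : ℂ) * G z) z = Φ z * gc z + b z * G z := by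
      intro z
      rw [wbar_mul (d1.differentiable (by simp) z) (hGd.differentiable (by simp) z),
        wbar_cauchyConv (e1.of_le (by simp)) ec]
      have : (χ z : ℂ) * gc z = gc z := by
        by_cases hz : z ∈ closure N
        · rw [c4.self_of_nhdsSet z hz]; simp
        · simp [hgc, hgN z hz]
      rw [this]
      simp only [b]
      ring
    have i1 : Integrable fun z ↦ Φ z * gc z := integrable_mul_of_locallyIntegrableOn hΦ
      e1.continuous ec (et.subset.trans (g3.trans (subset_closure.trans hNU)))
    have hbs : tsupport (wbar (fun z ↦ (χ z : ℂ))) ⊆ U :=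
      (tsupport_wbar_subset _).trans (dt.subset.trans c3)
    have i2 : Integrable fun z ↦ b z * G z := by
      have : ∀ z, b z * G z = Φ z * (wbar (fun z ↦ (χ z : ℂ)) z * G z) := fun z ↦ by
        simp only [b]; ring
      simp_rw [this]
      refine integrable_mul_of_locallyIntegrableOn hΦ
        ((continuous_wbar (d1.of_le (by simp))).mul hGd.continuous)
        (hasCompactSupport_wbar dc).mul_right
        ((tsupport_mul_subset_left).trans hbs)
    have i3 : Integrable (fun z ↦ (χ z : ℂ) * G z) ν := by
      have := integrable_mul_of_locallyIntegrableOn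
        (h.locallyIntegrableOn (a := fun _ ↦ (1 : ℂ)) continuousOn_const)
        (d1.mul hGd).continuous hχGc (hχG.trans c3)
      simpa using this
    simp_rw [hwm] at hweak
    rw [integral_add i1 i2] at hweak
    have hsplit : ∫ z, (χ z : ℂ) * G z ∂ν =
        ∫ z in closure N, 1 * G z ∂ν + ∫ z in L, (χ z : ℂ) * G z ∂ν := by
      have hd : Disjoint (closure N) L := disjoint_sdiff_right
      have e3 : ∫ z in closure N, 1 * G z ∂ν = ∫ z in closure N, (χ z : ℂ) * G z ∂ν :=
        setIntegral_congr_fun hNm fun z hz ↦ by simp [c4.self_of_nhdsSet z hz]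
      rw [e3, ← setIntegral_union hd hLm i3.integrableOn i3.integrableOn]
      refine (setIntegral_eq_integral_of_forall_compl_eq_zero fun z hz ↦ ?_).symm
      have : χ z = 0 := image_eq_zero_of_notMem_tsupport fun h' ↦ hz (by
        by_cases hzN : z ∈ closure N
        · exact Or.inl hzN
        · exact Or.inr ⟨h', hzN⟩)
      simp [this]
    have hbL : ∫ z, b z * G z = ∫ z in L, b z * G z := by
      refine (setIntegral_eq_integral_of_forall_compl_eq_zero fun z hz ↦ ?_).symm
      simp [b, hwχ z hz]
    have f1 := integral_mul_cauchyTransformWith e1.continuous ec (hb.integrableOn (s := L))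
    have f2 := integral_mul_cauchyTransformWith e1.continuous ec hχL
    have f3 := integral_mul_cauchyTransformWith e1.continuous ec h1N
    have ji : ∀ {F : ℂ → ℂ}, LocallyIntegrable F → Integrable fun z ↦ gc z * F z := fun {F} hF ↦ by
      simpa only [mul_comm] using integrable_mul_of_locallyIntegrableOn
        (hF.locallyIntegrableOn univ) e1.continuous ec (subset_univ _)
    have hexp : ∀ z, g z • (Φ z - (C z + (a₁ z + a₂ z))) =
        Φ z * gc z - (gc z * C z + (gc z * a₁ z + gc z * a₂ z)) := fun z ↦ by
      rw [Complex.real_smul]; ring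
    have j₁ : Integrable fun z ↦ gc z * a₁ z := ji hli₁
    have j₂ : Integrable fun z ↦ gc z * a₂ z := ji hli₂
    have j₃ : Integrable fun z ↦ gc z * C z := ji hli₃
    have j₁₂ : Integrable fun z ↦ gc z * a₁ z + gc z * a₂ z := j₁.add j₂
    have j : Integrable fun z ↦ gc z * C z + (gc z * a₁ z + gc z * a₂ z) := j₃.add j₁₂
    simp_rw [hexp]
    rw [integral_sub i1 j, integral_add j₃ j₁₂, integral_add j₁ j₂, f1, f2, f3]
    rw [hsplit, hbL] at hweak
    linear_combination hweak
  rw [ae_restrict_iff' hN.measurableSet]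
  filter_upwards [key, ae_integrable_cauchyKernel h1N hNc] with z hz hz' hzN
  refine ⟨by simpa [cauchyKernel] using hz' (subset_closure hzN), ?_⟩
  rw [hC]
  exact sub_eq_zero.1 (hz hzN)

/-! ### Primitives on simply connected domains -/

/-- The complex numbers with the discrete topology. -/
def DiscreteComplex : Type := ℂ

instance : TopologicalSpace DiscreteComplex := ⊥

instance : DiscreteTopology DiscreteComplex := ⟨rfl⟩

/-- The covering space of germs of primitives of `A`, built from primitives `P u` on the balls
`ball u (ρ u)`. -/
def primitiveCore (U : Opens ℂ) (A : ℂ → ℂ) (ρ : U → ℝ) (P : U → ℂ → ℂ) (hρ : ∀ u, 0 < ρ u)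
    (hP : ∀ u : U, ∀ z ∈ ball (u : ℂ) (ρ u), HasDerivAt (P u) (A z) z) :
    FiberBundleCore U U DiscreteComplex where
  baseSet u := (↑) ⁻¹' ball (u : ℂ) (ρ u)
  isOpen_baseSet u := isOpen_ball.preimage continuous_subtype_val
  indexAt u := u
  mem_baseSet_at u := mem_ball_self (hρ u)
  -- The coordinate `v` in the chart `i` stands for the germ of `P i + v`, which equals `P j` plus
  -- the new coordinate. The change is locally constant in `x`, so the discrete topology on the
  -- fibre is legitimate.
  coordChange i j x v := (id v : ℂ) + P i x - P j x
  coordChange_self i x _ v := add_sub_cancel_right (id v : ℂ) _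
  continuousOn_coordChange i j := by
    rintro ⟨x₀, v₀⟩ ⟨⟨hi, hj⟩, -⟩
    have hconv : Convex ℝ (ball (i : ℂ) (ρ i) ∩ ball (j : ℂ) (ρ j)) :=
      (convex_ball _ _).inter (convex_ball _ _)
    have hder : ∀ z ∈ ball (i : ℂ) (ρ i) ∩ ball (j : ℂ) (ρ j),
        HasDerivWithinAt (fun z ↦ P i z - P j z) 0 (ball (i : ℂ) (ρ i) ∩ ball (j : ℂ) (ρ j)) z :=
      fun z hz ↦ by
        have h := ((hP i z hz.1).sub (hP j z hz.2)).hasDerivWithinAt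
          (s := ball (i : ℂ) (ρ i) ∩ ball (j : ℂ) (ρ j))
        rw [sub_self] at h
        exact h
    have hconst : ∀ z ∈ ball (i : ℂ) (ρ i) ∩ ball (j : ℂ) (ρ j),
        P i z - P j z = P i x₀ - P j x₀ := fun z hz ↦ by
      have := hconv.norm_image_sub_le_of_norm_hasDerivWithin_le (C := 0) hder (by simp)
        (x := (x₀ : ℂ)) ⟨hi, hj⟩ hz
      simpa [sub_eq_zero] using this
    let c : DiscreteComplex := (id ((id v₀ : ℂ) + P i x₀ - P j x₀) : ℂ)
    refine (continuousWithinAt_const (b := c)).congr_of_eventuallyEq ?_ rfl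
    have h2 : ∀ᶠ q : U × DiscreteComplex in 𝓝 (x₀, v₀), q.2 = v₀ :=
      (continuous_snd.tendsto (x₀, v₀)) ((isOpen_discrete {v₀}).mem_nhds rfl)
    filter_upwards [self_mem_nhdsWithin, mem_nhdsWithin_of_mem_nhds h2] with q hq hq2
    have := hconst q.1 hq.1
    change (id q.2 : ℂ) + P i q.1 - P j q.1 = (id v₀ : ℂ) + P i x₀ - P j x₀
    rw [show q.2 = v₀ from hq2, add_sub_assoc, this, add_sub_assoc]
  coordChange_comp i j k x _ v := by
    change (id v : ℂ) + P i x - P j x + P j x - P k x = (id v : ℂ) + P i x - P k x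
    ring

/-- A primitive is a continuous section of the covering space of germs of primitives. Over a simply
connected base the identity map lifts, and the lift is such a section. -/
theorem exists_isPrimitiveFrom {U : Opens ℂ} (hU : IsSimplyConnected (U : Set ℂ)) {p : ℂ}
    (hp : p ∈ U) {A : ℂ → ℂ} (hA : AnalyticOnNhd ℂ A U) : ∃ F, IsPrimitiveFrom U p A F := by
  have hball : ∀ u : U, ∃ ρ > 0, ball (u : ℂ) ρ ⊆ U := fun u ↦
    Metric.isOpen_iff.1 U.isOpen u u.2
  choose ρ hρ hsub using hball
  have hprim : ∀ u : U, ∃ P : ℂ → ℂ, ∀ z ∈ ball (u : ℂ) (ρ u), HasDerivAt P (A z) z := fun u ↦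
    (hA.differentiableOn.mono (hsub u)).isExactOn_ball
  choose P hP using hprim
  let Z := primitiveCore U A ρ P hρ hP
  have : SimplyConnectedSpace U := hU.simplyConnectedSpace
  have : LocallyPathConnectedSpace U := U.isOpen.locallyPathConnectedSpace
  have hcov : IsCoveringMap (Bundle.TotalSpace.proj : Z.TotalSpace → U) :=
    FiberBundle.isCoveringMap
  obtain ⟨s, ⟨-, hs⟩, -⟩ := hcov.existsUnique_continuousMap_lifts (ContinuousMap.id U)
    ⟨p, hp⟩ ⟨⟨p, hp⟩, (0 : ℂ)⟩ rfl
  have hs1 : ∀ u : U, (s u).1 = u := fun u ↦ congr($hs u)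
  -- The preferred chart at `u` is the one indexed by `u`, so the chosen germ takes the value `V u +
  -- P u u` at `u`.
  let V : U → ℂ := fun u ↦ (s u).2
  have hex : ∃ F : ℂ → ℂ, ∀ u : U, F u = V u + P u u := by
    classical
    exact ⟨fun z ↦ if hz : z ∈ U then V ⟨z, hz⟩ + P ⟨z, hz⟩ z else 0, by simp⟩
  obtain ⟨F, hF⟩ := hex
  have hder : ∀ u : U, HasDerivAt F (A u) u := by
    intro u
    have hcont : ContinuousAt (fun z : U ↦ (Z.localTriv u (s z)).2) u := by
      have h1 : ContinuousAt (Z.localTriv u) (s u) := by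
        refine (Z.localTriv u).continuousAt ?_
        rw [Z.mem_localTriv_source, hs1]
        exact mem_ball_self (hρ u)
      exact continuous_snd.continuousAt.comp (h1.comp s.continuous.continuousAt)
    have hloc : ∀ᶠ z : U in 𝓝 u, (Z.localTriv u (s z)).2 = (Z.localTriv u (s u)).2 :=
      hcont.eventually_mem ((isOpen_discrete {_}).mem_nhds rfl)
    have hval : ∀ z : U, (Z.localTriv u (s z)).2 = (F z - P u z : ℂ) := by
      intro z
      rw [Z.localTriv_apply]
      have : Z.coordChange (Z.indexAt (s z).1) u (s z).1 (s z).2 =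
          (V z + P (s z).1 (s z).1 - P u (s z).1 : ℂ) := rfl
      change Z.coordChange (Z.indexAt (s z).1) u (s z).1 (s z).2 = _
      rw [this, hs1, hF]
    have hloc' : ∀ᶠ z : ℂ in 𝓝 (u : ℂ), F z = P u z + (F u - P u u) := by
      have h2 : ∀ᶠ z in map ((↑) : U → ℂ) (𝓝 u), F z = P u z + (F u - P u u) := by
        rw [eventually_map]
        filter_upwards [hloc] with z hz
        rw [hval, hval] at hz
        have hz' : F z - P u z = F u - P u u := hz
        rw [← hz']; ring
      rwa [map_nhds_subtype_coe_eq_nhds u.2 (U.isOpen.mem_nhds u.2)] at h2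
    exact ((hP u u (mem_ball_self (hρ u))).add_const _).congr_of_eventuallyEq hloc'
  exact ⟨fun z ↦ F z - F p, sub_self _, fun z hz ↦ (hder ⟨z, hz⟩).sub_const _⟩

/-! ### Mollification -/

/-- The convolution of `f` with a normed bump function. -/
def mollify (φ : ContDiffBump (0 : ℂ)) (f : ℂ → ℂ) : ℂ → ℂ :=
  convolution (φ.normed volume) f (ContinuousLinearMap.lsmul ℝ ℝ) volume

theorem mollify_eq (φ : ContDiffBump (0 : ℂ)) (f : ℂ → ℂ) (z : ℂ) :
    mollify φ f z = ∫ t, φ.normed volume (z - t) • f t := by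
  rw [mollify, convolution_eq_swap]
  rfl

theorem contDiff_mollify (φ : ContDiffBump (0 : ℂ)) {f : ℂ → ℂ} (hf : LocallyIntegrable f) :
    ContDiff ℝ ∞ (mollify φ f) :=
  φ.hasCompactSupport_normed.contDiff_convolution_left _ φ.contDiff_normed hf

theorem hasCompactSupport_bump_sub (φ : ContDiffBump (0 : ℂ)) (z : ℂ) :
    HasCompactSupport fun t ↦ φ.normed volume (z - t) :=
  φ.hasCompactSupport_normed.comp_homeomorph (Homeomorph.subLeft z)

theorem integrable_bump_smul (φ : ContDiffBump (0 : ℂ)) {f : ℂ → ℂ} (hf : LocallyIntegrable f)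
    (z : ℂ) : Integrable fun t ↦ φ.normed volume (z - t) • f t :=
  hf.integrable_smul_left_of_hasCompactSupport
    (φ.continuous_normed.comp (continuous_const.sub continuous_id))
    (hasCompactSupport_bump_sub φ z)

theorem integral_bump_sub (φ : ContDiffBump (0 : ℂ)) (z : ℂ) :
    ∫ t, φ.normed volume (z - t) = 1 := by
  rw [integral_sub_left_eq_self (fun t ↦ φ.normed volume t) volume z, φ.integral_normed]

/-- Mollification averages `f` against a probability density on a small ball, so one-sided bounds on
real linear forms persist. This transfers directional monotonicity from `f` to its smooth
approximations. -/
theorem re_mul_mollify_le (φ : ContDiffBump (0 : ℂ)) {f : ℂ → ℂ} (hf : LocallyIntegrable f)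
    {z u : ℂ} {κ : ℝ}
    (h : ∀ᵐ t ∂volume.restrict (ball z φ.rOut), (u * f t).re ≤ κ) :
    (u * mollify φ f z).re ≤ κ := by
  have hi := (integrable_bump_smul φ hf z).const_mul u
  have e : (u * mollify φ f z).re = ∫ t, (u * (φ.normed volume (z - t) • f t)).re := by
    rw [mollify_eq, ← integral_const_mul]
    exact (integral_re hi).symm
  rw [e]
  have hb : Integrable fun t ↦ φ.normed volume (z - t) :=
    (φ.continuous_normed.comp (continuous_const.sub continuous_id)).integrable_of_hasCompactSupport
      (hasCompactSupport_bump_sub φ z)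
  calc _ ≤ ∫ t, φ.normed volume (z - t) * κ := by
        refine integral_mono_ae hi.re (hb.mul_const κ) ?_
        rw [ae_restrict_iff' measurableSet_ball] at h
        filter_upwards [h] with t ht
        have e1 : (u * (φ.normed volume (z - t) • f t)).re
            = φ.normed volume (z - t) * (u * f t).re := by
          rw [mul_smul_comm, Complex.real_smul, Complex.re_ofReal_mul]
        change (u * (φ.normed volume (z - t) • f t)).re ≤ _
        rw [e1]
        by_cases hz : t ∈ ball z φ.rOut
        · exact mul_le_mul_of_nonneg_left (ht hz) (φ.nonneg_normed _)
        · have : φ.normed volume (z - t) = 0 := by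
            rw [← Function.notMem_support, φ.support_normed_eq]
            simpa [dist_eq_norm, norm_sub_rev] using hz
          simp [this]
    _ = κ := by rw [integral_mul_const, integral_bump_sub, one_mul]

theorem norm_mollify_le (φ : ContDiffBump (0 : ℂ)) {f : ℂ → ℂ} (hf : LocallyIntegrable f)
    {C : ℝ} (hC : ∀ z, ‖f z‖ ≤ C) (z : ℂ) : ‖mollify φ f z‖ ≤ C := by
  -- With the conjugate of the value as direction, the bounded linear form is the squared norm.
  have h := re_mul_mollify_le φ hf (z := z) (u := (starRingEnd ℂ) (mollify φ f z))
    (κ := ‖mollify φ f z‖ * C) (Eventually.of_forall fun t ↦ (Complex.re_le_norm _).trans (by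
      rw [norm_mul, Complex.norm_conj]
      exact mul_le_mul_of_nonneg_left (hC t) (norm_nonneg _)))
  rw [mul_comm, Complex.mul_conj, Complex.ofReal_re, Complex.normSq_eq_norm_sq, sq] at h
  rcases (norm_nonneg (mollify φ f z)).eq_or_lt with h0 | h0
  · rw [← h0]; exact (norm_nonneg _).trans (hC 0)
  · exact le_of_mul_le_mul_left h h0

theorem fderiv_mollify (φ : ContDiffBump (0 : ℂ)) {f : ℂ → ℂ} (hf : LocallyIntegrable f)
    (z v : ℂ) :
    fderiv ℝ (mollify φ f) z v = ∫ t, fderiv ℝ (φ.normed volume) (z - t) v • f t := by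
  have h := (φ.hasCompactSupport_normed (μ := volume)).hasFDerivAt_convolution_left (μ := volume)
    (ContinuousLinearMap.lsmul ℝ ℝ) (φ.contDiff_normed (n := 1)) hf z
  rw [mollify, h.fderiv, convolution_eq_swap, ContinuousLinearMap.integral_apply]
  · rfl
  have := ((φ.hasCompactSupport_normed (μ := volume)).fderiv ℝ).convolutionExists_left
    (μ := volume) ((ContinuousLinearMap.lsmul ℝ ℝ : ℝ →L[ℝ] ℂ →L[ℝ] ℂ).precompL ℂ)
    ((φ.contDiff_normed (n := 1)).continuous_fderiv one_ne_zero) hf z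
  exact (convolutionExistsAt_iff_integrable_swap).1 this

/-- The derivative falls on the bump, which is a real test function in `t`; the weak equation for
`f` therefore shows that the mollifications have real `∂/∂z̄`. -/
theorem wbar_mollify (φ : ContDiffBump (0 : ℂ)) {f : ℂ → ℂ} (hf : LocallyIntegrable f)
    (z : ℂ) :
    wbar (mollify φ f) z = -∫ t, f t * wbar (fun t ↦ (φ.normed volume (z - t) : ℂ)) t := by
  have hcd : ContDiff ℝ 1 (φ.normed volume) := φ.contDiff_normed (n := 1)
  have hd : ∀ t v, fderiv ℝ (fun t ↦ (φ.normed volume (z - t) : ℂ)) t v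
      = -(fderiv ℝ (φ.normed volume) (z - t) v : ℂ) := by
    intro t v
    rw [fderiv_ofReal_comp (g := fun t ↦ φ.normed volume (z - t))
      ((hcd.differentiable one_ne_zero _).comp t (by fun_prop))]
    have := ((hcd.differentiable one_ne_zero (z - t)).hasFDerivAt.comp t
      ((hasFDerivAt_id t).const_sub z)).fderiv
    have := congr($this v)
    change fderiv ℝ (fun t ↦ φ.normed volume (z - t)) t v = _ at this
    rw [this]
    simp
  have hi : ∀ v, Integrable fun t ↦ fderiv ℝ (φ.normed volume) (z - t) v • f t := by
    intro v
    refine hf.integrable_smul_left_of_hasCompactSupport ?_ ?_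
    · have := hcd.continuous_fderiv one_ne_zero
      fun_prop
    · exact (φ.hasCompactSupport_normed.fderiv_apply ℝ v).comp_homeomorph (Homeomorph.subLeft z)
  unfold wbar
  rw [fderiv_mollify φ hf, fderiv_mollify φ hf]
  simp_rw [hd]
  have : ∀ t, f t * ((-(fderiv ℝ (φ.normed volume) (z - t) 1 : ℂ)
      + Complex.I * -(fderiv ℝ (φ.normed volume) (z - t) Complex.I : ℂ)) / 2)
      = -((1 / 2) * (fderiv ℝ (φ.normed volume) (z - t) 1 • f t)
        + (Complex.I / 2) * (fderiv ℝ (φ.normed volume) (z - t) Complex.I • f t)) := by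
    intro t
    simp only [Complex.real_smul]
    ring
  simp_rw [this]
  rw [integral_neg, integral_add ((hi _).const_mul _) ((hi _).const_mul _), integral_const_mul,
    integral_const_mul]
  ring

/-! ### Functions with a prescribed gradient and the Laplacian -/

/-- The Laplacian of a real valued function. -/
def lap (g : ℂ → ℝ) (z : ℂ) : ℝ :=
  fderiv ℝ (fun w ↦ fderiv ℝ g w 1) z 1 + fderiv ℝ (fun w ↦ fderiv ℝ g w Complex.I) z Complex.I

/-- The real linear form `v ↦ Re (a v)`, depending linearly on `a`. -/
def reForm : ℂ →L[ℝ] ℂ →L[ℝ] ℝ :=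
  ContinuousLinearMap.compL ℝ ℂ ℂ ℝ Complex.reCLM ∘L ContinuousLinearMap.mul ℝ ℂ

theorem reForm_apply (a v : ℂ) : reForm a v = (a * v).re := rfl

theorem norm_reForm_le (a : ℂ) : ‖reForm a‖ ≤ ‖a‖ :=
  ContinuousLinearMap.opNorm_le_bound _ (norm_nonneg _) fun v ↦ by
    rw [reForm_apply, ← norm_mul]
    exact Complex.abs_re_le_norm _

theorem hasFDerivAt_re_of_hasDerivAt {F : ℂ → ℂ} {a z : ℂ} (h : HasDerivAt F a z) :
    HasFDerivAt (fun w ↦ (F w).re) (reForm a) z := by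
  have h1 := Complex.reCLM.hasFDerivAt.comp z (h.hasFDerivAt.restrictScalars ℝ)
  refine h1.congr_fderiv ?_
  ext v
  all_goals simp [reForm_apply, mul_comm]

theorem tsupport_lap_subset (g : ℂ → ℝ) : tsupport (lap g) ⊆ tsupport g := by
  refine closure_minimal (fun z hz ↦ ?_) (isClosed_tsupport g)
  by_contra hzg
  apply hz
  have h : ∀ v, fderiv ℝ (fun w ↦ fderiv ℝ g w v) z = 0 := fun v ↦ by
    by_contra h
    exact hzg (tsupport_fderiv_apply_subset ℝ v
      (support_fderiv_subset ℝ (f := fun w ↦ fderiv ℝ g w v) h))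
  simp [lap, h]

theorem contDiff_fderiv_apply_const {g : ℂ → ℝ} (hg : ContDiff ℝ ∞ g) (v : ℂ) :
    ContDiff ℝ ∞ fun w ↦ fderiv ℝ g w v :=
  (hg.fderiv_right (m := ∞) le_rfl).clm_apply contDiff_const

theorem continuous_lap {g : ℂ → ℝ} (hg : ContDiff ℝ ∞ g) : Continuous (lap g) := by
  have h : ∀ v, Continuous fun z ↦ fderiv ℝ (fun w ↦ fderiv ℝ g w v) z v := fun v ↦
    (contDiff_fderiv_apply_const (contDiff_fderiv_apply_const hg v) v).continuous
  exact (h 1).add (h Complex.I)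

/-- Here `a = 2 ∂ψ/∂z`, so `2 Re (a ∂g/∂z̄)` is the scalar product of the gradients of `ψ` and `g`;
a single integration by parts finishes, and `ψ` need only be `C¹`. -/
theorem integral_mul_lap {O : Set ℂ} (hO : IsOpen O) {ψ : ℂ → ℝ} {a : ℂ → ℂ}
    (h : ∀ z ∈ O, HasFDerivAt ψ (reForm (a z)) z) (ha : ContinuousOn a O) {g : ℂ → ℝ}
    (hg : ContDiff ℝ ∞ g) (hc : HasCompactSupport g) (hs : tsupport g ⊆ O) :
    ∫ z, ψ z * lap g z = -2 * (∫ z, a z * wbar (fun w ↦ (g w : ℂ)) z).re := by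
  have hψ : ContinuousOn ψ O := fun z hz ↦ (h z hz).continuousAt.continuousWithinAt
  have hsub : ∀ v, tsupport (fun w ↦ fderiv ℝ g w v) ⊆ tsupport g := fun v ↦
    tsupport_fderiv_apply_subset ℝ v
  have hcs : ∀ v, HasCompactSupport fun w ↦ fderiv ℝ g w v := fun v ↦
    hc.of_isClosed_subset (isClosed_tsupport _) (hsub v)
  have key : ∀ v, ∫ z, ψ z * fderiv ℝ (fun w ↦ fderiv ℝ g w v) z v
      = -∫ z, reForm (a z) v * fderiv ℝ g z v := fun v ↦
    integral_mul_fderiv_of_continuousOn hO h (reForm.continuous.comp_continuousOn ha)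
      ((contDiff_fderiv_apply_const hg v).of_le (by simp)) (hcs v) ((hsub v).trans hs) v
  have hi : ∀ v, Integrable fun z ↦ ψ z * fderiv ℝ (fun w ↦ fderiv ℝ g w v) z v := fun v ↦
    integrable_mul_of_locallyIntegrableOn (hψ.locallyIntegrableOn hO.measurableSet)
      (contDiff_fderiv_apply_const (contDiff_fderiv_apply_const hg v) v).continuous
      ((hcs v).fderiv_apply ℝ v)
      (((tsupport_fderiv_apply_subset ℝ v).trans (hsub v)).trans hs)
  have hi' : ∀ v, Integrable fun z ↦ reForm (a z) v * fderiv ℝ g z v := fun v ↦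
    integrable_mul_of_locallyIntegrableOn
      (((reForm.continuous.comp_continuousOn ha).clm_apply
        continuousOn_const).locallyIntegrableOn hO.measurableSet)
      (contDiff_fderiv_apply_const hg v).continuous (hcs v) ((hsub v).trans hs)
  have hgc := contDiff_ofReal_comp hg
  have hw : Integrable fun z ↦ a z * wbar (fun w ↦ (g w : ℂ)) z :=
    integrable_mul_of_locallyIntegrableOn (ha.locallyIntegrableOn hO.measurableSet)
      (continuous_wbar (hgc.of_le (by simp)))
      (hasCompactSupport_wbar (hc.comp_left (g := fun x : ℝ ↦ (x : ℂ)) Complex.ofReal_zero))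
      ((tsupport_wbar_subset _).trans ((tsupport_ofReal_comp g).subset.trans hs))
  have e1 : (∫ z, a z * wbar (fun w ↦ (g w : ℂ)) z).re
      = ∫ z, (a z * wbar (fun w ↦ (g w : ℂ)) z).re := (integral_re hw).symm
  have e2 : ∀ z, (a z * wbar (fun w ↦ (g w : ℂ)) z).re
      = (1 / 2) * (reForm (a z) 1 * fderiv ℝ g z 1
        + reForm (a z) Complex.I * fderiv ℝ g z Complex.I) := by
    intro z
    have hd : DifferentiableAt ℝ g z := hg.differentiable (by simp) z
    unfold wbar
    rw [fderiv_ofReal_comp hd, fderiv_ofReal_comp hd]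
    simp [reForm_apply]
    ring
  rw [e1]
  simp_rw [e2, lap, mul_add]
  rw [integral_add (hi _) (hi _), key, key, integral_add ((hi' _).const_mul _)
    ((hi' _).const_mul _), integral_const_mul, integral_const_mul]
  ring

/-- The curl of the form `Re(a dz)` is a multiple of `Im (∂a/∂z̄)`, so the form is closed, and the
Poincaré lemma applies on a convex set. -/
theorem exists_hasFDerivAt_reForm {O : Set ℂ} (hO : IsOpen O) (hOc : Convex ℝ O) {a : ℂ → ℂ}
    (ha : ContDiff ℝ ∞ a) (h : ∀ z ∈ O, (wbar a z).im = 0) :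
    ∃ ψ : ℂ → ℝ, ∀ z ∈ O, HasFDerivAt ψ (reForm (a z)) z := by
  have hd : ∀ z, HasFDerivAt (fun z ↦ reForm (a z)) (reForm ∘L fderiv ℝ a z) z := fun z ↦
    reForm.hasFDerivAt.comp z (ha.differentiable (by simp) z).hasFDerivAt
  refine hOc.exists_forall_hasFDerivAt_of_fderiv_symmetric hO
    (fun z _ ↦ (hd z).differentiableAt.differentiableWithinAt) fun z hz x y ↦ ?_
  rw [(hd z).fderiv]
  simp only [ContinuousLinearMap.comp_apply, reForm_apply]
  have key : ∀ v : ℂ, fderiv ℝ a z v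
      = v.re * fderiv ℝ a z 1 + v.im * fderiv ℝ a z Complex.I := by
    intro v
    have : v = v.re • (1 : ℂ) + v.im • Complex.I := by
      apply Complex.ext <;> simp
    conv_lhs => rw [this, map_add, map_smul, map_smul]
    simp
  rw [key x, key y]
  have h' := h z hz
  unfold wbar at h'
  simp at h'
  simp
  linear_combination (x.im * y.re - x.re * y.im) * h'

/-! ### The potential -/

/-- `Ψ` is a continuous function on the ball `ball p ρ`, vanishing at `p`, whose weak
derivative in the direction `v` is `Re (f v)`. -/
structure IsPotential (f : ℂ → ℂ) (p : ℂ) (ρ : ℝ) (Ψ : ℂ → ℝ) : Prop where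
  zero : Ψ p = 0
  continuousOn : ContinuousOn Ψ (ball p ρ)
  sub_le : ∀ (w₀ : ℂ) (δ : ℝ) (u : ℂ) (κ : ℝ), ball w₀ δ ⊆ ball p ρ →
    (∀ᵐ z ∂volume.restrict (ball w₀ δ), (u * f z).re ≤ κ) → ∀ w ∈ ball w₀ δ, ∀ s : ℝ, 0 ≤ s →
      w + s * u ∈ ball w₀ δ → Ψ (w + s * u) - Ψ w ≤ s * κ
  integral_lap : ∀ g : ℂ → ℝ, ContDiff ℝ ∞ g → HasCompactSupport g → tsupport g ⊆ ball p ρ →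
    ∫ z, Ψ z * lap g z = -2 * (∫ z, f z * wbar (fun w ↦ (g w : ℂ)) z).re

theorem sub_le_of_hasFDerivAt_reForm {ψ : ℂ → ℝ} {a : ℂ → ℂ} {w u : ℂ} {s κ : ℝ} (hs : 0 ≤ s)
    (h : ∀ τ ∈ Icc 0 s, HasFDerivAt ψ (reForm (a (w + τ * u))) (w + τ * u))
    (hκ : ∀ τ ∈ Icc 0 s, (u * a (w + τ * u)).re ≤ κ) : ψ (w + s * u) - ψ w ≤ s * κ := by
  have hd : ∀ τ ∈ Icc 0 s, HasDerivAt (fun τ : ℝ ↦ ψ (w + τ * u)) (u * a (w + τ * u)).re τ := by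
    intro τ hτ
    have h1 : HasDerivAt (fun τ : ℝ ↦ w + τ * u) u τ := by
      simpa using ((Complex.ofRealCLM.hasDerivAt (x := τ)).mul_const u).const_add w
    have := (h τ hτ).comp_hasDerivAt τ h1
    rwa [reForm_apply, mul_comm] at this
  have := (convex_Icc 0 s).image_sub_le_mul_sub_of_deriv_le
    (f := fun τ : ℝ ↦ ψ (w + τ * u)) (C := κ)
    (fun τ hτ ↦ (hd τ hτ).continuousAt.continuousWithinAt)
    (fun τ hτ ↦ (hd τ (interior_subset hτ)).differentiableAt.differentiableWithinAt)
    (fun τ hτ ↦ by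
      rw [(hd τ (interior_subset hτ)).deriv]
      exact hκ τ (interior_subset hτ)) 0 ⟨le_rfl, hs⟩ s ⟨hs, le_rfl⟩ hs
  simpa [mul_comm] using this

/-- The bounded ratio of outer to inner radius is the condition under which mollifications converge
almost everywhere. -/
theorem exists_bump_seq {R : ℝ} (hR : 0 < R) : ∃ φ : ℕ → ContDiffBump (0 : ℂ),
    (∀ n, (φ n).rOut ≤ R) ∧ Tendsto (fun n ↦ (φ n).rOut) atTop (𝓝 0) ∧
    ∀ n, (φ n).rOut ≤ 2 * (φ n).rIn := by
  have h : ∀ n : ℕ, 0 < R / (n + 1 : ℝ) := fun n ↦ by positivity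
  refine ⟨fun n ↦ ⟨R / (n + 1) / 2, R / (n + 1), half_pos (h n), half_lt_self (h n)⟩,
    fun n ↦ ?_, ?_, fun n ↦ ?_⟩
  · exact div_le_self hR.le (by linarith [n.cast_nonneg (α := ℝ)])
  · exact tendsto_const_nhds.div_atTop
      (tendsto_atTop_add_const_right _ _ tendsto_natCast_atTop_atTop)
  · dsimp only; linarith

/-- Arzelà–Ascoli for a sequence of Lipschitz functions on a ball. -/
theorem exists_subseq_tendsto_of_lipschitz {p : ℂ} {ρ C : ℝ} {ψ : ℕ → ℂ → ℝ}
    (hC : 0 ≤ C) (hρ : 0 ≤ ρ) (h0 : ∀ n, ψ n p = 0)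
    (hL : ∀ n, ∀ x ∈ closedBall p ρ, ∀ y ∈ closedBall p ρ, |ψ n x - ψ n y| ≤ C * dist x y) :
    ∃ (σ : ℕ → ℕ) (Ψ : ℂ → ℝ), StrictMono σ ∧
      ∀ x ∈ closedBall p ρ, Tendsto (fun n ↦ ψ (σ n) x) atTop (𝓝 (Ψ x)) := by
  have : CompactSpace (closedBall p ρ) := isCompact_iff_compactSpace.1 (isCompact_closedBall p ρ)
  have hlip : ∀ n, LipschitzWith C.toNNReal fun x : closedBall p ρ ↦ ψ n x := fun n ↦
    LipschitzWith.of_dist_le_mul fun x y ↦ by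
      rw [Real.coe_toNNReal _ hC]
      exact hL n x x.2 y y.2
  let b : ℕ → BoundedContinuousFunction (closedBall p ρ) ℝ := fun n ↦
    BoundedContinuousFunction.mkOfCompact ⟨_, (hlip n).continuous⟩
  have hK : IsCompact (closure (range b)) := by
    refine BoundedContinuousFunction.arzela_ascoli (Icc (-(C * ρ)) (C * ρ)) isCompact_Icc _ ?_ ?_
    · rintro _ x ⟨n, rfl⟩
      have := hL n x x.2 p (mem_closedBall_self hρ)
      rw [h0, sub_zero] at this
      exact abs_le.1 (this.trans (mul_le_mul_of_nonneg_left x.2 hC))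
    · refine (LipschitzWith.uniformEquicontinuous _ C.toNNReal ?_).equicontinuous
      rintro ⟨_, n, rfl⟩
      exact hlip n
  obtain ⟨B, -, σ, hσ, hB⟩ := hK.tendsto_subseq fun n ↦ subset_closure (mem_range_self n)
  classical
  refine ⟨σ, fun x ↦ if hx : x ∈ closedBall p ρ then B ⟨x, hx⟩ else 0, hσ, fun x hx ↦ ?_⟩
  simp only [dif_pos hx]
  exact ((BoundedContinuousFunction.lipschitz_eval_const
    (⟨x, hx⟩ : closedBall p ρ)).continuous.tendsto B).comp hB

/-- Primitives of `Re(f_n dz)` for the mollified `f_n`, normalized at `p`, are uniformly Lipschitz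
because `f` is bounded. A limit along a subsequence inherits the one-sided increment bounds and the
weak Laplacian. -/
theorem exists_isPotential {f : ℂ → ℂ} {p : ℂ} {R C : ℝ} (hR : 0 < R)
    (hf : LocallyIntegrable f) (hC : ∀ z, ‖f z‖ ≤ C)
    (hw : ∀ g : ℂ → ℝ, ContDiff ℝ ∞ g → HasCompactSupport g → tsupport g ⊆ ball p R →
      (∫ z, f z * wbar (fun w ↦ (g w : ℂ)) z).im = 0) :
    ∃ Ψ, IsPotential f p (R / 3) Ψ := by
  have hC0 : 0 ≤ C := (norm_nonneg _).trans (hC 0)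
  -- With radii at most `R / 2`, the kernels centred in `ball p (R / 2)` are test functions in `ball
  -- p R`. Shrinking once more to `R / 3` leaves a closed ball on which compactness is available.
  obtain ⟨φ, hφR, hφ0, hφK⟩ := exists_bump_seq (half_pos hR)
  have hsm : ∀ n, ContDiff ℝ ∞ (mollify (φ n) f) := fun n ↦ contDiff_mollify _ hf
  have hprim : ∀ n, ∃ ψ : ℂ → ℝ, ∀ z ∈ ball p (R / 2),
      HasFDerivAt ψ (reForm (mollify (φ n) f z)) z := by
    intro n
    refine exists_hasFDerivAt_reForm isOpen_ball (convex_ball _ _) (hsm n) fun z hz ↦ ?_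
    rw [wbar_mollify _ hf, Complex.neg_im, hw (fun t ↦ (φ n).normed volume (z - t)), neg_zero]
    · exact (φ n).contDiff_normed.comp (contDiff_const.sub contDiff_id)
    · exact hasCompactSupport_bump_sub _ _
    · have h1 : tsupport (fun t ↦ (φ n).normed volume (z - t)) ⊆ closedBall z (φ n).rOut := by
        refine closure_minimal (fun t ht ↦ ?_) isClosed_closedBall
        have : z - t ∈ Function.support ((φ n).normed volume) := ht
        rw [(φ n).support_normed_eq, mem_ball_zero_iff, norm_sub_rev, ← dist_eq_norm] at this
        exact this.le
      refine h1.trans fun t ht ↦ ?_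
      have := hφR n
      rw [mem_closedBall] at ht
      rw [mem_ball] at hz ⊢
      linarith [dist_triangle t z p]
  choose ψ₀ hψ₀ using hprim
  obtain ⟨ψ, hψ, hψp⟩ : ∃ ψ : ℕ → ℂ → ℝ, (∀ n, ∀ z ∈ ball p (R / 2),
      HasFDerivAt (ψ n) (reForm (mollify (φ n) f z)) z) ∧ ∀ n, ψ n p = 0 :=
    ⟨fun n z ↦ ψ₀ n z - ψ₀ n p, fun n z hz ↦ (hψ₀ n z hz).sub_const _, fun n ↦ sub_self _⟩
  have hL : ∀ n, ∀ x ∈ ball p (R / 2), ∀ y ∈ ball p (R / 2), |ψ n x - ψ n y| ≤ C * dist x y := by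
    intro n x hx y hy
    have := (convex_ball p (R / 2)).norm_image_sub_le_of_norm_hasFDerivWithin_le
      (fun z hz ↦ (hψ n z hz).hasFDerivWithinAt)
      (fun z _ ↦ (norm_reForm_le _).trans (norm_mollify_le (φ n) hf hC z)) hy hx
    rwa [Real.norm_eq_abs, ← dist_eq_norm] at this
  have hsub : closedBall p (R / 3) ⊆ ball p (R / 2) := closedBall_subset_ball (by linarith)
  have hsub' : ball p (R / 3) ⊆ ball p (R / 2) := ball_subset_ball (by linarith)
  obtain ⟨σ, Ψ, hσ, hΨ⟩ := exists_subseq_tendsto_of_lipschitz (ρ := R / 3) hC0 (by positivity) hψp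
    fun n x hx y hy ↦ hL n x (hsub hx) y (hsub hy)
  have hφσ := hφ0.comp hσ.tendsto_atTop
  refine ⟨Ψ, ?_, ?_, ?_, ?_⟩
  · have := hΨ p (mem_closedBall_self (by positivity))
    simp only [hψp] at this
    exact (tendsto_nhds_unique tendsto_const_nhds this).symm
  · have : LipschitzOnWith C.toNNReal Ψ (ball p (R / 3)) :=
      LipschitzOnWith.of_dist_le_mul fun x hx y hy ↦ by
        rw [Real.coe_toNNReal _ hC0]
        exact le_of_tendsto (((hΨ x (ball_subset_closedBall hx)).dist
          (hΨ y (ball_subset_closedBall hy)))) (Eventually.of_forall fun n ↦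
            hL _ x (hsub' hx) y (hsub' hy))
    exact this.continuousOn
  · intro w₀ δ u κ hball hae w hwb s hs hsb
    obtain ⟨δ', hδ', hmax⟩ : ∃ δ' < δ, max (dist w w₀) (dist (w + s * u) w₀) ≤ δ' :=
      ⟨_, max_lt hwb hsb, le_rfl⟩
    have hev : ∀ᶠ n in atTop, (φ (σ n)).rOut < δ - δ' := hφσ.eventually_lt_const (by linarith)
    refine le_of_tendsto ((hΨ _ (ball_subset_closedBall (hball hsb))).sub
      (hΨ _ (ball_subset_closedBall (hball hwb)))) ?_
    filter_upwards [hev] with n hn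
    have hseg : ∀ τ ∈ Icc (0 : ℝ) s, w + τ * u ∈ closedBall w₀ δ' := by
      intro τ hτ
      rcases hs.eq_or_lt with rfl | hs'
      · rw [le_antisymm hτ.2 hτ.1]
        simpa using (le_max_left _ _).trans hmax
      · have := (convex_closedBall w₀ δ') (x := w) ((le_max_left _ _).trans hmax)
          (y := w + s * u) ((le_max_right _ _).trans hmax) (a := 1 - τ / s) (b := τ / s)
          (by rw [sub_nonneg, div_le_one hs']; exact hτ.2) (div_nonneg hτ.1 hs) (by ring)
        convert this using 1
        have : (s : ℂ) ≠ 0 := by exact_mod_cast hs'.ne'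
        simp only [Complex.real_smul]
        push_cast
        field_simp
        ring
    refine sub_le_of_hasFDerivAt_reForm hs (a := mollify (φ (σ n)) f) (fun τ hτ ↦ hψ _ _ ?_)
      fun τ hτ ↦ re_mul_mollify_le _ hf (ae_restrict_of_ae_restrict_of_subset ?_ hae)
    · exact hsub' (hball (closedBall_subset_ball hδ' (hseg τ hτ)))
    · intro t ht
      have := hseg τ hτ
      rw [mem_closedBall] at this
      rw [mem_ball] at ht ⊢
      linarith [dist_triangle t (w + τ * u) w₀]
  · intro g hg hgc hgs
    have hgcC := contDiff_ofReal_comp hg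
    have hwc := continuous_wbar (hgcC.of_le (m := 1) (by simp))
    have hws : HasCompactSupport (wbar fun w ↦ (g w : ℂ)) :=
      hasCompactSupport_wbar (hgc.comp_left (g := fun x : ℝ ↦ (x : ℂ)) Complex.ofReal_zero)
    have hlc : HasCompactSupport (lap g) :=
      hgc.of_isClosed_subset (isClosed_tsupport _) (tsupport_lap_subset g)
    have hl := continuous_lap hg
    have T1 : Tendsto (fun n ↦ ∫ z, ψ (σ n) z * lap g z) atTop (𝓝 (∫ z, Ψ z * lap g z)) := by
      refine tendsto_integral_of_dominated_convergence (fun z ↦ C * R * ‖lap g z‖) ?_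
        (((hl.integrable_of_hasCompactSupport hlc).norm).const_mul _) ?_ ?_
      · intro n
        refine (integrable_mul_of_locallyIntegrableOn (O := ball p (R / 2))
          (ContinuousOn.locallyIntegrableOn (fun z hz ↦
            (hψ _ z hz).continuousAt.continuousWithinAt) measurableSet_ball) hl hlc
          ((tsupport_lap_subset g).trans (hgs.trans hsub'))).aestronglyMeasurable
      · refine fun n ↦ Eventually.of_forall fun z ↦ ?_
        by_cases hz : z ∈ tsupport (lap g)
        · rw [norm_mul]
          refine mul_le_mul_of_nonneg_right ?_ (norm_nonneg _)
          have hzb := hsub' (hgs (tsupport_lap_subset g hz))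
          have := hL (σ n) z hzb p (mem_ball_self (by positivity))
          rw [hψp, sub_zero] at this
          refine this.trans (mul_le_mul_of_nonneg_left ?_ hC0)
          rw [mem_ball] at hzb
          linarith
        · simp [image_eq_zero_of_notMem_tsupport hz]
      · refine Eventually.of_forall fun z ↦ ?_
        by_cases hz : z ∈ tsupport (lap g)
        · exact (hΨ z (ball_subset_closedBall (hgs (tsupport_lap_subset g hz)))).mul_const _
        · simp [image_eq_zero_of_notMem_tsupport hz]
    have T2 : Tendsto (fun n ↦ ∫ z, mollify (φ (σ n)) f z * wbar (fun w ↦ (g w : ℂ)) z) atTop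
        (𝓝 (∫ z, f z * wbar (fun w ↦ (g w : ℂ)) z)) := by
      refine tendsto_integral_of_dominated_convergence
        (fun z ↦ C * ‖wbar (fun w ↦ (g w : ℂ)) z‖) ?_
        (((hwc.integrable_of_hasCompactSupport hws).norm).const_mul _) ?_ ?_
      · exact fun n ↦ ((hsm _).continuous.mul hwc).aestronglyMeasurable
      · refine fun n ↦ Eventually.of_forall fun z ↦ ?_
        rw [norm_mul]
        exact mul_le_mul_of_nonneg_right (norm_mollify_le _ hf hC z) (norm_nonneg _)
      · have := ContDiffBump.ae_convolution_tendsto_right_of_locallyIntegrable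
          (μ := volume) (φ := fun n ↦ φ (σ n)) (K := 2) hφσ
          (Eventually.of_forall fun n ↦ hφK _) hf
        filter_upwards [this] with z hz
        exact hz.mul_const _
    have e : ∀ n, ∫ z, ψ (σ n) z * lap g z
        = -2 * (∫ z, mollify (φ (σ n)) f z * wbar (fun w ↦ (g w : ℂ)) z).re := fun n ↦
      integral_mul_lap isOpen_ball (hψ _) (hsm _).continuous.continuousOn hg hgc
        (hgs.trans hsub')
    refine tendsto_nhds_unique T1 ?_
    simp_rw [e]
    exact ((Complex.continuous_re.tendsto _).comp T2).const_mul _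

/-- An almost everywhere bound says nothing about one given segment, but `A` is continuous: on a
small ball `Re (u f)` lies below any number exceeding `Re (u A)` at the centre. This bounds the
right slopes of `Ψ` along the segment, and a Dini-derivative comparison integrates the bound. -/
theorem IsPotential.sub_re_le {f : ℂ → ℂ} {p : ℂ} {ρ : ℝ} {Ψ : ℂ → ℝ} (h : IsPotential f p ρ Ψ)
    {O : Set ℂ} (hO : IsOpen O) (hOρ : O ⊆ ball p ρ) {A F : ℂ → ℂ}
    (hF : ∀ z ∈ O, HasDerivAt F (A z) z) (hA : ContinuousOn A O) {u z : ℂ}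
    (hu : ∀ᵐ w ∂volume.restrict O, (u * (f w - A w)).re ≤ 0)
    (hz : ∀ s ∈ Icc (0 : ℝ) 1, z + s * u ∈ O) :
    Ψ (z + u) - (F (z + u)).re ≤ Ψ z - (F z).re := by
  have hline : ∀ s : ℝ, HasDerivAt (fun s : ℝ ↦ z + s * u) u s := fun s ↦ by
    simpa using ((Complex.ofRealCLM.hasDerivAt (x := s)).mul_const u).const_add z
  have hd : ∀ s ∈ Icc (0 : ℝ) 1, HasDerivAt (fun s : ℝ ↦ (F (z + s * u)).re + (Ψ z - (F z).re))
      (u * A (z + s * u)).re s := by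
    intro s hs
    have := (hasFDerivAt_re_of_hasDerivAt (hF _ (hz s hs))).comp_hasDerivAt s (hline s)
    rw [reForm_apply, mul_comm] at this
    exact this.add_const _
  have key := image_le_of_liminf_slope_right_le_deriv_boundary
    (f := fun s : ℝ ↦ Ψ (z + s * u)) (a := 0) (b := 1)
    (B := fun s : ℝ ↦ (F (z + s * u)).re + (Ψ z - (F z).re))
    (B' := fun s ↦ (u * A (z + s * u)).re) ?_ (by simp)
    (fun s hs ↦ (hd s hs).continuousAt.continuousWithinAt)
    (fun s hs ↦ (hd s ⟨hs.1, hs.2.le⟩).hasDerivWithinAt) ?_ (x := 1) ⟨zero_le_one, le_rfl⟩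
  · simp only [Complex.ofReal_one, one_mul] at key
    linarith
  · intro s hs
    exact ((h.continuousOn.continuousAt (isOpen_ball.mem_nhds (hOρ (hz s hs)))).comp
      (f := fun s : ℝ ↦ z + s * u) (hline s).continuousAt).continuousWithinAt
  · intro s hs r hr
    obtain ⟨r', hr1, hr2⟩ := exists_between hr
    have hw := hz s ⟨hs.1, hs.2.le⟩
    have hcont : ContinuousAt (fun w ↦ (u * A w).re) (z + s * u) :=
      Complex.continuous_re.continuousAt.comp
        (continuousAt_const.mul (hA.continuousAt (hO.mem_nhds hw)))
    obtain ⟨δ, hδ, hball⟩ := Metric.mem_nhds_iff.1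
      ((hcont.eventually_lt_const hr1).and (hO.mem_nhds hw))
    have hae : ∀ᵐ w ∂volume.restrict (ball (z + s * u) δ), (u * f w).re ≤ r' := by
      have h1 := ae_restrict_of_ae_restrict_of_subset (fun w hw ↦ (hball hw).2) hu
      filter_upwards [h1, ae_restrict_mem measurableSet_ball] with w hw1 hw2
      have := (hball hw2).1
      rw [mul_sub, Complex.sub_re] at hw1
      linarith
    have hnear : ∀ᶠ t : ℝ in 𝓝[>] s, z + t * u ∈ ball (z + s * u) δ :=
      nhdsWithin_le_nhds ((hline s).continuousAt.eventually (ball_mem_nhds _ hδ))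
    refine Eventually.frequently ?_
    filter_upwards [hnear, self_mem_nhdsWithin] with t ht hts
    have hts' : s < t := hts
    have e : z + s * u + ((t - s : ℝ) : ℂ) * u = z + t * u := by push_cast; ring
    have := h.sub_le (z + s * u) δ u r' (fun w hw ↦ hOρ (hball hw).2) hae _
      (mem_ball_self hδ) (t - s) (by linarith) (by rwa [e])
    rw [e] at this
    rw [slope_def_field, div_lt_iff₀ (by linarith)]
    have := mul_lt_mul_of_pos_right hr2 (sub_pos.2 hts')
    linarith

/-! ### The minimum principle -/

/-- The barrier `exp (-κ / (ρ² - |z - z₀|²))`, extended by zero, is smooth with compact support, so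
it can be used directly as a test function in the minimum principle. -/
theorem lap_expNegInvGlue (z₀ z : ℂ) (ρ κ : ℝ) :
    lap (fun w ↦ expNegInvGlue ((ρ ^ 2 - ‖w - z₀‖ ^ 2) / κ)) z =
      expNegInvGlue ((ρ ^ 2 - ‖z - z₀‖ ^ 2) / κ) *
        ((((ρ ^ 2 - ‖z - z₀‖ ^ 2) / κ)⁻¹ ^ 4 - 2 * ((ρ ^ 2 - ‖z - z₀‖ ^ 2) / κ)⁻¹ ^ 3)
          * (4 * ‖z - z₀‖ ^ 2 / κ ^ 2) - 4 / κ * ((ρ ^ 2 - ‖z - z₀‖ ^ 2) / κ)⁻¹ ^ 2) := by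
  set q : ℂ → ℝ := fun w ↦ (ρ ^ 2 - ‖w - z₀‖ ^ 2) / κ with hq
  set e₁ : ℝ → ℝ := fun x ↦ (Polynomial.X ^ 2 : Polynomial ℝ).eval x⁻¹ * expNegInvGlue x with he₁
  have hqd : ∀ w, HasFDerivAt q (-(2 / κ) • reForm ((starRingEnd ℂ) (w - z₀))) w := by
    intro w
    have := (((hasFDerivAt_id w).sub_const z₀).norm_sq.const_sub (ρ ^ 2)).mul_const κ⁻¹
    refine this.congr_fderiv ?_
    ext v
    all_goals simp [reForm_apply]
    all_goals ring
  have hg : ∀ w v, fderiv ℝ (fun w ↦ expNegInvGlue (q w)) w v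
      = e₁ (q w) * (-(2 / κ) * ((starRingEnd ℂ) (w - z₀) * v).re) := by
    intro w v
    have h1 := expNegInvGlue.hasDerivAt_polynomial_eval_inv_mul 1 (q w)
    simp only [Polynomial.eval_one, one_mul, Polynomial.derivative_one, sub_zero, mul_one] at h1
    have := congr($((h1.comp_hasFDerivAt w (hqd w)).fderiv) v)
    refine Eq.trans ?_ (this.trans ?_)
    · rfl
    · simp [reForm_apply, he₁, -mul_eq_mul_left_iff]
      ring
  have hg2 : ∀ v, fderiv ℝ (fun w ↦ fderiv ℝ (fun w ↦ expNegInvGlue (q w)) w v) z v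
      = (((q z)⁻¹ ^ 4 - 2 * (q z)⁻¹ ^ 3) * expNegInvGlue (q z))
          * (-(2 / κ) * ((starRingEnd ℂ) (z - z₀) * v).re) ^ 2
        + e₁ (q z) * (-(2 / κ) * ‖v‖ ^ 2) := by
    intro v
    simp_rw [hg]
    have h1 := expNegInvGlue.hasDerivAt_polynomial_eval_inv_mul (Polynomial.X ^ 2) (q z)
    have h2 := h1.comp_hasFDerivAt z (hqd z)
    have h3 : HasFDerivAt (fun w ↦ -(2 / κ) * ((starRingEnd ℂ) (w - z₀) * v).re)
        (-(2 / κ) • (reForm v ∘L (Complex.conjCLE : ℂ →L[ℝ] ℂ))) z := by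
      have := ((reForm v ∘L (Complex.conjCLE : ℂ →L[ℝ] ℂ)).hasFDerivAt.comp z
        ((hasFDerivAt_id z).sub_const z₀)).const_mul (-(2 / κ))
      refine this.congr_of_eventuallyEq (Eventually.of_forall fun w ↦ ?_)
      change -(2 / κ) * _ = -(2 / κ) * _
      congr 1
      simp [reForm_apply]
      ring
    have h4 := (h2.mul h3).fderiv
    have h5 := congr($h4 v)
    refine (Eq.trans ?_ h5).trans ?_
    · rfl
    · simp [reForm_apply, he₁, Complex.sq_norm, Complex.normSq_apply]
      ring_nf
  rw [lap, hg2, hg2]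
  have : ‖z - z₀‖ ^ 2 = (z - z₀).re ^ 2 + (z - z₀).im ^ 2 := by
    rw [Complex.sq_norm, Complex.normSq_apply]; ring
  rw [show (ρ ^ 2 - ‖z - z₀‖ ^ 2) / κ = q z from rfl, this]
  simp [he₁]
  ring

/-- The barrier has positive Laplacian on the annulus between the radii `ρ₀` and `ρ`, and `v - c ≥
0` vanishes inside. Its product with the Laplacian is thus nonnegative while its integral is at most
zero, so `v = c` on the annulus too. -/
theorem eq_of_superharmonic_of_eq_on_ball {v : ℂ → ℝ} {O : Set ℂ} {c ρ₀ ρ : ℝ} {z₀ : ℂ}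
    (hv : ContinuousOn v O) (hρ₀ : 0 < ρ₀) (hρ : 0 < ρ) (hball : closedBall z₀ ρ ⊆ O)
    (hint : ∀ g : ℂ → ℝ, ContDiff ℝ ∞ g → HasCompactSupport g → tsupport g ⊆ O →
      (∀ z, 0 ≤ g z) → ∫ z, v z * lap g z ≤ 0)
    (hc : ∀ z ∈ O, c ≤ v z) (heq : ∀ z ∈ ball z₀ ρ₀, v z = c) :
    ∀ z ∈ ball z₀ ρ, v z = c := by
  -- With `x = (ρ² - m²) / κ` and `m = |z - z₀|`, the Laplacian has the sign of `(1 - 2x) m² - κ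
  -- x²`. The first bound on `κ` gives `x ≤ 1/4`, the second `κ x² < ρ₀² / 2`, which suffice for `m
  -- ≥ ρ₀`.
  obtain ⟨κ, hκ, hκ1, hκ2⟩ : ∃ κ : ℝ, 0 < κ ∧ 4 * ρ ^ 2 ≤ κ ∧ 2 * ρ ^ 4 < κ * ρ₀ ^ 2 := by
    refine ⟨4 * ρ ^ 2 + 4 * ρ ^ 4 / ρ₀ ^ 2, by positivity, by
      have : 0 ≤ 4 * ρ ^ 4 / ρ₀ ^ 2 := by positivity
      linarith, ?_⟩
    have : 4 * ρ ^ 4 / ρ₀ ^ 2 * ρ₀ ^ 2 = 4 * ρ ^ 4 := by field_simp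
    rw [add_mul, this]
    have : 0 < 4 * ρ ^ 2 * ρ₀ ^ 2 := by positivity
    have : 0 < ρ ^ 4 := by positivity
    linarith
  set g : ℂ → ℝ := fun w ↦ expNegInvGlue ((ρ ^ 2 - ‖w - z₀‖ ^ 2) / κ) with hg
  have hgd : ContDiff ℝ ∞ g := expNegInvGlue.contDiff.comp
    ((contDiff_const.sub ((contDiff_id.sub contDiff_const).norm_sq ℝ)).div_const κ)
  have hts : tsupport g ⊆ closedBall z₀ ρ := by
    refine closure_minimal (fun w hw ↦ ?_) isClosed_closedBall
    by_contra h
    rw [mem_closedBall, dist_eq_norm, not_le] at h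
    refine hw (expNegInvGlue.zero_of_nonpos ?_)
    refine div_nonpos_of_nonpos_of_nonneg ?_ hκ.le
    nlinarith
  have hgc : HasCompactSupport g :=
    (isCompact_closedBall z₀ ρ).of_isClosed_subset (isClosed_tsupport _) hts
  have hlc : HasCompactSupport (lap g) :=
    hgc.of_isClosed_subset (isClosed_tsupport _) (tsupport_lap_subset g)
  have hpos : ∀ z, ρ₀ ≤ ‖z - z₀‖ → ‖z - z₀‖ < ρ → 0 < lap g z := by
    intro z h1 h2
    rw [hg, lap_expNegInvGlue]
    set x := (ρ ^ 2 - ‖z - z₀‖ ^ 2) / κ with hx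
    set m := ‖z - z₀‖ with hm
    have hx0 : 0 < x := div_pos (by nlinarith) hκ
    have hxm : κ * x = ρ ^ 2 - m ^ 2 := by rw [hx]; field_simp
    have hxκ : κ * x ≤ ρ ^ 2 := by rw [hxm]; nlinarith
    have hx1 : x ≤ 1 / 4 := by nlinarith
    have hx2 : 2 * (κ * x ^ 2) < ρ₀ ^ 2 := by
      have e : κ * (κ * x ^ 2) ≤ ρ ^ 4 := by
        have : κ * (κ * x ^ 2) = (κ * x) ^ 2 := by ring
        rw [this, show ρ ^ 4 = (ρ ^ 2) ^ 2 by ring]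
        exact pow_le_pow_left₀ (by positivity) hxκ 2
      nlinarith
    have hm2 : ρ₀ ^ 2 ≤ m ^ 2 := pow_le_pow_left₀ hρ₀.le h1 2
    have hmain : 0 < (1 - 2 * x) * m ^ 2 - κ * x ^ 2 := by nlinarith
    refine mul_pos (expNegInvGlue.pos_of_pos hx0) ?_
    have : (x⁻¹ ^ 4 - 2 * x⁻¹ ^ 3) * (4 * m ^ 2 / κ ^ 2) - 4 / κ * x⁻¹ ^ 2
        = 4 / (κ ^ 2 * x ^ 4) * ((1 - 2 * x) * m ^ 2 - κ * x ^ 2) := by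
      field_simp
    rw [this]
    positivity
  have hvi : Integrable fun z ↦ v z * lap g z := by
    have := integrable_mul_of_locallyIntegrableOn (𝕜 := ℝ) (μ := volume) (O := closedBall z₀ ρ)
      ((hv.mono hball).locallyIntegrableOn measurableSet_closedBall) (continuous_lap hgd) hlc
      ((tsupport_lap_subset g).trans hts)
    exact this
  have hli := (continuous_lap hgd).integrable_of_hasCompactSupport (μ := volume) hlc
  have hzero : ∫ z, c * lap g z = 0 := by
    have := integral_mul_lap isOpen_univ (ψ := fun _ ↦ c) (a := fun _ ↦ 0)
      (fun z _ ↦ by rw [map_zero]; exact hasFDerivAt_const c z) continuousOn_const hgd hgc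
      (subset_univ _)
    simpa using this
  have hnn : ∀ z, 0 ≤ (v z - c) * lap g z := by
    intro z
    by_cases hz : z ∈ tsupport (lap g)
    · have hzb := hts (tsupport_lap_subset g hz)
      by_cases h1 : ‖z - z₀‖ < ρ₀
      · rw [heq z (by rwa [mem_ball, dist_eq_norm]), sub_self, zero_mul]
      · refine mul_nonneg (sub_nonneg.2 (hc z (hball hzb))) ?_
        rw [mem_closedBall, dist_eq_norm] at hzb
        rcases hzb.eq_or_lt with h2 | h2
        · rw [hg, lap_expNegInvGlue, h2]
          simp
        · exact (hpos z (not_lt.1 h1) h2).le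
    · simp [image_eq_zero_of_notMem_tsupport hz]
  have hsub : ∫ z, (v z - c) * lap g z = 0 := by
    refine le_antisymm ?_ (integral_nonneg hnn)
    simp_rw [sub_mul]
    rw [integral_sub hvi (hli.const_mul c), hzero, sub_zero]
    exact hint g hgd hgc (hts.trans hball) fun z ↦ expNegInvGlue.nonneg _
  have hae := (integral_eq_zero_iff_of_nonneg hnn (by
    simp_rw [sub_mul]
    exact hvi.sub (hli.const_mul c))).1 hsub
  have hball' : ball z₀ ρ ⊆ O := ball_subset_closedBall.trans hball
  have hEq := Measure.eqOn_open_of_ae_eq (ae_restrict_of_ae (s := ball z₀ ρ) hae) isOpen_ball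
    (((hv.mono hball').sub continuousOn_const).mul (continuous_lap hgd).continuousOn)
    continuousOn_const
  intro z hz
  by_cases h1 : ‖z - z₀‖ < ρ₀
  · exact heq z (by rwa [mem_ball, dist_eq_norm])
  · have := hEq hz
    simp only [Pi.zero_apply, mul_eq_zero] at this
    rw [mem_ball, dist_eq_norm] at hz
    rcases this with h | h
    · linarith
    · exact absurd h (hpos z (not_lt.1 h1) hz).ne'

/-- The interior of the level set `{v = c}` is relatively closed in `O`: a small ball of equality
centred near a limit point expands to one containing that point. -/
theorem eqOn_of_superharmonic {v : ℂ → ℝ} {O : Set ℂ} {c : ℝ} (hO : IsOpen O)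
    (hOc : IsPreconnected O) (hv : ContinuousOn v O)
    (hint : ∀ g : ℂ → ℝ, ContDiff ℝ ∞ g → HasCompactSupport g → tsupport g ⊆ O →
      (∀ z, 0 ≤ g z) → ∫ z, v z * lap g z ≤ 0)
    (hc : ∀ z ∈ O, c ≤ v z) {z₁ : ℂ} (hz₁ : z₁ ∈ O) (heq : ∀ᶠ z in 𝓝 z₁, v z = c) :
    ∀ z ∈ O, v z = c := by
  suffices O ⊆ interior {z | v z = c} from fun z hz ↦ interior_subset (s := {z | v z = c}) (this hz)
  refine hOc.subset_of_closure_inter_subset isOpen_interior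
    ⟨z₁, hz₁, mem_interior_iff_mem_nhds.2 heq⟩ fun z ⟨hzc, hzO⟩ ↦ ?_
  obtain ⟨ε, hε, hball⟩ := Metric.isOpen_iff.1 hO z hzO
  obtain ⟨z₀, hz₀, hd⟩ := Metric.mem_closure_iff.1 hzc (ε / 4) (by positivity)
  obtain ⟨ρ₀, hρ₀, hb₀⟩ := Metric.isOpen_iff.1 isOpen_interior z₀ hz₀
  have key := eq_of_superharmonic_of_eq_on_ball (ρ := ε / 2) (z₀ := z₀) hv hρ₀ (by positivity)
    (fun w hw ↦ hball (by
      rw [mem_closedBall] at hw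
      rw [mem_ball]
      linarith [dist_triangle w z₀ z, dist_comm z z₀])) hint hc
    fun w hw ↦ interior_subset (s := {z | v z = c}) (hb₀ hw)
  exact mem_interior_iff_mem_nhds.2 (mem_of_superset
    (isOpen_ball.mem_nhds (by rw [mem_ball]; linarith)) key)

/-! ### Exposed vertices -/

/-- The point `a i` is a strict maximum over the family `a` of some real linear form. -/
def IsExposed {ι : Type*} (a : ι → ℂ) (i : ι) : Prop :=
  ∃ u : ℂ, ∀ j, j ≠ i → 0 < (u * (a i - a j)).re

theorem exists_real_mul_of_re_mul_eq_zero {w x y : ℂ} (hw : w ≠ 0) (hy : y ≠ 0)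
    (h1 : (w * x).re = 0) (h2 : (w * y).re = 0) : ∃ t : ℝ, x = t * y := by
  have e1 : w * x = (w * x).im * Complex.I := by
    refine Complex.ext (h1.trans (by simp)) (by simp)
  have e2 : w * y = (w * y).im * Complex.I := by
    refine Complex.ext (h2.trans (by simp)) (by simp)
  have hβ : ((w * y).im : ℂ) ≠ 0 := by
    intro h
    rw [h, zero_mul] at e2
    exact (mul_ne_zero hw hy) e2
  refine ⟨(w * x).im / (w * y).im, mul_left_cancel₀ hw ?_⟩
  push_cast
  calc w * x = (w * x).im * Complex.I := e1
    _ = (w * x).im / (w * y).im * ((w * y).im * Complex.I) := by field_simp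
    _ = _ := by rw [← e2]; ring

/-- Points maximizing a linear form lie on one line, so by noncollinearity at most two tie. Tilting
the form slightly towards either of the two breaks the tie in its favour. -/
theorem exists_isExposed_forall_le {ι : Type*} [Finite ι] [Nonempty ι] {a : ι → ℂ}
    (hii : ∀ i j k, i ≠ j → i ≠ k → j ≠ k → ∀ t : ℝ, a i - a k ≠ (t : ℂ) * (a j - a k))
    (hiii : ∀ i k, i ≠ k → a i ≠ a k) {w : ℂ} (hw : w ≠ 0) :
    ∃ m, (∀ j, (w * a j).re ≤ (w * a m).re) ∧
      ∀ j, (w * a j).re = (w * a m).re → IsExposed a j := by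
  obtain ⟨m, hm⟩ := Finite.exists_max fun j ↦ (w * a j).re
  refine ⟨m, hm, fun j hj ↦ ?_⟩
  have hmax : ∀ l, 0 ≤ (w * (a j - a l)).re := fun l ↦ by
    rw [mul_sub, Complex.sub_re, hj]
    linarith [hm l]
  by_cases hex : ∃ l, l ≠ j ∧ (w * (a j - a l)).re = 0
  · obtain ⟨l, hlj, hl⟩ := hex
    have hev : ∀ᶠ ε : ℝ in 𝓝[>] 0, ∀ l', l' ≠ j →
        0 < ((w + ε * (starRingEnd ℂ) (a j - a l)) * (a j - a l')).re := by
      refine eventually_all.2 fun l' ↦ ?_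
      by_cases hl' : (w * (a j - a l')).re = 0
      · filter_upwards [self_mem_nhdsWithin] with ε hε hne
        have hε' : 0 < ε := hε
        have : l' = l := by
          by_contra hne'
          obtain ⟨t, ht⟩ := exists_real_mul_of_re_mul_eq_zero hw
            (sub_ne_zero.2 (hiii j l hlj.symm)) hl' hl
          exact hii l' l j hne' hne hlj t (by linear_combination -ht)
        subst this
        rw [add_mul, Complex.add_re, hl', zero_add, mul_assoc, mul_comm ((starRingEnd ℂ) _),
          Complex.mul_conj, ← Complex.ofReal_mul, Complex.ofReal_re]
        exact mul_pos hε' (Complex.normSq_pos.2 (sub_ne_zero.2 (hiii j l' hlj.symm)))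
      · have hpos := lt_of_le_of_ne (hmax l') (Ne.symm hl')
        have hc : ContinuousAt (fun ε : ℝ ↦
            ((w + ε * (starRingEnd ℂ) (a j - a l)) * (a j - a l')).re) 0 := by fun_prop
        have := hc.eventually_const_lt (u := 0) (by simpa using hpos)
        filter_upwards [nhdsWithin_le_nhds this] with ε hε _ using hε
    obtain ⟨ε, hε⟩ := hev.exists
    exact ⟨_, hε⟩
  · push Not at hex
    exact ⟨w, fun l hl ↦ lt_of_le_of_ne (hmax l) (hex l hl).symm⟩

/-- A nonexposed point never maximizes a nonzero linear form, so an exposed point beats it strictly.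
Compactness of the unit circle and finiteness make the margin uniform, and homogeneity removes the
normalization. -/
theorem exists_exposed_gap {ι : Type*} [Finite ι] {a : ι → ℂ}
    (hii : ∀ i j k, i ≠ j → i ≠ k → j ≠ k → ∀ t : ℝ, a i - a k ≠ (t : ℂ) * (a j - a k))
    (hiii : ∀ i k, i ≠ k → a i ≠ a k) :
    ∃ δ > 0, ∀ w : ℂ, ∀ k, ¬ IsExposed a k →
      ∃ i, IsExposed a i ∧ δ * ‖w‖ ≤ (w * (a i - a k)).re := by
  have key : ∀ k, ∃ δ > 0, ¬ IsExposed a k → ∀ w ∈ sphere (0 : ℂ) 1,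
      ∃ i, IsExposed a i ∧ δ ≤ (w * (a i - a k)).re := by
    intro k
    by_cases hk : IsExposed a k
    · exact ⟨1, one_pos, fun h ↦ absurd hk h⟩
    have : Nonempty ι := ⟨k⟩
    suffices ∃ δ > 0, ∀ w ∈ sphere (0 : ℂ) 1, ∃ i, IsExposed a i ∧ δ ≤ (w * (a i - a k)).re by
      obtain ⟨δ, h1, h2⟩ := this
      exact ⟨δ, h1, fun _ ↦ h2⟩
    refine (isCompact_sphere (0 : ℂ) 1).induction_on
      (p := fun s ↦ ∃ δ > 0, ∀ w ∈ s, ∃ i, IsExposed a i ∧ δ ≤ (w * (a i - a k)).re)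
      ⟨1, one_pos, fun w hw ↦ absurd hw (notMem_empty w)⟩ ?_ ?_ ?_
    · rintro s t hst ⟨δ, h1, h2⟩
      exact ⟨δ, h1, fun w hw ↦ h2 w (hst hw)⟩
    · rintro s t ⟨δ, h1, h2⟩ ⟨δ', h1', h2'⟩
      refine ⟨min δ δ', lt_min h1 h1', ?_⟩
      rintro w (hw | hw)
      · obtain ⟨i, hi, hle⟩ := h2 w hw
        exact ⟨i, hi, (min_le_left _ _).trans hle⟩
      · obtain ⟨i, hi, hle⟩ := h2' w hw
        exact ⟨i, hi, (min_le_right _ _).trans hle⟩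
    · intro w hw
      have hw0 : w ≠ 0 := ne_zero_of_mem_unit_sphere ⟨w, hw⟩
      obtain ⟨m, hm, hme⟩ := exists_isExposed_forall_le hii hiii hw0
      have hpos : 0 < (w * (a m - a k)).re := by
        rw [mul_sub, Complex.sub_re, sub_pos]
        exact lt_of_le_of_ne (hm k) fun h ↦ hk (hme k h)
      have hc : ContinuousAt (fun w ↦ (w * (a m - a k)).re) w := by fun_prop
      refine ⟨_, nhdsWithin_le_nhds (hc.eventually_const_lt (half_lt_self hpos)), _,
        half_pos hpos, fun w' hw' ↦ ⟨m, hme m rfl, ?_⟩⟩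
      exact le_of_lt hw'
  choose δ hδ0 hδ using key
  have hev : ∀ᶠ d : ℝ in 𝓝[>] 0, ∀ k, d < δ k := eventually_all.2 fun k ↦
    nhdsWithin_le_nhds (eventually_lt_nhds (hδ0 k))
  obtain ⟨d, hd, hd0⟩ := (hev.and self_mem_nhdsWithin).exists
  refine ⟨d, hd0, fun w k hk ↦ ?_⟩
  by_cases hw : w = 0
  · obtain ⟨i, hi, -⟩ := hδ k hk 1 (by simp)
    exact ⟨i, hi, by simp [hw]⟩
  · have hn : 0 < ‖w‖ := norm_pos_iff.2 hw
    obtain ⟨i, hi, hle⟩ := hδ k hk ((‖w‖⁻¹ : ℝ) * w) (by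
      simp [hn.ne'])
    refine ⟨i, hi, ?_⟩
    rw [mul_assoc, Complex.re_ofReal_mul, le_inv_mul_iff₀ hn] at hle
    nlinarith [hd k]

/-! ### The potential is the maximum of the functions `Re F i` -/

/-- The properties of the potential `Ψ` of a piecewise analytic function near the point `p`
that determine it. -/
structure LocalPotential {r : ℕ} (M : Fin r → Set ℂ) (A F : Fin r → ℂ → ℂ) (p : ℂ) (ρ : ℝ)
    (Ψ : ℂ → ℝ) : Prop where
  pos : 0 < ρ
  zero : Ψ p = 0
  prim_zero : ∀ i, F i p = 0
  isOpen : ∀ i, IsOpen (M i)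
  disjoint : ∀ i j, i ≠ j → Disjoint (M i) (M j)
  hasDerivAt : ∀ i, ∀ z ∈ ball p ρ, HasDerivAt (F i) (A i z) z
  continuousOn_coeff : ∀ i, ContinuousOn (A i) (ball p ρ)
  continuousOn : ContinuousOn Ψ (ball p ρ)
  mono : ∀ (i : Fin r) (O : Set ℂ) (u z : ℂ), IsOpen O → O ⊆ ball p ρ →
    (∀ j, ∀ w ∈ O ∩ M j, (u * (A j w - A i w)).re ≤ 0) →
    (∀ s ∈ Icc (0 : ℝ) 1, z + s * u ∈ O) →
    Ψ (z + u) - (F i (z + u)).re ≤ Ψ z - (F i z).re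
  superharmonic : ∀ (i : Fin r) (g : ℂ → ℝ), ContDiff ℝ ∞ g → HasCompactSupport g →
    tsupport g ⊆ ball p ρ → (∀ z, 0 ≤ g z) → ∫ z, ((F i z).re - Ψ z) * lap g z ≤ 0
  dense : ∀ O : Set ℂ, IsOpen O → O ⊆ ball p ρ → O.Nonempty → ∃ j, (O ∩ M j).Nonempty

theorem Convex.add_mul_mem {D : Set ℂ} (hD : Convex ℝ D) {z w : ℂ} (hz : z ∈ D)
    (hw : z + w ∈ D) {s : ℝ} (hs : s ∈ Icc (0 : ℝ) 1) : z + s * w ∈ D := by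
  have := hD hz hw (a := 1 - s) (b := s) (by linarith [hs.2]) hs.1 (by ring)
  convert this using 1
  simp only [Complex.real_smul]
  push_cast
  ring

namespace LocalPotential

variable {r : ℕ} {M : Fin r → Set ℂ} {A F : Fin r → ℂ → ℂ} {p : ℂ} {ρ : ℝ} {Ψ : ℂ → ℝ}

theorem continuousOn_re (h : LocalPotential M A F p ρ Ψ) (i : Fin r) :
    ContinuousOn (fun z ↦ (F i z).re) (ball p ρ) := fun z hz ↦
  (Complex.continuous_re.continuousAt.comp (h.hasDerivAt i z hz).continuousAt).continuousWithinAt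

/-- On a ball inside `M i` no other piece is present, so the monotonicity property holds in every
direction and its opposite. -/
theorem sub_eq_of_mem (h : LocalPotential M A F p ρ Ψ) {i : Fin r} {z : ℂ} (hz : z ∈ ball p ρ)
    (hzM : z ∈ M i) : ∀ᶠ w in 𝓝 z, (F i w).re - Ψ w = (F i z).re - Ψ z := by
  obtain ⟨η, hη, hball⟩ := Metric.isOpen_iff.1 (isOpen_ball.inter (h.isOpen i)) z ⟨hz, hzM⟩
  have hmono : ∀ x ∈ ball z η, ∀ y ∈ ball z η, Ψ y - (F i y).re ≤ Ψ x - (F i x).re := by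
    intro x hx y hy
    have := h.mono i (ball z η) (y - x) x isOpen_ball (fun w hw ↦ (hball hw).1) ?_ ?_
    · simpa using this
    · rintro j w ⟨hw, hwj⟩
      by_cases hij : i = j
      · simp [hij]
      · exact absurd hwj (disjoint_left.1 (h.disjoint i j hij) (hball hw).2)
    · exact fun s hs ↦ Convex.add_mul_mem (convex_ball z η) hx (by simpa using hy) hs
  filter_upwards [ball_mem_nhds z hη] with w hw
  linarith [hmono z (mem_ball_self hη) w hw, hmono w hw z (mem_ball_self hη)]

/-- Monotonicity along a cone of exposing directions combines with the minimum principle: the value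
of `Re (F i) - Ψ` at a point of `M i` propagates over the forward cone of that point, and nearby
cones have a common point. -/
theorem exists_le_of_isExposed (h : LocalPotential M A F p ρ Ψ) {i : Fin r}
    (hi : p ∈ closure (M i)) (hexp : IsExposed (fun j ↦ A j p) i) :
    ∃ ρ' > 0, ρ' ≤ ρ ∧ ∀ z ∈ ball p ρ', (F i z).re ≤ Ψ z ∧ (z ∈ M i → Ψ z = (F i z).re) := by
  obtain ⟨u, hu⟩ := hexp
  have hpb : p ∈ ball p ρ := mem_ball_self h.pos
  have hev : ∀ᶠ x : ℂ × ℂ in 𝓝 (u, p), ∀ j, j ≠ i → 0 < (x.1 * (A i x.2 - A j x.2)).re := by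
    refine eventually_all.2 fun j ↦ ?_
    by_cases hj : j = i
    · exact Eventually.of_forall fun x hx ↦ absurd hj hx
    · have hc : ∀ k, ContinuousAt (fun x : ℂ × ℂ ↦ A k x.2) (u, p) := fun k ↦
        ContinuousAt.comp (f := Prod.snd) (g := A k)
          ((h.continuousOn_coeff k).continuousAt (isOpen_ball.mem_nhds hpb)) continuousAt_snd
      have : ContinuousAt (fun x : ℂ × ℂ ↦ (x.1 * (A i x.2 - A j x.2)).re) (u, p) :=
        Complex.continuous_re.continuousAt.comp (continuousAt_fst.mul ((hc i).sub (hc j)))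
      filter_upwards [this.eventually_const_lt (hu j hj)] with x hx _ using hx
  obtain ⟨ε₀, hε₀, hball₀⟩ := Metric.eventually_nhds_iff.1 hev
  obtain ⟨ε, hε, hερ, hball⟩ : ∃ ε > 0, ε ≤ ρ ∧ ∀ u' ∈ ball u ε, ∀ z ∈ ball p ε, ∀ j, j ≠ i →
      0 < (u' * (A i z - A j z)).re :=
    ⟨min ε₀ ρ, lt_min hε₀ h.pos, min_le_right _ _, fun u' hu' z hz ↦ hball₀ (y := (u', z))
      (max_lt (lt_of_lt_of_le hu' (min_le_left _ _)) (lt_of_lt_of_le hz (min_le_left _ _)))⟩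
  have hDρ : ball p ε ⊆ ball p ρ := ball_subset_ball hερ
  set v : ℂ → ℝ := fun z ↦ (F i z).re - Ψ z with hv
  have hvc : ContinuousOn v (ball p ρ) := (h.continuousOn_re i).sub h.continuousOn
  set K : Set ℂ := ⋃ t ∈ Ioi (0 : ℝ), ball ((t : ℂ) * u) (t * ε) with hK
  have hKo : IsOpen K := isOpen_biUnion fun _ _ ↦ isOpen_ball
  have hKmem : ∀ w, w ∈ K ↔ ∃ t : ℝ, 0 < t ∧ ‖w - t * u‖ < t * ε := fun w ↦ by
    simp [hK, dist_eq_norm]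
  have hKc : Convex ℝ K := by
    intro x hx y hy a b ha hb hab
    obtain ⟨s, hs, hs'⟩ := (hKmem x).1 hx
    obtain ⟨t, ht, ht'⟩ := (hKmem y).1 hy
    refine (hKmem _).2 ⟨a * s + b * t, ?_, ?_⟩
    · rcases ha.eq_or_lt with rfl | ha'
      · rw [zero_add] at hab; subst hab; linarith
      · have := mul_pos ha' hs
        have := mul_nonneg hb ht.le
        linarith
    · have e : a • x + b • y - ((a * s + b * t : ℝ) : ℂ) * u
          = (a : ℂ) * (x - s * u) + (b : ℂ) * (y - t * u) := by
        simp only [Complex.real_smul]; push_cast; ring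
      rw [e]
      refine (norm_add_le _ _).trans_lt ?_
      rw [norm_mul, norm_mul, Complex.norm_real, Complex.norm_real, Real.norm_of_nonneg ha,
        Real.norm_of_nonneg hb]
      rcases ha.eq_or_lt with rfl | ha'
      · rw [zero_add] at hab; subst hab; linarith
      · have := mul_lt_mul_of_pos_left hs' ha'
        have := mul_le_mul_of_nonneg_left ht'.le hb
        linarith
  have hmono : ∀ z ∈ ball p ε, ∀ w ∈ K, z + w ∈ ball p ε → v z ≤ v (z + w) := by
    intro z hz w hw hzw
    obtain ⟨t, ht, htw⟩ := (hKmem w).1 hw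
    have := h.mono i (ball p ε) w z isOpen_ball hDρ ?_
      fun s hs ↦ Convex.add_mul_mem (convex_ball p ε) hz hzw hs
    · simp only [hv]; linarith
    · rintro j x ⟨hx, -⟩
      by_cases hj : j = i
      · simp [hj]
      · have htC : (t : ℂ) ≠ 0 := by exact_mod_cast ht.ne'
        have hu' : (t : ℂ)⁻¹ * w ∈ ball u ε := by
          rw [mem_ball, dist_eq_norm]
          have : (t : ℂ)⁻¹ * w - u = (t : ℂ)⁻¹ * (w - t * u) := by field_simp
          rw [this, norm_mul, norm_inv, Complex.norm_real, Real.norm_of_nonneg ht.le,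
            inv_mul_lt_iff₀ ht]
          exact htw
        have h0 := hball _ hu' x hx j hj
        have e : w * (A j x - A i x) = ((-t : ℝ) : ℂ) * ((t : ℂ)⁻¹ * w * (A i x - A j x)) := by
          push_cast; field_simp; ring
        rw [e, Complex.re_ofReal_mul]
        nlinarith
  have hconst : ∀ z₀ ∈ ball p ε, z₀ ∈ M i → ∀ w ∈ K, z₀ + w ∈ ball p ε → v (z₀ + w) = v z₀ := by
    intro z₀ hz₀ hzM w hw hzw
    set O : Set ℂ := (fun x ↦ x - z₀) ⁻¹' K ∩ ball p ε with hO
    have hOo : IsOpen O := (hKo.preimage (by fun_prop)).inter isOpen_ball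
    have hOc : Convex ℝ O := by
      refine Convex.inter ?_ (convex_ball p ε)
      simpa [sub_eq_neg_add] using hKc.translate_preimage_right (-z₀)
    have hOD : O ⊆ ball p ε := inter_subset_right
    have hnear := h.sub_eq_of_mem (hDρ hz₀) hzM
    -- The vertex `z₀` is not in its open forward cone, so the minimum principle is started from a
    -- nearby point `z₀ + τ u`, where `v` is still locally equal to `v z₀`.
    have hline : Tendsto (fun τ : ℝ ↦ z₀ + τ * u) (𝓝[>] 0) (𝓝 z₀) := by
      have : ContinuousAt (fun τ : ℝ ↦ z₀ + τ * u) 0 := by fun_prop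
      simpa [ContinuousAt] using this.tendsto.mono_left nhdsWithin_le_nhds
    obtain ⟨τ, ⟨hτ1, hτ2⟩, hτ0⟩ := ((hline.eventually (hnear.eventually_nhds.and
      (isOpen_ball.mem_nhds hz₀))).and self_mem_nhdsWithin).exists
    have hτ0' : (0 : ℝ) < τ := hτ0
    have := eqOn_of_superharmonic hOo hOc.isPreconnected (c := v z₀) (z₁ := z₀ + τ * u)
      (hvc.mono (hOD.trans hDρ))
      (fun g h1 h2 h3 h4 ↦ h.superharmonic i g h1 h2 (h3.trans (hOD.trans hDρ)) h4)
      (fun z hz ↦ by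
        have := hmono z₀ hz₀ (z - z₀) hz.1 (by simpa using hz.2)
        simpa using this)
      ⟨(hKmem _).2 ⟨τ, hτ0', by simpa using mul_pos hτ0' hε⟩, hτ2⟩ hτ1 (z₀ + w)
      ⟨by simpa using hw, hzw⟩
    exact this
  obtain ⟨s, hs, hsu⟩ : ∃ s : ℝ, 0 < s ∧ s * ‖u‖ < ε := by
    refine ⟨ε / (2 * (‖u‖ + 1)), by positivity, ?_⟩
    rw [div_mul_eq_mul_div, div_lt_iff₀ (by positivity)]
    nlinarith [norm_nonneg u]
  -- A common point of the forward cones of all points close to `p`; comparing with `v q` reduces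
  -- the local constants to a single one.
  set q : ℂ := p + s * u with hq
  have hqD : q ∈ ball p ε := by
    rw [mem_ball, dist_eq_norm, hq, add_sub_cancel_left, norm_mul, Complex.norm_real,
      Real.norm_of_nonneg hs.le]
    exact hsu
  have hqK : ∀ z ∈ ball p (min ε (s * ε)), q - z ∈ K := by
    intro z hz
    refine (hKmem _).2 ⟨s, hs, ?_⟩
    have : q - z - s * u = -(z - p) := by rw [hq]; ring
    rw [this, norm_neg, ← dist_eq_norm]
    exact lt_of_lt_of_le hz (min_le_right _ _)
  have hD' : ball p (min ε (s * ε)) ⊆ ball p ε := ball_subset_ball (min_le_left _ _)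
  have hpos' : 0 < min ε (s * ε) := lt_min hε (mul_pos hs hε)
  have hle : ∀ z ∈ ball p (min ε (s * ε)), v z ≤ v q := fun z hz ↦ by
    have := hmono z (hD' hz) (q - z) (hqK z hz) (by simpa using hqD)
    simpa using this
  have heq : ∀ z ∈ ball p (min ε (s * ε)), z ∈ M i → v z = v q := fun z hz hzM ↦ by
    have := hconst z (hD' hz) hzM (q - z) (hqK z hz) (by simpa using hqD)
    simpa using this.symm
  have hvp : v p = 0 := by simp [hv, h.zero, h.prim_zero]
  have hvq : v q = 0 := by
    rw [← hvp]
    have hcp := hvc.continuousAt (isOpen_ball.mem_nhds hpb)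
    have hfr : ∃ᶠ z in 𝓝 p, z ∈ M i := mem_closure_iff_frequently.1 hi
    have hfr2 : ∃ᶠ z in 𝓝 p, v z = v q :=
      (hfr.and_eventually (ball_mem_nhds p hpos')).mono fun z hz ↦ heq z hz.2 hz.1
    have : v p ∈ ({v q} : Set ℝ) := isClosed_singleton.mem_of_frequently_of_tendsto hfr2 hcp
    exact this.symm
  refine ⟨min ε (s * ε), hpos', (min_le_left _ _).trans hερ, fun z hz ↦ ⟨?_, fun hzM ↦ ?_⟩⟩
  · have := hle z hz
    rw [hvq] at this
    simp only [hv] at this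
    linarith
  · have := heq z hz hzM
    rw [hvq] at this
    simp only [hv] at this
    linarith

end LocalPotential

namespace LocalPotential

variable {r : ℕ} {M : Fin r → Set ℂ} {A F : Fin r → ℂ → ℂ} {p : ℂ} {ρ : ℝ} {Ψ : ℂ → ℝ}

theorem exists_forall_isExposed_le (h : LocalPotential M A F p ρ Ψ)
    (hi : ∀ i, p ∈ closure (M i)) :
    ∃ ρ' > 0, ρ' ≤ ρ ∧ ∀ i, IsExposed (fun j ↦ A j p) i → ∀ z ∈ ball p ρ',
      (F i z).re ≤ Ψ z ∧ (z ∈ M i → Ψ z = (F i z).re) := by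
  have key : ∀ i, ∀ᶠ ρ' : ℝ in 𝓝[>] 0, IsExposed (fun j ↦ A j p) i → ∀ z ∈ ball p ρ',
      (F i z).re ≤ Ψ z ∧ (z ∈ M i → Ψ z = (F i z).re) := by
    intro i
    by_cases he : IsExposed (fun j ↦ A j p) i
    · obtain ⟨ρ', h1, h2, h3⟩ := h.exists_le_of_isExposed (hi i) he
      filter_upwards [nhdsWithin_le_nhds (eventually_lt_nhds h1)] with t ht _ z hz
      exact h3 z (ball_subset_ball ht.le hz)
    · exact Eventually.of_forall fun _ h' ↦ absurd h' he
  obtain ⟨ρ', ⟨h1, h2⟩, h3⟩ := (((eventually_all.2 key).and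
    (nhdsWithin_le_nhds (eventually_lt_nhds h.pos))).and self_mem_nhdsWithin).exists
  exact ⟨ρ', h3, h2.le, h1⟩

/-- Where `Ψ` exceeds every exposed `Re (F i)`, only nonexposed pieces are present, and by the gap
some exposed function grows faster in the direction travelled. Starting from the last point of a
segment from `p` at which there is no excess, none can appear. -/
theorem exists_forall_exists_eq (h : LocalPotential M A F p ρ Ψ)
    (hi : ∀ i, p ∈ closure (M i))
    (hii : ∀ i j k, i ≠ j → i ≠ k → j ≠ k → ∀ t : ℝ,
      A i p - A k p ≠ (t : ℂ) * (A j p - A k p))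
    (hiii : ∀ i k, i ≠ k → A i p ≠ A k p) :
    ∃ ρ' > 0, ρ' ≤ ρ ∧ (∀ i, IsExposed (fun j ↦ A j p) i → ∀ z ∈ ball p ρ',
      (F i z).re ≤ Ψ z ∧ (z ∈ M i → Ψ z = (F i z).re)) ∧
      ∀ z ∈ ball p ρ', ∃ i, IsExposed (fun j ↦ A j p) i ∧ Ψ z = (F i z).re := by
  obtain ⟨ρ₁, hρ₁, hρ₁ρ, hle⟩ := h.exists_forall_isExposed_le hi
  obtain ⟨δ, hδ, hgap⟩ := exists_exposed_gap hii hiii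
  have hpb : p ∈ ball p ρ := mem_ball_self h.pos
  have hev : ∀ᶠ z in 𝓝 p, ∀ j, ‖A j z - A j p‖ ≤ δ / 8 ∧
      ‖F j z - A j p * (z - p)‖ ≤ δ / 8 * ‖z - p‖ := by
    refine eventually_all.2 fun j ↦ Eventually.and ?_ ?_
    · have hc := (h.continuousOn_coeff j).continuousAt (isOpen_ball.mem_nhds hpb)
      filter_upwards [hc.eventually (closedBall_mem_nhds _ (by positivity : 0 < δ / 8))] with z hz
      rwa [← dist_eq_norm]
    · have := (h.hasDerivAt j p hpb).isLittleO.def (by positivity : 0 < δ / 8)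
      filter_upwards [this] with z hz
      rw [h.prim_zero, sub_zero, smul_eq_mul, mul_comm (z - p)] at hz
      exact hz
  obtain ⟨ρ₂, hρ₂, hball⟩ := Metric.eventually_nhds_iff.1 hev
  set ρ' := min ρ₁ ρ₂ with hρ'
  have hρ'ρ : ball p ρ' ⊆ ball p ρ := ball_subset_ball ((min_le_left _ _).trans hρ₁ρ)
  have hρ'1 : ball p ρ' ⊆ ball p ρ₁ := ball_subset_ball (min_le_left _ _)
  have hb : ∀ z ∈ ball p ρ', ∀ j, ‖A j z - A j p‖ ≤ δ / 8 ∧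
      ‖F j z - A j p * (z - p)‖ ≤ δ / 8 * ‖z - p‖ := fun z hz ↦
    hball (lt_of_lt_of_le hz (min_le_right _ _))
  refine ⟨ρ', lt_min hρ₁ hρ₂, (min_le_left _ _).trans hρ₁ρ,
    fun i hie z hz ↦ hle i hie z (hρ'1 hz), fun z₀ hz₀ ↦ ?_⟩
  by_contra hcon
  push Not at hcon
  set W : Set ℂ := ball p ρ' ∩ ⋂ i, {z | IsExposed (fun j ↦ A j p) i → z ∈ ball p ρ' ∧
    (F i z).re < Ψ z} with hW
  have hWo : IsOpen W := by
    have : W = ball p ρ' ∩ ⋂ i, {z | z ∈ ball p ρ' ∧ (IsExposed (fun j ↦ A j p) i →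
        (F i z).re < Ψ z)} := by
      ext z
      simp only [hW, mem_inter_iff, mem_iInter, mem_ofPred_eq]
      grind
    rw [this]
    refine isOpen_ball.inter (isOpen_iInter_of_finite fun i ↦ ?_)
    by_cases hie : IsExposed (fun j ↦ A j p) i
    · have := ((h.continuousOn.mono hρ'ρ).sub ((h.continuousOn_re i).mono hρ'ρ)).isOpen_inter_preimage
        isOpen_ball (isOpen_Ioi (a := (0 : ℝ)))
      convert this using 1
      ext z
      simp [hie]
    · convert isOpen_ball (x := p) (ε := ρ') using 1
      ext z
      simp [hie]
  have hWmem : ∀ z, z ∈ W ↔ z ∈ ball p ρ' ∧ ∀ i, IsExposed (fun j ↦ A j p) i →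
      (F i z).re < Ψ z := by
    intro z
    simp only [hW, mem_inter_iff, mem_iInter, mem_ofPred_eq]
    grind
  have hz₀W : z₀ ∈ W := (hWmem _).2 ⟨hz₀, fun i hie ↦
    lt_of_le_of_ne (hle i hie z₀ (hρ'1 hz₀)).1 (hcon i hie).symm⟩
  obtain ⟨k, hk⟩ := h.dense W hWo (fun z hz ↦ hρ'ρ hz.1) ⟨z₀, hz₀W⟩
  have hnonexp : ∀ j, (W ∩ M j).Nonempty → ¬ IsExposed (fun j ↦ A j p) j := by
    rintro j ⟨z, hzW, hzM⟩ hj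
    have := ((hWmem z).1 hzW).2 j hj
    have := (hle j hj z (hρ'1 hzW.1)).2 hzM
    linarith
  -- The direction `1` is arbitrary: only the existence of some exposed index matters here.
  obtain ⟨i₀, hi₀, -⟩ := hgap 1 k (hnonexp k hk)
  set w := z₀ - p with hw
  have hpW : p ∉ W := fun hp ↦ by
    have := ((hWmem p).1 hp).2 i₀ hi₀
    simp [h.zero, h.prim_zero] at this
  have hw0 : w ≠ 0 := fun h0 ↦ hpW (by rw [← sub_eq_zero.1 h0]; exact hz₀W)
  have hwn : 0 < ‖w‖ := norm_pos_iff.2 hw0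
  have hseg : ∀ t ∈ Icc (0 : ℝ) 1, p + t * w ∈ ball p ρ' := fun t ht ↦
    Convex.add_mul_mem (convex_ball p ρ') (mem_ball_self (lt_min hρ₁ hρ₂))
      (by simpa [hw] using hz₀) ht
  have hlinec : Continuous fun t : ℝ ↦ p + t * w := by fun_prop
  obtain ⟨T, ⟨⟨hT, hTW⟩, hTmax⟩⟩ : ∃ T, IsGreatest
      {t : ℝ | t ∈ Icc (0 : ℝ) 1 ∧ p + t * w ∉ W} T := by
    refine IsCompact.exists_isGreatest ?_ ⟨0, ⟨le_rfl, zero_le_one⟩, by simpa using hpW⟩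
    exact isCompact_Icc.inter_right ((hWo.isClosed_compl).preimage hlinec)
  have hT1 : T < 1 := lt_of_le_of_ne hT.2 fun h1 ↦ hTW (by simpa [h1, hw] using hz₀W)
  have hafter : ∀ t, T < t → t ≤ 1 → p + t * w ∈ W := fun t h1 h2 ↦ by
    by_contra hn
    exact absurd (hTmax ⟨⟨hT.1.trans h1.le, h2⟩, hn⟩) (not_le.2 h1)
  set x := p + T * w with hx
  have hxb := hseg T hT
  -- The index must realize `Ψ` at `x` and be nearly maximal in the direction `w`. At `x = p` all
  -- the functions vanish and a maximizer is chosen. Otherwise `Re (F i)` is already largest among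
  -- the exposed ones at `x`, and dividing the first-order expansion at `p` by `T` costs at most `δ
  -- / 4`.
  obtain ⟨i, hie, hix, hnear⟩ : ∃ i, IsExposed (fun j ↦ A j p) i ∧ Ψ x ≤ (F i x).re ∧
      ∀ i', IsExposed (fun j ↦ A j p) i' →
        -(δ / 4) * ‖w‖ ≤ (w * (A i p - A i' p)).re := by
    rcases hT.1.eq_or_lt with h0 | h0
    · have hxp : x = p := by simp [hx, ← h0]
      obtain ⟨i, hie, hmax⟩ := Set.exists_max_image {i | IsExposed (fun j ↦ A j p) i}
        (fun i ↦ (w * A i p).re) (toFinite _) ⟨i₀, hi₀⟩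
      refine ⟨i, hie, by simp [hxp, h.zero, h.prim_zero], fun i' hi' ↦ ?_⟩
      have := hmax i' hi'
      rw [mul_sub, Complex.sub_re]
      have : 0 ≤ δ / 4 * ‖w‖ := by positivity
      linarith
    · have : ∃ i, IsExposed (fun j ↦ A j p) i ∧ Ψ x ≤ (F i x).re := by
        by_contra hn
        push Not at hn
        exact hTW ((hWmem x).2 ⟨hxb, hn⟩)
      obtain ⟨i, hie, hix⟩ := this
      refine ⟨i, hie, hix, fun i' hi' ↦ ?_⟩
      have h1 := (hle i' hi' x (hρ'1 hxb)).1
      have e1 := (hb x hxb i).2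
      have e2 := (hb x hxb i').2
      have hxp : x - p = T * w := by rw [hx]; ring
      rw [hxp] at e1 e2
      have n1 : ‖(T : ℂ) * w‖ = T * ‖w‖ := by
        rw [norm_mul, Complex.norm_real, Real.norm_of_nonneg hT.1]
      rw [n1] at e1 e2
      have e1' := (abs_le.1 ((Complex.abs_re_le_norm _).trans e1)).2
      have e2' := (abs_le.1 ((Complex.abs_re_le_norm _).trans e2)).1
      rw [Complex.sub_re] at e1' e2'
      have e3 : ∀ j, (A j p * (T * w)).re = T * (w * A j p).re := fun j ↦ by
        rw [← Complex.re_ofReal_mul]; congr 1; ring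
      rw [e3] at e1' e2'
      rw [mul_sub, Complex.sub_re]
      have : T * (-(δ / 4) * ‖w‖) ≤ T * ((w * A i p).re - (w * A i' p).re) := by
        linarith
      exact le_of_mul_le_mul_left this h0
  have hanti : ∀ t, T < t → t ≤ 1 → Ψ z₀ - (F i z₀).re ≤ Ψ (p + t * w) - (F i (p + t * w)).re := by
    intro t ht1 ht2
    have e : p + t * w + ((1 - t : ℝ) : ℂ) * w = z₀ := by
      rw [hw]; push_cast; ring
    have := h.mono i W (((1 - t : ℝ) : ℂ) * w) (p + t * w) hWo (fun z hz ↦ hρ'ρ hz.1) ?_ ?_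
    · rwa [e] at this
    · rintro j z ⟨hzW, hzM⟩
      obtain ⟨i', hi', hg⟩ := hgap w j (hnonexp j ⟨z, hzW, hzM⟩)
      have h1 := hnear i' hi'
      rw [mul_assoc, Complex.re_ofReal_mul]
      refine mul_nonpos_of_nonneg_of_nonpos (by linarith) ?_
      -- In units of `‖w‖`, the three terms are at most `-δ`, `δ / 4` and `δ / 4`, so the sum is
      -- negative.
      have e : w * (A j z - A i z) = -(w * (A i' p - A j p)) - w * (A i p - A i' p)
          + w * ((A j z - A j p) - (A i z - A i p)) := by ring
      have h2 : (w * ((A j z - A j p) - (A i z - A i p))).re ≤ ‖w‖ * (δ / 8 + δ / 8) :=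
        (Complex.re_le_norm _).trans (by
          rw [norm_mul]
          exact mul_le_mul_of_nonneg_left ((norm_sub_le _ _).trans
            (add_le_add (hb z hzW.1 j).1 (hb z hzW.1 i).1)) (norm_nonneg _))
      rw [e, Complex.add_re, Complex.sub_re, Complex.neg_re]
      nlinarith
    · intro s hs
      have : p + t * w + s * (((1 - t : ℝ) : ℂ) * w) = p + ((t + s * (1 - t) : ℝ) : ℂ) * w := by
        push_cast; ring
      rw [this]
      refine hafter _ ?_ ?_
      · nlinarith [hs.1]
      · nlinarith [hs.2]
  have hlim : Tendsto (fun t : ℝ ↦ Ψ (p + t * w) - (F i (p + t * w)).re) (𝓝[>] T)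
      (𝓝 (Ψ x - (F i x).re)) := by
    have hc : ContinuousAt (fun z ↦ Ψ z - (F i z).re) x :=
      (h.continuousOn.sub (h.continuousOn_re i)).continuousAt (isOpen_ball.mem_nhds (hρ'ρ hxb))
    exact (hc.tendsto.comp (hlinec.tendsto T)).mono_left nhdsWithin_le_nhds
  have hfin : Ψ z₀ - (F i z₀).re ≤ Ψ x - (F i x).re := by
    refine ge_of_tendsto hlim ?_
    filter_upwards [Ioc_mem_nhdsGT hT1] with t ht
    exact hanti t ht.1 ht.2
  have := ((hWmem z₀).1 hz₀W).2 i hie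
  linarith

/-- A nonexposed `k` is impossible: at a point of `M k` near `p`, `Ψ` equals some exposed `Re (F
i)`, lies above it nearby, and has the gradient of `Re (F k)`. The difference `Re (F k) - Re (F i)`
then has a local minimum, so `A k = A i` there, contrary to (iii) near `p`. -/
theorem exists_ball_forall_le (h : LocalPotential M A F p ρ Ψ)
    (hi : ∀ i, p ∈ closure (M i))
    (hii : ∀ i j k, i ≠ j → i ≠ k → j ≠ k → ∀ t : ℝ,
      A i p - A k p ≠ (t : ℂ) * (A j p - A k p))
    (hiii : ∀ i k, i ≠ k → A i p ≠ A k p) :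
    (∀ k, IsExposed (fun j ↦ A j p) k) ∧ ∃ ρ' > 0, ρ' ≤ ρ ∧
      ∀ k, ∀ z ∈ ball p ρ' ∩ M k, ∀ j, (F j z).re ≤ (F k z).re := by
  obtain ⟨ρ₁, hρ₁, hρ₁ρ, hle, hex⟩ := h.exists_forall_exists_eq hi hii hiii
  have hsub : ball p ρ₁ ⊆ ball p ρ := ball_subset_ball hρ₁ρ
  have hpb : p ∈ ball p ρ := mem_ball_self h.pos
  have hexp : ∀ k, IsExposed (fun j ↦ A j p) k := by
    intro k
    by_contra hk
    have hev : ∀ᶠ z in 𝓝 p, ∀ i, i ≠ k → A i z ≠ A k z := by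
      refine eventually_all.2 fun i ↦ ?_
      by_cases hik : i = k
      · exact Eventually.of_forall fun _ h' ↦ absurd hik h'
      · have hc : ∀ j, ContinuousAt (A j) p := fun j ↦
          (h.continuousOn_coeff j).continuousAt (isOpen_ball.mem_nhds hpb)
        filter_upwards [((hc i).sub (hc k)).eventually_ne (sub_ne_zero.2 (hiii i k hik))]
          with z hz _ using sub_ne_zero.1 hz
    obtain ⟨z₀, hzM, hzb, hne⟩ := ((mem_closure_iff_frequently.1 (hi k)).and_eventually
      ((eventually_mem_set.2 (ball_mem_nhds p hρ₁)).and hev)).exists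
    obtain ⟨i, hie, hΨi⟩ := hex z₀ hzb
    have hik : i ≠ k := fun h' ↦ hk (h' ▸ hie)
    have hconst := h.sub_eq_of_mem (hsub hzb) hzM
    have hd : HasFDerivAt (fun z ↦ (F k z).re - (F i z).re)
        (reForm (A k z₀) - reForm (A i z₀)) z₀ :=
      (hasFDerivAt_re_of_hasDerivAt (h.hasDerivAt k z₀ (hsub hzb))).sub
        (hasFDerivAt_re_of_hasDerivAt (h.hasDerivAt i z₀ (hsub hzb)))
    have hmin : IsLocalMin (fun z ↦ (F k z).re - (F i z).re) z₀ := by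
      filter_upwards [hconst, isOpen_ball.mem_nhds hzb] with z hz hzb'
      have := (hle i hie z hzb').1
      linarith
    have h0 := hmin.hasFDerivAt_eq_zero hd
    refine hne i hik ?_
    have h1 : ∀ v, ((A k z₀ - A i z₀) * v).re = 0 := fun v ↦ by
      have := congr($h0 v)
      rw [sub_mul, Complex.sub_re]
      simpa [reForm_apply] using this
    have h2 := h1 ((starRingEnd ℂ) (A k z₀ - A i z₀))
    rw [Complex.mul_conj, Complex.ofReal_re, Complex.normSq_eq_zero, sub_eq_zero] at h2
    exact h2.symm
  refine ⟨hexp, ρ₁, hρ₁, hρ₁ρ, fun k z hz j ↦ ?_⟩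
  rw [← (hle k (hexp k) z hz.1).2 hz.2]
  exact (hle j (hexp j) z hz.1).1

end LocalPotential

/-- Positivity of `ν` enters through the identity `∫ (Re (F i) - Ψ) Δg = -2 ∫ g dν`, the first term
being harmonic. -/
theorem IsPiecewiseAnalytic.exists_localPotential {r : ℕ} {U : Opens ℂ} {M : Fin r → Set ℂ}
    {A F : Fin r → ℂ → ℂ} {Φ : ℂ → ℂ} {ν : Measure ℂ} {p : ℂ} (hΦ : IsPiecewiseAnalytic U M A Φ)
    (hw : IsWeakDbar U Φ ν) (hp : p ∈ U) (hF : ∀ i, IsPrimitiveFrom U p (A i) (F i)) :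
    ∃ ρ Ψ, ball p ρ ⊆ U ∧ LocalPotential M A F p ρ Ψ := by
  obtain ⟨R, hR, hRU⟩ := nhds_basis_closedBall.mem_iff.1 (U.isOpen.mem_nhds hp)
  -- Truncation makes the function globally bounded and integrable, as mollification requires, and
  -- fixes its values at every point of each `M i` instead of almost everywhere.
  set f : ℂ → ℂ := (closedBall p R).indicator fun z ↦ ∑ i, (M i).indicator (A i) z with hf
  have hAc : ∀ i, ContinuousOn (A i) (closedBall p R) := fun i ↦
    (hΦ.analytic i).continuousOn.mono hRU
  have hfM : ∀ i, ∀ z ∈ closedBall p R ∩ M i, f z = A i z := by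
    rintro i z ⟨hz, hzi⟩
    rw [hf, indicator_of_mem hz, Finset.sum_eq_single i, indicator_of_mem hzi]
    · intro j _ hji
      exact indicator_of_notMem (fun hzj ↦ disjoint_left.1 (hΦ.disjoint j i hji) hzj hzi) _
    · simp
  have hfint : Integrable f := by
    refine (integrable_indicator_iff measurableSet_closedBall).2
      (integrable_finsetSum _ fun i _ ↦ ?_)
    exact ((hAc i).integrableOn_compact (isCompact_closedBall p R)).indicator
      (hΦ.isOpen i).measurableSet
  obtain ⟨C, hC⟩ : ∃ C, ∀ z, ‖f z‖ ≤ C := by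
    have : ∀ i, ∃ C, ∀ z ∈ closedBall p R, ‖A i z‖ ≤ C := fun i ↦
      (isCompact_closedBall p R).exists_bound_of_continuousOn (hAc i)
    choose C hC using this
    have hC0 : ∀ i, 0 ≤ C i := fun i ↦ (norm_nonneg _).trans (hC i p (mem_closedBall_self hR.le))
    refine ⟨∑ i, C i, fun z ↦ ?_⟩
    by_cases hz : z ∈ closedBall p R
    · rw [hf, indicator_of_mem hz]
      refine (norm_sum_le _ _).trans (Finset.sum_le_sum fun i _ ↦ ?_)
      exact (norm_indicator_le_norm_self _ _).trans (hC i z hz)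
    · rw [hf, indicator_of_notMem hz, norm_zero]
      exact Finset.sum_nonneg fun i _ ↦ hC0 i
  have hfΦ : ∀ᵐ z, z ∈ closedBall p R → f z = Φ z := by
    have := hΦ.eq_sum
    rw [ae_restrict_iff' U.isOpen.measurableSet] at this
    filter_upwards [this] with z hz hzb
    rw [hz (hRU hzb), hf, indicator_of_mem hzb]
  have hweak : ∀ g : ℂ → ℝ, ContDiff ℝ ∞ g → HasCompactSupport g → tsupport g ⊆ ball p R →
      ∫ z, f z * wbar (fun w ↦ (g w : ℂ)) z = -((∫ z, g z ∂ν : ℝ) : ℂ) := by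
    intro g h1 h2 h3
    have hts : tsupport (fun w ↦ (g w : ℂ)) ⊆ ball p R := (tsupport_ofReal_comp g).subset.trans h3
    rw [← integral_complex_ofReal, ← hw (fun w ↦ (g w : ℂ)) (contDiff_ofReal_comp h1)
      (h2.comp_left (g := fun x : ℝ ↦ (x : ℂ)) Complex.ofReal_zero)
      (hts.trans (ball_subset_closedBall.trans hRU))]
    refine integral_congr_ae ?_
    filter_upwards [hfΦ] with z hz
    by_cases hzs : z ∈ tsupport (wbar fun w ↦ (g w : ℂ))
    · rw [hz (ball_subset_closedBall (hts (tsupport_wbar_subset _ hzs)))]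
    · rw [image_eq_zero_of_notMem_tsupport hzs, mul_zero, mul_zero]
  obtain ⟨Ψ, hΨ⟩ := exists_isPotential hR hfint.locallyIntegrable hC fun g h1 h2 h3 ↦ by
    rw [hweak g h1 h2 h3]; simp
  have hsub : ball p (R / 3) ⊆ closedBall p R :=
    (ball_subset_ball (by linarith)).trans ball_subset_closedBall
  have hsub' : ball p (R / 3) ⊆ ball p R := ball_subset_ball (by linarith)
  have hbU : ball p (R / 3) ⊆ U := hsub.trans hRU
  have hae : ∀ᵐ z, z ∈ ball p (R / 3) → ∃ i, z ∈ M i := by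
    have h0 : ∀ᵐ z, z ∉ (U : Set ℂ) \ ⋃ i, M i := measure_eq_zero_iff_ae_notMem.1 hΦ.null
    filter_upwards [h0] with z hz hzb
    by_contra hn
    exact hz ⟨hbU hzb, by simpa using hn⟩
  refine ⟨R / 3, Ψ, hbU, ⟨by positivity, hΨ.zero, fun i ↦ (hF i).1, hΦ.isOpen, hΦ.disjoint,
    fun i z hz ↦ (hF i).2 z (hbU hz), fun i ↦ (hAc i).mono hsub, hΨ.continuousOn, ?_, ?_, ?_⟩⟩
  · intro i O u z hO hOb hu hz
    refine hΨ.sub_re_le hO hOb (fun w hw ↦ (hF i).2 w (hbU (hOb hw)))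
      (((hAc i).mono hsub).mono hOb) ?_ hz
    rw [ae_restrict_iff' hO.measurableSet]
    filter_upwards [hae] with w hw hwO
    obtain ⟨j, hj⟩ := hw (hOb hwO)
    rw [hfM j w ⟨hsub (hOb hwO), hj⟩]
    exact hu j w ⟨hwO, hj⟩
  · intro i g h1 h2 h3 h4
    have hl := continuous_lap h1
    have hlc : HasCompactSupport (lap g) :=
      h2.of_isClosed_subset (isClosed_tsupport _) (tsupport_lap_subset g)
    have hls := (tsupport_lap_subset g).trans h3
    have hFd : ∀ z ∈ ball p (R / 3), HasFDerivAt (fun w ↦ (F i w).re) (reForm (A i z)) z :=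
      fun z hz ↦ hasFDerivAt_re_of_hasDerivAt ((hF i).2 z (hbU hz))
    have i1 : Integrable fun z ↦ (F i z).re * lap g z :=
      integrable_mul_of_locallyIntegrableOn (O := ball p (R / 3))
        (ContinuousOn.locallyIntegrableOn (fun z hz ↦
          (hFd z hz).continuousAt.continuousWithinAt) measurableSet_ball) hl hlc hls
    have i2 : Integrable fun z ↦ Ψ z * lap g z :=
      integrable_mul_of_locallyIntegrableOn (O := ball p (R / 3))
        (hΨ.continuousOn.locallyIntegrableOn measurableSet_ball) hl hlc hls
    simp_rw [sub_mul]
    rw [integral_sub i1 i2, hΨ.integral_lap g h1 h2 h3, hweak g h1 h2 (h3.trans hsub'),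
      integral_mul_lap isOpen_ball hFd ((hAc i).mono hsub) h1 h2 h3,
      integral_holomorphic_mul_wbar isOpen_ball (a := A i)
        (((hΦ.analytic i).mono hbU).differentiableOn) ((contDiff_ofReal_comp h1).of_le (by simp))
        (h2.comp_left (g := fun x : ℝ ↦ (x : ℂ)) Complex.ofReal_zero)
        ((tsupport_ofReal_comp g).subset.trans h3)]
    have := integral_nonneg (μ := ν) (f := g) h4
    simp
    exact this
  · intro O hO hOb hne
    by_contra hn
    push Not at hn
    have h0 : volume O = 0 := by
      refine measure_mono_null (fun z hz ↦ ?_) hΦ.null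
      refine ⟨hbU (hOb hz), fun hzM ↦ ?_⟩
      obtain ⟨i, hi⟩ := mem_iUnion.1 hzM
      exact notMem_empty z (hn i ▸ ⟨hz, hi⟩)
    exact (hO.measure_pos volume hne).ne' h0

/-! ### Charts straightening a level curve -/

/-- `S` is a holomorphic inverse, defined on `ball c ρ`, of the restriction of the holomorphic
function `G`, with derivative `G'`, to the open set `N`. -/
structure IsLevelChart (G G' S : ℂ → ℂ) (N : Set ℂ) (c : ℂ) (ρ : ℝ) : Prop where
  pos : 0 < ρ
  isOpen : IsOpen N
  mapsTo : MapsTo G N (ball c ρ)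
  mapsTo_inv : MapsTo S (ball c ρ) N
  left_inv : ∀ z ∈ N, S (G z) = z
  right_inv : ∀ w ∈ ball c ρ, G (S w) = w
  hasDerivAt : ∀ z ∈ N, HasDerivAt G (G' z) z
  deriv_ne_zero : ∀ z ∈ N, G' z ≠ 0
  hasDerivAt_inv : ∀ w ∈ ball c ρ, HasDerivAt S (G' (S w))⁻¹ w

/-- The holomorphic inverse function theorem, shrunk so that the image is a disc. Half-planes then
meet the image in convex sets, which gives connectedness of the two sides of a level curve. -/
theorem exists_isLevelChart {G G' : ℂ → ℂ} {V : Set ℂ} (hV : IsOpen V)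
    (hG : ∀ z ∈ V, HasDerivAt G (G' z) z) {z₀ : ℂ} (hz₀ : z₀ ∈ V) (h0 : G' z₀ ≠ 0) :
    ∃ (ρ : ℝ) (S : ℂ → ℂ) (N : Set ℂ), z₀ ∈ N ∧ N ⊆ V ∧ IsLevelChart G G' S N (G z₀) ρ := by
  have hd : DifferentiableOn ℂ G V := fun z hz ↦ (hG z hz).differentiableAt.differentiableWithinAt
  have hcont : ContinuousOn G' V :=
    ((hd.deriv hV).continuousOn).congr fun z hz ↦ (hG z hz).deriv.symm
  have hs : HasStrictDerivAt G (G' z₀) z₀ := by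
    have := (hd.analyticAt (hV.mem_nhds hz₀)).hasStrictDerivAt
    rwa [(hG z₀ hz₀).deriv] at this
  let e := (hs.hasStrictFDerivAt_equiv h0).toOpenPartialHomeomorph G
  have he : ∀ z, e z = G z := fun z ↦ rfl
  have hz₀e : z₀ ∈ e.source := (hs.hasStrictFDerivAt_equiv h0).mem_toOpenPartialHomeomorph_source
  have hV' : IsOpen (V ∩ G' ⁻¹' {0}ᶜ) :=
    hcont.isOpen_inter_preimage hV isOpen_compl_singleton
  have hT : IsOpen (e.target ∩ e.symm ⁻¹' (V ∩ G' ⁻¹' {0}ᶜ)) :=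
    e.symm.isOpen_inter_preimage hV'
  have hz₀T : G z₀ ∈ e.target ∩ e.symm ⁻¹' (V ∩ G' ⁻¹' {0}ᶜ) := by
    refine ⟨e.map_source hz₀e, ?_⟩
    rw [mem_preimage, ← he, e.left_inv hz₀e]
    exact ⟨hz₀, h0⟩
  obtain ⟨ρ, hρ, hball⟩ := Metric.isOpen_iff.1 hT _ hz₀T
  have hNsub : ∀ z ∈ e.source ∩ e ⁻¹' ball (G z₀) ρ, z ∈ V ∩ G' ⁻¹' {0}ᶜ := by
    rintro z ⟨hz1, hz2⟩
    have := (hball hz2).2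
    rwa [mem_preimage, e.left_inv hz1] at this
  refine ⟨ρ, e.symm, e.source ∩ e ⁻¹' ball (G z₀) ρ, ⟨hz₀e, mem_ball_self hρ⟩,
    fun z hz ↦ (hNsub z hz).1, hρ, e.isOpen_inter_preimage isOpen_ball, fun z hz ↦ hz.2,
    fun w hw ↦ ?_, fun z hz ↦ e.left_inv hz.1, fun w hw ↦ e.right_inv (hball hw).1,
    fun z hz ↦ hG z (hNsub z hz).1, fun z hz ↦ (hNsub z hz).2, fun w hw ↦ ?_⟩
  · refine ⟨e.map_target (hball hw).1, ?_⟩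
    rwa [mem_preimage, e.right_inv (hball hw).1]
  · exact e.hasDerivAt_symm (hball hw).1 (hball hw).2.2 (hG _ (hball hw).2.1)

namespace IsLevelChart

variable {G G' S : ℂ → ℂ} {N : Set ℂ} {c : ℂ} {ρ : ℝ}

theorem injOn_inv (h : IsLevelChart G G' S N c ρ) : InjOn S (ball c ρ) := fun x hx y hy hxy ↦ by
  rw [← h.right_inv x hx, ← h.right_inv y hy, hxy]

theorem deriv_inv_ne_zero (h : IsLevelChart G G' S N c ρ) {w : ℂ} (hw : w ∈ ball c ρ) :
    (G' (S w))⁻¹ ≠ 0 :=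
  inv_ne_zero (h.deriv_ne_zero _ (h.mapsTo_inv hw))

theorem isRegularArc (h : IsLevelChart G G' S N c ρ) {a b : ℂ} (hb : b ≠ 0) {I : Set ℝ}
    (hI : ∀ t ∈ I, a + t * b ∈ ball c ρ) :
    IsRegularArc (fun t : ℝ ↦ S (a + t * b)) I ∧
      ∀ t ∈ I, HasDerivAt (fun t : ℝ ↦ S (a + t * b)) ((G' (S (a + t * b)))⁻¹ * b) t := by
  have hd : ∀ t ∈ I, HasDerivAt (fun t : ℝ ↦ S (a + t * b)) ((G' (S (a + t * b)))⁻¹ * b) t := by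
    intro t ht
    have h1 : HasDerivAt (fun t : ℝ ↦ a + t * b) b t := by
      simpa using ((Complex.ofRealCLM.hasDerivAt (x := t)).mul_const b).const_add a
    exact (h.hasDerivAt_inv _ (hI t ht)).comp t h1
  refine ⟨⟨fun t ht ↦ ?_, fun t ht ↦ ?_, fun s hs t ht hst ↦ ?_⟩, hd⟩
  · have hSa : AnalyticAt ℂ S (a + t * b) :=
      DifferentiableOn.analyticAt
        (fun w hw ↦ (h.hasDerivAt_inv w hw).differentiableAt.differentiableWithinAt)
        (isOpen_ball.mem_nhds (hI t ht))
    have h1 : AnalyticAt ℝ (fun t : ℝ ↦ a + t * b) t :=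
      analyticAt_const.add ((Complex.ofRealCLM.analyticAt t).mul analyticAt_const)
    exact (hSa.restrictScalars (𝕜 := ℝ)).comp_of_eq h1 rfl
  · rw [(hd t ht).deriv]
    exact mul_ne_zero (h.deriv_inv_ne_zero (hI t ht)) hb
  · have := h.injOn_inv (hI s hs) (hI t ht) hst
    have := mul_right_cancel₀ hb (add_left_cancel this)
    exact_mod_cast this

theorem inter_preimage_eq_image (h : IsLevelChart G G' S N c ρ) (P : Set ℂ) :
    N ∩ G ⁻¹' P = S '' (ball c ρ ∩ P) := by
  ext z
  constructor
  · rintro ⟨hz1, hz2⟩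
    exact ⟨G z, ⟨h.mapsTo hz1, hz2⟩, h.left_inv z hz1⟩
  · rintro ⟨w, ⟨hw1, hw2⟩, rfl⟩
    refine ⟨h.mapsTo_inv hw1, ?_⟩
    rwa [mem_preimage, h.right_inv w hw1]

theorem isConnected_inter_preimage (h : IsLevelChart G G' S N c ρ) {P : Set ℂ} (hP : Convex ℝ P)
    (hne : (ball c ρ ∩ P).Nonempty) : IsConnected (N ∩ G ⁻¹' P) := by
  rw [h.inter_preimage_eq_image]
  exact (((convex_ball c ρ).inter hP).isConnected hne).image S fun w hw ↦
    (h.hasDerivAt_inv w hw.1).continuousAt.continuousWithinAt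

end IsLevelChart

/-! ### The jump formula -/

/-- By Fubini's theorem the vertical derivative integrates to zero and the horizontal one leaves a
boundary term on the imaginary axis. -/
theorem integral_wbar_halfPlane {h : ℂ → ℂ} (hh : ContDiff ℝ 1 h) (hc : HasCompactSupport h) :
    ∫ z in {z : ℂ | 0 < z.re}, wbar h z = -(1 / 2) * ∫ y : ℝ, h (y * Complex.I) := by
  have hfc : ∀ v, Continuous fun z ↦ fderiv ℝ h z v := fun v ↦ by
    have := hh.continuous_fderiv one_ne_zero
    fun_prop
  have hfs : ∀ v, HasCompactSupport fun z ↦ fderiv ℝ h z v := fun v ↦ hc.fderiv_apply ℝ v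
  have hfi : ∀ v, Integrable fun z ↦ fderiv ℝ h z v := fun v ↦
    (hfc v).integrable_of_hasCompactSupport (hfs v)
  have hmp := Complex.volume_preserving_equiv_real_prod.symm
  have hset : MeasurableSet {z : ℂ | 0 < z.re} :=
    (isOpen_lt continuous_const Complex.continuous_re).measurableSet
  have hpre : Complex.measurableEquivRealProd.symm ⁻¹' {z : ℂ | 0 < z.re}
      = Ioi (0 : ℝ) ×ˢ (univ : Set ℝ) := by
    ext x
    simp [Complex.measurableEquivRealProd]
  have hprod : ∀ v, ∫ z in {z : ℂ | 0 < z.re}, fderiv ℝ h z v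
      = ∫ x in Ioi (0 : ℝ) ×ˢ (univ : Set ℝ), fderiv ℝ h (x.1 + x.2 * Complex.I) v := by
    intro v
    rw [← hmp.setIntegral_preimage_emb (Complex.measurableEquivRealProd.symm.measurableEmbedding),
      hpre]
    refine setIntegral_congr_fun (measurableSet_Ioi.prod MeasurableSet.univ) fun x _ ↦ ?_
    congr 2
    apply Complex.ext <;> simp [Complex.measurableEquivRealProd]
  have hint : ∀ v, IntegrableOn (fun x : ℝ × ℝ ↦ fderiv ℝ h (x.1 + x.2 * Complex.I) v)
      (Ioi (0 : ℝ) ×ˢ (univ : Set ℝ)) (volume.prod volume) := by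
    intro v
    have := (hmp.integrable_comp_emb
      (Complex.measurableEquivRealProd.symm.measurableEmbedding)).2 (hfi v)
    refine (Integrable.congr this (Eventually.of_forall fun x ↦ ?_)).integrableOn
    simp only [Function.comp_apply]
    congr 2
    apply Complex.ext <;> simp [Complex.measurableEquivRealProd]
  have hdx : ∀ x y : ℝ, HasDerivAt (fun x : ℝ ↦ h (x + y * Complex.I))
      (fderiv ℝ h (x + y * Complex.I) 1) x := by
    intro x y
    have h1 : HasDerivAt (fun x : ℝ ↦ (x : ℂ) + y * Complex.I) 1 x := by
      simpa using (Complex.ofRealCLM.hasDerivAt (x := x)).add_const (y * Complex.I)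
    exact (hh.differentiable one_ne_zero _).hasFDerivAt.comp_hasDerivAt x h1
  have hdy : ∀ x y : ℝ, HasDerivAt (fun y : ℝ ↦ h (x + y * Complex.I))
      (fderiv ℝ h (x + y * Complex.I) Complex.I) y := by
    intro x y
    have h1 : HasDerivAt (fun y : ℝ ↦ (x : ℂ) + y * Complex.I) Complex.I y := by
      simpa using ((Complex.ofRealCLM.hasDerivAt (x := y)).mul_const Complex.I).const_add (x : ℂ)
    exact (hh.differentiable one_ne_zero _).hasFDerivAt.comp_hasDerivAt y h1
  have hclx : ∀ y : ℝ, Topology.IsClosedEmbedding fun x : ℝ ↦ (x : ℂ) + y * Complex.I := fun y ↦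
    (Homeomorph.addRight ((y : ℂ) * Complex.I)).isClosedEmbedding.comp
      Complex.isometry_ofReal.isClosedEmbedding
  have hcly : ∀ x : ℝ, Topology.IsClosedEmbedding fun y : ℝ ↦ (x : ℂ) + y * Complex.I := fun x ↦
    ((Homeomorph.addLeft (x : ℂ)).isClosedEmbedding.comp
      (Homeomorph.mulRight₀ Complex.I Complex.I_ne_zero).isClosedEmbedding).comp
      Complex.isometry_ofReal.isClosedEmbedding
  have e1 : ∫ z in {z : ℂ | 0 < z.re}, fderiv ℝ h z 1 = -∫ y : ℝ, h (y * Complex.I) := by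
    rw [hprod, Measure.volume_eq_prod, ← Measure.prod_restrict,
      integral_prod_symm _ (by rw [Measure.prod_restrict]; exact hint 1), Measure.restrict_univ,
      ← integral_neg]
    congr 1
    ext y
    have hcs : HasCompactSupport fun x : ℝ ↦ h (x + y * Complex.I) :=
      hc.comp_isClosedEmbedding (hclx y)
    have := integral_Ioi_of_hasDerivAt_of_tendsto (a := 0) (m := 0)
      ((hdx 0 y).continuousAt.continuousWithinAt) (fun x _ ↦ hdx x y)
      (((hfc 1).comp (hclx y).continuous).integrable_of_hasCompactSupport
        ((hfs 1).comp_isClosedEmbedding (hclx y))).integrableOn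
      (hcs.is_zero_at_infty.mono_left (by rw [cocompact_eq_atBot_atTop]; exact le_sup_right))
    rw [this]
    simp
  have e2 : ∫ z in {z : ℂ | 0 < z.re}, fderiv ℝ h z Complex.I = 0 := by
    rw [hprod, Measure.volume_eq_prod, setIntegral_prod _ (hint Complex.I)]
    simp only [Measure.restrict_univ]
    refine (setIntegral_congr_fun measurableSet_Ioi fun x _ ↦ ?_).trans (integral_zero _ _)
    have hcs : HasCompactSupport fun y : ℝ ↦ h (x + y * Complex.I) :=
      hc.comp_isClosedEmbedding (hcly x)
    exact integral_eq_zero_of_hasDerivAt_of_integrable (fun y ↦ hdy x y)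
      (((hfc Complex.I).comp (hcly x).continuous).integrable_of_hasCompactSupport
        ((hfs Complex.I).comp_isClosedEmbedding (hcly x)))
      ((hh.continuous.comp (hcly x).continuous).integrable_of_hasCompactSupport hcs)
  unfold wbar
  rw [integral_div, integral_add (hfi 1).integrableOn ((hfi _).const_mul _).integrableOn,
    integral_const_mul, e1, e2]
  ring

/-- Under `z = S w` the Jacobian is `|S'|²` and `G' S' = 1`, so the integrand becomes the conjugate
of `S'` times `∂g/∂z̄`, which is exactly the `∂/∂w̄` derivative of `g ∘ S`. The half-plane formula
applies to its extension by zero. -/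
theorem IsLevelChart.integral_mul_wbar {G G' S : ℂ → ℂ} {N : Set ℂ} {c : ℂ} {ρ : ℝ}
    (hS : IsLevelChart G G' S N c ρ) {g : ℂ → ℂ} (hg : ContDiff ℝ 1 g) (hc : HasCompactSupport g)
    (hs : tsupport g ⊆ N) :
    ∫ z in N ∩ {z | 0 < (G z).re}, G' z * wbar g z
      = -(1 / 2) * ∫ y : ℝ, (ball c ρ).indicator (fun w ↦ g (S w)) (y * Complex.I) := by
  set h : ℂ → ℂ := (ball c ρ).indicator fun w ↦ g (S w) with hh
  have hGc : ContinuousOn G (tsupport g) := fun z hz ↦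
    (hS.hasDerivAt z (hs hz)).continuousAt.continuousWithinAt
  have hK : IsCompact (G '' tsupport g) := IsCompact.image_of_continuousOn hc hGc
  have hsupp : Function.support h ⊆ G '' tsupport g := by
    intro w hw
    have hwB : w ∈ ball c ρ := by
      by_contra hn
      exact hw (indicator_of_notMem hn _)
    refine ⟨S w, subset_tsupport g fun h0 ↦ hw ?_, hS.right_inv w hwB⟩
    rw [hh, indicator_of_mem hwB, h0]
  have hhc : HasCompactSupport h :=
    hK.of_isClosed_subset (isClosed_tsupport _) (closure_minimal hsupp hK.isClosed)
  have hnear : ∀ w ∈ ball c ρ, h =ᶠ[𝓝 w] fun w ↦ g (S w) := fun w hw ↦ by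
    filter_upwards [isOpen_ball.mem_nhds hw] with w' hw' using indicator_of_mem hw' _
  have hSd : ∀ w ∈ ball c ρ, ContDiffAt ℝ 1 S w := fun w hw ↦ by
    have : AnalyticAt ℂ S w :=
      DifferentiableOn.analyticAt
        (fun w hw ↦ (hS.hasDerivAt_inv w hw).differentiableAt.differentiableWithinAt)
        (isOpen_ball.mem_nhds hw)
    exact (this.contDiffAt (n := 1)).restrict_scalars ℝ
  have hhd : ContDiff ℝ 1 h := by
    refine contDiff_iff_contDiffAt.2 fun w ↦ ?_
    by_cases hw : w ∈ ball c ρ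
    · exact (hg.contDiffAt.comp w (hSd w hw)).congr_of_eventuallyEq (hnear w hw)
    · have hwK : w ∉ tsupport h := fun hwK ↦ by
        obtain ⟨z, hz, rfl⟩ := closure_minimal hsupp hK.isClosed hwK
        exact hw (hS.mapsTo (hs hz))
      exact contDiffAt_const.congr_of_eventuallyEq (notMem_tsupport_iff_eventuallyEq.1 hwK)
  have hwb : ∀ w ∈ ball c ρ, wbar h w = (starRingEnd ℂ) (G' (S w))⁻¹ * wbar g (S w) := by
    intro w hw
    rw [← wbar_comp_holomorphic (hS.hasDerivAt_inv w hw) (hg.differentiable one_ne_zero _)]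
    unfold wbar
    rw [(hnear w hw).fderiv_eq]
  have hset : MeasurableSet (ball c ρ ∩ {z | 0 < z.re}) :=
    measurableSet_ball.inter (isOpen_lt continuous_const Complex.continuous_re).measurableSet
  have himg : N ∩ {z | 0 < (G z).re} = S '' (ball c ρ ∩ {z | 0 < z.re}) :=
    hS.inter_preimage_eq_image {z | 0 < z.re}
  rw [himg, integral_image_eq_integral_abs_det_fderiv_smul volume hset
    (fun w hw ↦ ((hS.hasDerivAt_inv w hw.1).hasFDerivAt.restrictScalars ℝ).hasFDerivWithinAt)
    (hS.injOn_inv.mono inter_subset_left), ← integral_wbar_halfPlane hhd hhc]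
  have hzero : ∀ w ∈ {z : ℂ | 0 < z.re} \ (ball c ρ ∩ {z | 0 < z.re}), wbar h w = 0 := by
    intro w hw
    refine image_eq_zero_of_notMem_tsupport fun hwt ↦ ?_
    obtain ⟨z, hz, rfl⟩ := closure_minimal hsupp hK.isClosed (tsupport_wbar_subset h hwt)
    exact hw.2 ⟨hS.mapsTo (hs hz), hw.1⟩
  rw [setIntegral_eq_of_subset_of_forall_sdiff_eq_zero
    (isOpen_lt continuous_const Complex.continuous_re).measurableSet inter_subset_right hzero]
  refine setIntegral_congr_fun hset fun w hw ↦ ?_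
  rw [hwb w hw.1]
  have hdet : ∀ a : ℂ, |((ContinuousLinearMap.toSpanSingleton ℂ a).restrictScalars ℝ).det|
      = Complex.normSq a := by
    intro a
    have : ((ContinuousLinearMap.toSpanSingleton ℂ a).restrictScalars ℝ).det
        = Complex.normSq a := by
      simp [ContinuousLinearMap.det, LinearMap.det_restrictScalars, Algebra.norm_complex_eq]
    rw [this, abs_of_nonneg (Complex.normSq_nonneg _)]
  have h0 := hS.deriv_ne_zero _ (hS.mapsTo_inv hw.1)
  rw [hdet, Complex.real_smul, ← Complex.mul_conj]
  field_simp

/-! ### The measure near a regular point of a level curve -/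

theorem volume_re_eq_zero : volume {z : ℂ | z.re = 0} = 0 := by
  have h : ({z : ℂ | z.re = 0} : Set ℂ) = (LinearMap.ker Complex.reLm : Submodule ℝ ℂ) := by
    ext z; simp
  rw [h]
  refine Measure.addHaar_submodule _ _ fun htop ↦ ?_
  have : (1 : ℂ) ∈ LinearMap.ker Complex.reLm := htop ▸ Submodule.mem_top
  simp at this

/-- In the chart the curve has speed inversely proportional to `|A i - A j|`, so the density of `ν`
against length becomes constant in the parameter. -/
theorem lengthMeasure_withDensity {γ : ℝ → ℂ} {I : Set ℝ} (hI : MeasurableSet I)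
    (hγ : ContinuousOn γ I) {N : Set ℂ} (hN : MeasurableSet N) (hγN : MapsTo γ I N) {f : ℂ → ℝ}
    (hf : ContinuousOn f N) {κ : ℝ} (hκ : ∀ t ∈ I, ‖deriv γ t‖ * f (γ t) = κ) :
    (lengthMeasure γ I).withDensity (fun w ↦ ENNReal.ofReal (f w))
      = ENNReal.ofReal κ • (volume.restrict I).map γ := by
  have hγm : AEMeasurable γ (volume.restrict I) := hγ.aemeasurable hI
  set m := (volume.restrict I).withDensity fun t ↦ ENNReal.ofReal ‖deriv γ t‖ with hm
  have hdm : Measurable fun t ↦ ENNReal.ofReal ‖deriv γ t‖ :=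
    (measurable_deriv γ).norm.ennreal_ofReal
  have hγm' : AEMeasurable γ m := hγm.mono_ac (withDensity_absolutelyContinuous _ _)
  have hmem : ∀ᵐ w ∂(m.map γ), w ∈ N := by
    refine (ae_map_iff hγm' (p := fun w ↦ w ∈ N) hN).2 ?_
    refine (withDensity_absolutelyContinuous _ _).ae_le ?_
    filter_upwards [ae_restrict_mem hI] with t ht using hγN ht
  have hfm : AEMeasurable (fun w ↦ ENNReal.ofReal (f w)) (m.map γ) := by
    rw [← Measure.restrict_eq_self_of_ae_mem hmem]
    exact (hf.aemeasurable hN).ennreal_ofReal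
  ext s hs
  rw [withDensity_apply _ hs, Measure.smul_apply, lengthMeasure, ← lintegral_indicator hs,
    lintegral_map' (hfm.indicator hs) hγm', smul_eq_mul,
    lintegral_withDensity_eq_lintegral_mul_non_measurable₀ _ hdm.aemeasurable
      (Eventually.of_forall fun t ↦ ENNReal.ofReal_lt_top), Measure.map_apply_of_aemeasurable hγm hs,
    ← lintegral_indicator_const₀ (hγm.nullMeasurable hs)]
  refine setLIntegral_congr_fun hI fun t ht ↦ ?_
  by_cases hts : γ t ∈ s
  · simp only [Pi.mul_apply, indicator_of_mem hts, indicator_of_mem (show t ∈ γ ⁻¹' s from hts)]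
    rw [← ENNReal.ofReal_mul (norm_nonneg _), hκ t ht]
  · simp [indicator_of_notMem hts, indicator_of_notMem (show t ∉ γ ⁻¹' s from hts)]

/-- In the coordinate `G = F i - F j` the curve is a vertical diameter and `Φ` jumps by `G'` across
it. The jump formula turns this into half of the Lebesgue measure `dy`, and `dy = |G'| ds`. -/
theorem locallyDescribedAt_of_isLevelChart {r : ℕ} {U : Opens ℂ} {A F : Fin r → ℂ → ℂ}
    {Φ : ℂ → ℂ} {T : 𝓓'(U, ℂ)} {ν : Measure ℂ} {V : Set ℂ} {z₀ : ℂ} {i j : Fin r} (hij : i ≠ j)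
    (hA : ∀ i, DifferentiableOn ℂ (A i) U) 
    (hν : IsMeasureOf T ν) (hw : IsWeakDbar U Φ ν)
    {S : ℂ → ℂ} {N : Set ℂ} {c : ℂ} {ρ : ℝ}
    (hS : IsLevelChart (fun z ↦ F i z - F j z) (fun z ↦ A i z - A j z) S N c ρ) (hc : c.re = 0)
    (hNV : N ⊆ V) (hVU : V ⊆ U)
    (hΦi : ∀ᵐ w ∂volume.restrict (N ∩ {w | 0 < (F i w - F j w).re}), Φ w = A i w)
    (hΦj : ∀ᵐ w ∂volume.restrict (N ∩ {w | (F i w - F j w).re < 0}), Φ w = A j w)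
    (hz₀ : z₀ ∈ N) (hre : (F i z₀ - F j z₀).re = 0) :
    HasNormalAt ν.support z₀ ∧
      LocallyDescribedAt A (fun i z ↦ (F i z).re) Φ ν ν.support V z₀ := by
  set G : ℂ → ℂ := fun z ↦ F i z - F j z with hG
  set G' : ℂ → ℂ := fun z ↦ A i z - A j z with hG'
  have hNU : N ⊆ U := hNV.trans hVU
  have hGc : ContinuousOn G N := fun z hz ↦ (hS.hasDerivAt z hz).continuousAt.continuousWithinAt
  set Np := N ∩ {w | 0 < (G w).re} with hNp
  set Nm := N ∩ {w | (G w).re < 0} with hNm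
  have hNpo : IsOpen Np :=
    (Complex.continuous_re.comp_continuousOn hGc).isOpen_inter_preimage hS.isOpen isOpen_Ioi
  have hNmo : IsOpen Nm :=
    (Complex.continuous_re.comp_continuousOn hGc).isOpen_inter_preimage hS.isOpen isOpen_Iio
  set N0 := N ∩ {w | (G w).re = 0} with hN0
  have hN0null : volume N0 = 0 := by
    have himg : N0 ⊆ S '' (ball c ρ ∩ {w | w.re = 0}) := fun z hz ↦
      ⟨G z, ⟨hS.mapsTo hz.1, hz.2⟩, hS.left_inv z hz.1⟩
    refine measure_mono_null himg (addHaar_image_eq_zero_of_differentiableOn_of_addHaar_eq_zero _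
      (fun w hw ↦ ((hS.hasDerivAt_inv w hw.1).differentiableAt.restrictScalars
        ℝ).differentiableWithinAt) ?_)
    exact measure_mono_null inter_subset_right volume_re_eq_zero
  -- the parametrization of the curve
  set b : ℂ := ρ * Complex.I with hb
  have hρC : (ρ : ℂ) ≠ 0 := by exact_mod_cast hS.pos.ne'
  have hb0 : b ≠ 0 := mul_ne_zero hρC Complex.I_ne_zero
  have hbn : ‖b‖ = ρ := by rw [hb]; simp [abs_of_pos hS.pos]
  have hmemB : ∀ t : ℝ, c + t * b ∈ ball c ρ ↔ t ∈ Ioo (-1 : ℝ) 1 := by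
    intro t
    rw [mem_ball, dist_eq_norm, add_sub_cancel_left, norm_mul, hbn, Complex.norm_real,
      Real.norm_eq_abs, mem_Ioo, ← abs_lt]
    exact mul_lt_iff_lt_one_left hS.pos
  obtain ⟨harc, hderiv⟩ := hS.isRegularArc (a := c) hb0 fun t ht ↦ (hmemB t).2 ht
  set γ : ℝ → ℂ := fun t ↦ S (c + t * b) with hγ
  have hγc : ContinuousOn γ (Ioo (-1) 1) := fun t ht ↦
    (hderiv t ht).continuousAt.continuousWithinAt
  have hcre : ∀ t : ℝ, (c + t * b).re = 0 := fun t ↦ by simp [hb, hc]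
  have hγN : MapsTo γ (Ioo (-1) 1) N0 := fun t ht ↦ by
    have hB := (hmemB t).2 ht
    refine ⟨hS.mapsTo_inv hB, ?_⟩
    change (G (S (c + t * b))).re = 0
    rw [hS.right_inv _ hB, hcre]
  have himg : γ '' Ioo (-1) 1 = N0 := by
    refine Subset.antisymm hγN.image_subset fun z hz ↦ ?_
    have hzB := hS.mapsTo hz.1
    set t := ((G z).im - c.im) / ρ with ht
    have e : c + t * b = G z := by
      have hz2 : (G z).re = 0 := hz.2
      apply Complex.ext
      · rw [hcre, hz2]
      · simp [hb, ht]
        field_simp [hS.pos.ne']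
        ring
    refine ⟨t, (hmemB t).1 (e ▸ hzB), ?_⟩
    simp only [hγ, e]
    exact hS.left_inv z hz.1
  -- the measure
  set μ := ENNReal.ofReal (ρ / 2) • (volume.restrict (Ioo (-1 : ℝ) 1)).map γ with hμ
  have hγm : AEMeasurable γ (volume.restrict (Ioo (-1) 1)) := hγc.aemeasurable measurableSet_Ioo
  have hμN : μ.restrict N = μ := by
    refine Measure.restrict_eq_self_of_ae_mem ?_
    refine Measure.smul_absolutelyContinuous.ae_le ?_
    refine (ae_map_iff hγm (p := fun w ↦ w ∈ N) hS.isOpen.measurableSet).2 ?_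
    filter_upwards [ae_restrict_mem measurableSet_Ioo] with t ht using (hγN ht).1
  have hνμ : ν.restrict N = μ := by
    rw [← hμN]
    have hfin : IsFiniteMeasure μ := by
      have : IsFiniteMeasure ((volume.restrict (Ioo (-1 : ℝ) 1)).map γ) := inferInstance
      exact Measure.smul_finite _ ENNReal.ofReal_ne_top
    refine restrict_eq_of_integral_contDiff_eq hS.isOpen
      (fun K hK hKN ↦ hν.finite_compact K hK (hKN.trans hNU)) (fun K _ _ ↦ measure_lt_top μ K)
      fun g h1 h2 h3 ↦ ?_
    have hts : tsupport (fun w ↦ (g w : ℂ)) ⊆ N := (tsupport_ofReal_comp g).subset.trans h3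
    have hgC := contDiff_ofReal_comp h1
    have hgC1 : ContDiff ℝ 1 fun w ↦ (g w : ℂ) := hgC.of_le (by simp)
    have hgc : HasCompactSupport fun w ↦ (g w : ℂ) :=
      h2.comp_left (g := fun x : ℝ ↦ (x : ℂ)) Complex.ofReal_zero
    have hwbN : ∀ z ∉ N, wbar (fun w ↦ (g w : ℂ)) z = 0 := fun z hz ↦
      image_eq_zero_of_notMem_tsupport fun h ↦ hz (hts (tsupport_wbar_subset _ h))
    have hint : ∀ k, Integrable fun z ↦ A k z * wbar (fun w ↦ (g w : ℂ)) z := fun k ↦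
      integrable_mul_of_locallyIntegrableOn
        (((hA k).continuousOn.mono hNU).locallyIntegrableOn hS.isOpen.measurableSet)
        (continuous_wbar hgC1) (hasCompactSupport_wbar hgc)
        ((tsupport_wbar_subset _).trans hts)
    -- `Φ` is the analytic function `A j`, invisible to `∂/∂z̄`, plus the jump `A i - A j` on the
    -- side `Re G > 0`; the curve itself is a null set.
    have hae : (fun z ↦ Φ z * wbar (fun w ↦ (g w : ℂ)) z) =ᵐ[volume]
        fun z ↦ A j z * wbar (fun w ↦ (g w : ℂ)) z
          + Np.indicator (fun z ↦ G' z * wbar (fun w ↦ (g w : ℂ)) z) z := by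
      rw [ae_restrict_iff' hNpo.measurableSet] at hΦi
      rw [ae_restrict_iff' hNmo.measurableSet] at hΦj
      filter_upwards [hΦi, hΦj, measure_eq_zero_iff_ae_notMem.1 hN0null] with z hzi hzj hz0
      by_cases hzN : z ∈ N
      · rcases lt_trichotomy (G z).re 0 with h | h | h
        · rw [hzj ⟨hzN, h⟩, indicator_of_notMem (fun h' ↦ (lt_asymm h h'.2)), add_zero]
        · exact absurd ⟨hzN, h⟩ hz0
        · rw [hzi ⟨hzN, h⟩, indicator_of_mem (show z ∈ Np from ⟨hzN, h⟩)]
          simp only [hG']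
          ring
      · rw [indicator_of_notMem (fun h' ↦ hzN h'.1), hwbN z hzN]
        simp
    have e1 := hw _ hgC hgc (hts.trans hNU)
    have hind : Integrable (Np.indicator fun z ↦ G' z * wbar (fun w ↦ (g w : ℂ)) z) := by
      refine Integrable.indicator ?_ hNpo.measurableSet
      refine ((hint i).sub (hint j)).congr (Eventually.of_forall fun z ↦ ?_)
      simp [hG', sub_mul]
    rw [integral_congr_ae hae, integral_add (hint j) hind,
      integral_holomorphic_mul_wbar hS.isOpen ((hA j).mono hNU) hgC1 hgc hts, zero_add,
      integral_indicator hNpo.measurableSet, hS.integral_mul_wbar hgC1 hgc hts] at e1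
    have e2 : ∫ y : ℝ, (ball c ρ).indicator (fun w ↦ (g (S w) : ℂ)) (y * Complex.I)
        = ρ * ∫ t in Ioo (-1 : ℝ) 1, (g (γ t) : ℂ) := by
      set k : ℝ → ℂ := fun y ↦ (ball c ρ).indicator (fun w ↦ (g (S w) : ℂ)) (y * Complex.I) with hk
      have e3 : ∀ t : ℝ, k (ρ * t + c.im)
          = (Ioo (-1 : ℝ) 1).indicator (fun t ↦ (g (γ t) : ℂ)) t := by
        intro t
        have e4 : ((ρ * t + c.im : ℝ) : ℂ) * Complex.I = c + t * b := by
          apply Complex.ext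
          · simp [hb, hc]
          · simp [hb]; ring
        simp only [hk, e4, hγ]
        by_cases ht : t ∈ Ioo (-1 : ℝ) 1
        · rw [indicator_of_mem ht, indicator_of_mem ((hmemB t).2 ht)]
        · rw [indicator_of_notMem ht, indicator_of_notMem (fun h ↦ ht ((hmemB t).1 h))]
      have e5 := Measure.integral_comp_mul_left (fun y ↦ k (y + c.im)) ρ
      rw [integral_add_right_eq_self k c.im] at e5
      simp only [e3] at e5
      rw [integral_indicator measurableSet_Ioo, abs_of_pos (inv_pos.2 hS.pos),
        Complex.real_smul] at e5
      rw [e5, ← mul_assoc, ← Complex.ofReal_mul, mul_inv_cancel₀ hS.pos.ne']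
      simp
    rw [e2] at e1
    have e6 : ∫ z, g z ∂μ = ρ / 2 * ∫ t in Ioo (-1 : ℝ) 1, g (γ t) := by
      rw [hμ, integral_smul_measure, integral_map hγm h1.continuous.aestronglyMeasurable,
        ENNReal.toReal_ofReal (half_pos hS.pos).le, smul_eq_mul]
    rw [e6]
    apply Complex.ofReal_injective
    rw [integral_complex_ofReal, integral_complex_ofReal] at e1
    push_cast
    linear_combination e1
  have hdens : (lengthMeasure γ (Ioo (-1) 1)).withDensity
      (fun w ↦ ENNReal.ofReal (‖A i w - A j w‖ / 2)) = μ := by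
    refine lengthMeasure_withDensity measurableSet_Ioo hγc hS.isOpen.measurableSet
      (fun t ht ↦ (hγN ht).1)
      (((((hA i).continuousOn.mono hNU).sub ((hA j).continuousOn.mono hNU)).norm).div_const 2)
      fun t ht ↦ ?_
    have h0 := hS.deriv_ne_zero _ (hγN ht).1
    rw [(hderiv t ht).deriv, norm_mul, norm_inv, hbn]
    have : ‖A i (γ t) - A j (γ t)‖ ≠ 0 := norm_ne_zero_iff.2 h0
    change ‖A i (γ t) - A j (γ t)‖⁻¹ * ρ * (‖A i (γ t) - A j (γ t)‖ / 2) = ρ / 2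
    field_simp
  -- the support
  have hνzero : ∀ O, IsOpen O → O ⊆ N → ∀ k, (∀ᵐ w ∂volume.restrict O, Φ w = A k w) →
      ∀ w ∈ O, w ∉ ν.support := fun O hO hON k hk w hwO ↦ by
    rw [Measure.notMem_support_iff_exists]
    exact ⟨O, hO.mem_nhds hwO, hν.restrict_eq_zero hw hO (hON.trans hNU)
      ((hA k).mono (hON.trans hNU)) hk⟩
  have hsupp : N ∩ ν.support = N0 := by
    ext z
    constructor
    · rintro ⟨hzN, hzs⟩
      rcases lt_trichotomy (G z).re 0 with h | h | h
      · exact absurd hzs (hνzero Nm hNmo inter_subset_left j hΦj z ⟨hzN, h⟩)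
      · exact ⟨hzN, h⟩
      · exact absurd hzs (hνzero Np hNpo inter_subset_left i hΦi z ⟨hzN, h⟩)
    · intro hz
      refine ⟨hz.1, (Measure.mem_support_iff_forall z).2 fun O hO ↦ ?_⟩
      obtain ⟨O', hO'O, hO', hzO'⟩ := _root_.mem_nhds_iff.1 hO
      refine lt_of_lt_of_le ?_ (measure_mono (inter_subset_left.trans hO'O : O' ∩ N ⊆ O))
      rw [← Measure.restrict_apply hO'.measurableSet, hνμ, hμ, Measure.smul_apply, smul_eq_mul,
        Measure.map_apply_of_aemeasurable hγm hO'.measurableSet,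
        Measure.restrict_apply' measurableSet_Ioo]
      rw [← himg] at hz
      obtain ⟨t, ht, rfl⟩ := hz
      refine ENNReal.mul_pos (by simpa using half_pos hS.pos) ?_
      rw [inter_comm]
      exact ((hγc.isOpen_inter_preimage isOpen_Ioo hO').measure_pos volume ⟨t, ht, hzO'⟩).ne'
  have hz₀0 : z₀ ∈ N ∩ ν.support := hsupp ▸ ⟨hz₀, hre⟩
  refine ⟨⟨N, fun z ↦ (G z).re, hS.isOpen, hz₀, hz₀0.2, ?_, ?_, ?_⟩, ?_⟩
  · have : DifferentiableOn ℂ G N := fun z hz ↦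
      (hS.hasDerivAt z hz).differentiableAt.differentiableWithinAt
    exact Complex.reCLM.contDiff.comp_contDiffOn
      ((this.contDiffOn hS.isOpen (n := 1)).restrict_scalars ℝ)
  · rw [(hasFDerivAt_re_of_hasDerivAt (hS.hasDerivAt z₀ hz₀)).fderiv]
    intro h0
    have h1 := congr($h0 ((starRingEnd ℂ) (G' z₀)))
    rw [reForm_apply, Complex.mul_conj, Complex.ofReal_re] at h1
    exact hS.deriv_ne_zero z₀ hz₀ (Complex.normSq_eq_zero.1 h1)
  · rw [inter_comm, hsupp]; rfl
  · refine ⟨i, j, hij, N, Np, Nm, hS.isOpen, hz₀, hNV, ⟨hNpo, ?_, hNmo, ?_, ?_, ?_⟩, hΦi, hΦj, ?_,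
      γ, harc, himg.trans hsupp.symm, hνμ.trans hdens.symm⟩
    · refine hS.isConnected_inter_preimage (P := {w | 0 < w.re})
        (convex_halfSpace_re_gt 0) ⟨c + (ρ / 2 : ℝ), ?_, ?_⟩
      · rw [mem_ball, dist_eq_norm, add_sub_cancel_left, Complex.norm_real,
          Real.norm_of_nonneg (half_pos hS.pos).le]
        exact half_lt_self hS.pos
      · simpa [hc] using hS.pos
    · refine hS.isConnected_inter_preimage (P := {w | w.re < 0})
        (convex_halfSpace_re_lt 0) ⟨c - (ρ / 2 : ℝ), ?_, ?_⟩
      · rw [mem_ball, dist_eq_norm, sub_sub_cancel_left, norm_neg, Complex.norm_real,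
          Real.norm_of_nonneg (half_pos hS.pos).le]
        exact half_lt_self hS.pos
      · simpa [hc] using hS.pos
    · exact disjoint_left.2 fun z h1 h2 ↦ lt_asymm (show 0 < (G z).re from h1.2) h2.2
    · rw [← sdiff_self_inter, hsupp]
      ext z
      simp only [hN0, hNp, hNm, Set.mem_sdiff, mem_inter_iff, mem_union, mem_ofPred_eq]
      grind
    · rw [hsupp]
      intro w hw
      have := hw.2
      simpa [hG] using this

/-! ### Piecewise analytic functions described by a maximum of harmonic functions -/

theorem exists_mul_norm_le_of_forall_ne {x y : ℂ} (hy : y ≠ 0) (h : ∀ t : ℝ, x ≠ t * y) :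
    ∃ η > 0, ∀ w : ℂ, |(x * w).re| ≤ η * ‖w‖ → |(y * w).re| ≤ η * ‖w‖ → w = 0 := by
  -- Cramer's rule recovers `w` from the two real linear forms. The determinant `D` is nonzero
  -- because `x` is not a real multiple of `y`, and the choice of `η` makes the right-hand side at
  -- most half the left one.
  have hid : ∀ w : ℂ, (starRingEnd ℂ) y * ((x * w).re : ℂ) - (starRingEnd ℂ) x * ((y * w).re : ℂ)
      = w * (Complex.I * ((x * (starRingEnd ℂ) y).im : ℂ)) := by
    intro w
    apply Complex.ext
    · simp; ring
    · simp; ring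
  set D := (x * (starRingEnd ℂ) y).im with hD
  have hD0 : D ≠ 0 := by
    intro h0
    refine h ((x * (starRingEnd ℂ) y).re / Complex.normSq y) ?_
    have e : x * (starRingEnd ℂ) y = ((x * (starRingEnd ℂ) y).re : ℂ) :=
      Complex.ext rfl (h0.trans (Complex.ofReal_im _).symm)
    have hn : (Complex.normSq y : ℂ) ≠ 0 := by
      exact_mod_cast (Complex.normSq_pos.2 hy).ne'
    push_cast
    rw [← e, div_mul_eq_mul_div, eq_div_iff hn, ← Complex.mul_conj]
    ring
  have hx : x ≠ 0 := fun h0 ↦ h 0 (by simp [h0])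
  have hs : 0 < ‖x‖ + ‖y‖ := add_pos (norm_pos_iff.2 hx) (norm_pos_iff.2 hy)
  have hDp : 0 < |D| := abs_pos.2 hD0
  refine ⟨|D| / (2 * (‖x‖ + ‖y‖)), by positivity, fun w h1 h2 ↦ ?_⟩
  by_contra hw
  have hwp : 0 < ‖w‖ := norm_pos_iff.2 hw
  have hn := congr(‖$(hid w)‖)
  rw [norm_mul, norm_mul, Complex.norm_I, one_mul, Complex.norm_real, Real.norm_eq_abs] at hn
  have hle : ‖w‖ * |D| ≤ ‖y‖ * |(x * w).re| + ‖x‖ * |(y * w).re| := by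
    rw [← hn]
    refine (norm_sub_le _ _).trans ?_
    rw [norm_mul, norm_mul, Complex.norm_conj, Complex.norm_conj, Complex.norm_real,
      Complex.norm_real, Real.norm_eq_abs, Real.norm_eq_abs]
  have h1' := mul_le_mul_of_nonneg_left h1 (norm_nonneg y)
  have h2' := mul_le_mul_of_nonneg_left h2 (norm_nonneg x)
  have e : ‖y‖ * (|D| / (2 * (‖x‖ + ‖y‖)) * ‖w‖) + ‖x‖ * (|D| / (2 * (‖x‖ + ‖y‖)) * ‖w‖)
      = ‖w‖ * |D| / 2 := by
    field_simp
    ring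
  have := mul_pos hwp hDp
  linarith

theorem exists_isLevelSegment {U : Opens ℂ} {p : ℂ} (hp : p ∈ U) {A₁ A₂ F₁ F₂ : ℂ → ℂ}
    (h₁ : IsPrimitiveFrom U p A₁ F₁) (h₂ : IsPrimitiveFrom U p A₂ F₂) (hne : A₁ p ≠ A₂ p) :
    ∃ S, IsLevelSegment U (fun z ↦ (F₁ z).re) (fun z ↦ (F₂ z).re) S ∧
      ∀ᶠ z in 𝓝 p, (F₁ z).re = (F₂ z).re → z ∈ S := by
  obtain ⟨ρ, S, N, hpN, hNU, hS⟩ := exists_isLevelChart (G := fun z ↦ F₁ z - F₂ z)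
    (G' := fun z ↦ A₁ z - A₂ z) U.isOpen (fun z hz ↦ (h₁.2 z hz).sub (h₂.2 z hz)) hp
    (sub_ne_zero.2 hne)
  simp only [h₁.1, h₂.1, sub_self] at hS
  have hρ := hS.pos
  have hb0 : (ρ : ℂ) * Complex.I ≠ 0 :=
    mul_ne_zero (by exact_mod_cast hρ.ne') Complex.I_ne_zero
  -- The parameter interval `[0, 1]` covers the part of the imaginary axis of height at most `ρ /
  -- 2`, a compact segment inside the open disc.
  have e : ∀ t : ℝ, -((ρ / 2 : ℝ) : ℂ) * Complex.I + t * (ρ * Complex.I)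
      = ((ρ * (t - 1 / 2) : ℝ) : ℂ) * Complex.I := fun t ↦ by push_cast; ring
  have hmem : ∀ t ∈ Icc (0 : ℝ) 1,
      -((ρ / 2 : ℝ) : ℂ) * Complex.I + t * (ρ * Complex.I) ∈ ball (0 : ℂ) ρ := by
    intro t ht
    rw [e, mem_ball_zero_iff, norm_mul, Complex.norm_I, mul_one, Complex.norm_real,
      Real.norm_eq_abs, abs_lt]
    constructor <;> nlinarith [ht.1, ht.2]
  obtain ⟨harc, -⟩ := hS.isRegularArc hb0 hmem
  refine ⟨_, ⟨_, harc, rfl, ?_, ?_⟩, ?_⟩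
  · rintro _ ⟨t, ht, rfl⟩
    exact hNU (hS.mapsTo_inv (hmem t ht))
  · rintro _ ⟨t, ht, rfl⟩
    have := hS.right_inv _ (hmem t ht)
    rw [e] at this
    have := congr(Complex.re $this)
    simp only [e]
    simpa using this
  · have hc : ContinuousAt (fun z ↦ F₁ z - F₂ z) p := (hS.hasDerivAt p hpN).continuousAt
    have hev : ∀ᶠ z in 𝓝 p, F₁ z - F₂ z ∈ ball (0 : ℂ) (ρ / 2) := by
      refine hc.eventually (isOpen_ball.mem_nhds ?_)
      simpa [h₁.1, h₂.1] using hρ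
    filter_upwards [hev, hS.isOpen.mem_nhds hpN] with z hz hzN hre
    rw [mem_ball_zero_iff] at hz
    set y := (F₁ z - F₂ z).im with hy
    have hyz : F₁ z - F₂ z = y * Complex.I := by
      apply Complex.ext
      · simp [hre]
      · simp [hy]
    rw [hyz, norm_mul, Complex.norm_I, mul_one, Complex.norm_real, Real.norm_eq_abs, abs_lt] at hz
    refine ⟨y / ρ + 1 / 2, ⟨?_, ?_⟩, ?_⟩
    · have : -(1 / 2) < y / ρ := by rw [lt_div_iff₀ hρ]; linarith
      linarith
    · have : y / ρ < 1 / 2 := by rw [div_lt_iff₀ hρ]; linarith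
      linarith
    · simp only
      rw [e]
      have : ρ * (y / ρ + 1 / 2 - 1 / 2) = y := by field_simp; ring
      rw [this, ← hyz]
      exact hS.left_inv z hzN

/-- In the neighborhood `V` of `p`, the function `Φ` is equal to `A i` where `Re (F i)` is the
largest of the functions `Re (F j)`. -/
structure IsMaxModel {r : ℕ} (U : Opens ℂ) (A F : Fin r → ℂ → ℂ) (Φ : ℂ → ℂ) (ν : Measure ℂ)
    (p : ℂ) (V : Set ℂ) : Prop where
  nonempty : Nonempty (Fin r)
  isOpen : IsOpen V
  mem : p ∈ V
  subset : V ⊆ U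
  prim : ∀ i, IsPrimitiveFrom U p (A i) (F i)
  differentiableOn : ∀ i, DifferentiableOn ℂ (A i) U
  ne : ∀ i j, i ≠ j → ∀ z ∈ V, A i z ≠ A j z
  eq_of_triple : ∀ z ∈ V, ∀ i j k, i ≠ j → i ≠ k → j ≠ k → (F i z).re = (F k z).re →
    (F j z).re = (F k z).re → z = p
  ae_eq : ∀ᵐ w, w ∈ V → ∃ k, Φ w = A k w ∧ ∀ j, (F j w).re ≤ (F k w).re
  isMeasureOf : ∃ T : 𝓓'(U, ℂ), IsMeasureOf T ν
  isWeakDbar : IsWeakDbar U Φ ν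
  exposed : ∀ i, IsExposed (fun j ↦ A j p) i

namespace IsMaxModel

variable {r : ℕ} {U : Opens ℂ} {A F : Fin r → ℂ → ℂ} {Φ : ℂ → ℂ} {ν : Measure ℂ}
    {p : ℂ} {V : Set ℂ}

theorem continuousAt_re (h : IsMaxModel U A F Φ ν p V) (i : Fin r) {z : ℂ} (hz : z ∈ V) :
    ContinuousAt (fun z ↦ (F i z).re) z :=
  Complex.continuous_re.continuousAt.comp ((h.prim i).2 z (h.subset hz)).continuousAt

theorem notMem_support (h : IsMaxModel U A F Φ ν p V) {z : ℂ} (hz : z ∈ V) {i : Fin r}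
    (hi : ∀ k, k ≠ i → (F k z).re < (F i z).re) : z ∉ ν.support := by
  have hev : ∀ᶠ w in 𝓝 z, w ∈ V ∧ ∀ k, k ≠ i → (F k w).re < (F i w).re := by
    refine Eventually.and (h.isOpen.mem_nhds hz) (eventually_all.2 fun k ↦ ?_)
    by_cases hk : k = i
    · exact Eventually.of_forall fun _ h' ↦ absurd hk h'
    · filter_upwards [(h.continuousAt_re k hz).eventually_lt (h.continuousAt_re i hz) (hi k hk)]
        with w hw _ using hw
  obtain ⟨N, hN, hNo, hzN⟩ := _root_.eventually_nhds_iff.1 hev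
  obtain ⟨T, hT⟩ := h.isMeasureOf
  rw [Measure.notMem_support_iff_exists]
  refine ⟨N, hNo.mem_nhds hzN, hT.restrict_eq_zero h.isWeakDbar hNo
    (fun w hw ↦ h.subset (hN w hw).1)
    ((h.differentiableOn i).mono fun w hw ↦ h.subset (hN w hw).1) ?_⟩
  rw [ae_restrict_iff' hNo.measurableSet]
  filter_upwards [h.ae_eq] with w hw hwN
  obtain ⟨k, hk, hmax⟩ := hw (hN w hwN).1
  by_cases hki : k = i
  · rw [hk, hki]
  · exact absurd ((hN w hwN).2 k hki) (not_lt.2 (hmax i))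

theorem locallyDescribedAt (h : IsMaxModel U A F Φ ν p V) {z : ℂ} (hz : z ∈ V) {i j : Fin r}
    (hij : i ≠ j) (heq : (F i z).re = (F j z).re)
    (hlt : ∀ k, k ≠ i → k ≠ j → (F k z).re < (F i z).re) :
    HasNormalAt ν.support z ∧
      LocallyDescribedAt A (fun i z ↦ (F i z).re) Φ ν ν.support V z := by
  have hev : ∀ᶠ w in 𝓝 z, w ∈ V ∧ ∀ k, k ≠ i → k ≠ j →
      (F k w).re < (F i w).re ∧ (F k w).re < (F j w).re := by
    refine Eventually.and (h.isOpen.mem_nhds hz) (eventually_all.2 fun k ↦ ?_)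
    by_cases hk : k = i ∨ k = j
    · exact Eventually.of_forall fun _ h1 h2 ↦ absurd hk (by tauto)
    · push Not at hk
      filter_upwards [(h.continuousAt_re k hz).eventually_lt (h.continuousAt_re i hz)
        (hlt k hk.1 hk.2), (h.continuousAt_re k hz).eventually_lt (h.continuousAt_re j hz)
        (heq ▸ hlt k hk.1 hk.2)] with w h1 h2 _ _ using ⟨h1, h2⟩
  obtain ⟨O, hO, hOo, hzO⟩ := _root_.eventually_nhds_iff.1 hev
  have hOV : O ⊆ V := fun w hw ↦ (hO w hw).1
  obtain ⟨ρ, S, N, hzN, hNO, hS⟩ := exists_isLevelChart (G := fun z ↦ F i z - F j z)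
    (G' := fun z ↦ A i z - A j z) hOo (fun w hw ↦ ((h.prim i).2 w (h.subset (hOV hw))).sub
      ((h.prim j).2 w (h.subset (hOV hw)))) hzO (sub_ne_zero.2 (h.ne i j hij z hz))
  obtain ⟨T, hT⟩ := h.isMeasureOf
  have hcont : ContinuousOn (fun w ↦ (F i w - F j w).re) N := fun w hw ↦
    (Complex.continuous_re.continuousAt.comp
      (hS.hasDerivAt w hw).continuousAt).continuousWithinAt
  have hre : (F i z - F j z).re = 0 := by rw [Complex.sub_re, heq, sub_self]
  refine locallyDescribedAt_of_isLevelChart hij h.differentiableOn hT h.isWeakDbar hS hre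
    (hNO.trans hOV) h.subset ?_ ?_ hzN hre
  · have ho : IsOpen (N ∩ {w | 0 < (F i w - F j w).re}) :=
      hcont.isOpen_inter_preimage hS.isOpen isOpen_Ioi
    rw [ae_restrict_iff' ho.measurableSet]
    filter_upwards [h.ae_eq] with w hw hwN
    have hpos : 0 < (F i w - F j w).re := hwN.2
    obtain ⟨k, hk, hmax⟩ := hw (hOV (hNO hwN.1))
    rw [Complex.sub_re] at hpos
    by_cases hki : k = i
    · rw [hk, hki]
    · by_cases hkj : k = j
      · subst hkj
        linarith [hmax i]
      · linarith [hmax i, ((hO w (hNO hwN.1)).2 k hki hkj).1]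
  · have ho : IsOpen (N ∩ {w | (F i w - F j w).re < 0}) :=
      hcont.isOpen_inter_preimage hS.isOpen isOpen_Iio
    rw [ae_restrict_iff' ho.measurableSet]
    filter_upwards [h.ae_eq] with w hw hwN
    have hneg : (F i w - F j w).re < 0 := hwN.2
    obtain ⟨k, hk, hmax⟩ := hw (hOV (hNO hwN.1))
    rw [Complex.sub_re] at hneg
    by_cases hkj : k = j
    · rw [hk, hkj]
    · by_cases hki : k = i
      · subst hki
        linarith [hmax j]
      · linarith [hmax j, ((hO w (hNO hwN.1)).2 k hki hkj).2]

/-- The cases count how many functions attain the maximum: one (off the support), two (a regular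
point of the curve), or at least three (only at `p`). -/
theorem trichotomy (h : IsMaxModel U A F Φ ν p V) {z : ℂ} (hz : z ∈ V) :
    (∃ i, ∀ k, k ≠ i → (F k z).re < (F i z).re) ∨
    (∃ i j, i ≠ j ∧ (F i z).re = (F j z).re ∧
      ∀ k, k ≠ i → k ≠ j → (F k z).re < (F i z).re) ∨
    (z = p ∧ ∃ i j k : Fin r, i ≠ j ∧ i ≠ k ∧ j ≠ k) := by
  have := h.nonempty
  obtain ⟨i, hi⟩ := Finite.exists_max fun i ↦ (F i z).re
  by_cases h1 : ∀ k, k ≠ i → (F k z).re < (F i z).re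
  · exact Or.inl ⟨i, h1⟩
  push Not at h1
  obtain ⟨j, hji, hj⟩ := h1
  have hij : (F i z).re = (F j z).re := le_antisymm hj (hi j)
  by_cases h2 : ∀ k, k ≠ i → k ≠ j → (F k z).re < (F i z).re
  · exact Or.inr (Or.inl ⟨i, j, hji.symm, hij, h2⟩)
  push Not at h2
  obtain ⟨k, hki, hkj, hk⟩ := h2
  have hik : (F i z).re = (F k z).re := le_antisymm hk (hi k)
  exact Or.inr (Or.inr ⟨h.eq_of_triple z hz i j k hji.symm hki.symm hkj.symm hik
    (hij.symm.trans hik), i, j, k, hji.symm, hki.symm, hkj.symm⟩)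

theorem measure_singleton (h : IsMaxModel U A F Φ ν p V) : ν {p} = 0 := by
  obtain ⟨T, hT⟩ := h.isMeasureOf
  have hev : ∀ᶠ w in 𝓝 p, w ∈ V ∧ ∀ k, ‖A k w‖ ≤ ‖A k p‖ + 1 := by
    refine Eventually.and (h.isOpen.mem_nhds h.mem) (eventually_all.2 fun k ↦ ?_)
    have hc : ContinuousAt (fun w ↦ ‖A k w‖) p :=
      ((h.differentiableOn k).continuousOn.continuousAt
        (U.isOpen.mem_nhds (h.subset h.mem))).norm
    exact (hc.eventually_lt_const (lt_add_one _)).mono fun _ ↦ le_of_lt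
  obtain ⟨R, hR, hball⟩ := Metric.eventually_nhds_iff_ball.1 hev
  refine hT.measure_singleton_eq_zero h.isWeakDbar hR (C := ∑ k, (‖A k p‖ + 1))
    (fun w hw ↦ h.subset (hball w hw).1) ?_
  rw [ae_restrict_iff' measurableSet_ball]
  filter_upwards [h.ae_eq] with w hw hwR
  obtain ⟨k, hk, -⟩ := hw (hball w hwR).1
  rw [hk]
  exact ((hball w hwR).2 k).trans (Finset.single_le_sum
    (f := fun k ↦ ‖A k p‖ + 1) (fun k _ ↦ by positivity) (Finset.mem_univ k))

end IsMaxModel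

/-- Nonzero linear forms do not vanish on exposing directions in general position. -/
theorem IsExposed.exists_ne_zero {ι : Type*} [Finite ι] {a : ι → ℂ} {i : ι} (h : IsExposed a i)
    {L : ℂ →L[ℝ] ℝ} (hL : L ≠ 0) :
    ∃ u : ℂ, (∀ j, j ≠ i → 0 < (u * (a i - a j)).re) ∧ L u ≠ 0 := by
  obtain ⟨u, hu⟩ := h
  obtain ⟨v, hv⟩ : ∃ v, L v ≠ 0 := by
    by_contra hn
    push Not at hn
    exact hL (ContinuousLinearMap.ext hn)
  by_cases h0 : L u = 0
  · have hev : ∀ᶠ ε : ℝ in 𝓝[>] 0, ∀ j, j ≠ i → 0 < ((u + ε * v) * (a i - a j)).re := by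
      refine eventually_all.2 fun j ↦ ?_
      by_cases hj : j = i
      · exact Eventually.of_forall fun _ h' ↦ absurd hj h'
      · have hc : ContinuousAt (fun ε : ℝ ↦ ((u + ε * v) * (a i - a j)).re) 0 := by fun_prop
        filter_upwards [nhdsWithin_le_nhds (hc.eventually_const_lt (u := 0)
          (by simpa using hu j hj))] with ε hε _ using hε
    obtain ⟨ε, hε, hε0⟩ := (hev.and self_mem_nhdsWithin).exists
    have hε0' : (0 : ℝ) < ε := hε0
    refine ⟨u + ε * v, hε, ?_⟩
    rw [← Complex.real_smul, map_add, h0, zero_add, map_smul, smul_eq_mul]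
    exact mul_ne_zero hε0'.ne' hv
  · exact ⟨u, hu, h0⟩

theorem exists_pair_same_sign {x y z : ℝ} (hx : x ≠ 0) (hy : y ≠ 0) (hz : z ≠ 0) :
    0 < x * y ∨ 0 < x * z ∨ 0 < y * z := by
  rcases hx.lt_or_gt with hx | hx <;> rcases hy.lt_or_gt with hy | hy <;>
    rcases hz.lt_or_gt with hz | hz
  all_goals first
    | exact Or.inl (mul_pos hx hy)
    | exact Or.inl (mul_pos_of_neg_of_neg hx hy)
    | exact Or.inr (Or.inl (mul_pos hx hz))
    | exact Or.inr (Or.inl (mul_pos_of_neg_of_neg hx hz))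
    | exact Or.inr (Or.inr (mul_pos hy hz))
    | exact Or.inr (Or.inr (mul_pos_of_neg_of_neg hy hz))

/-! ### The support of `ν` and its normals in the maximum model -/

namespace IsMaxModel

variable {r : ℕ} {U : Opens ℂ} {A F : Fin r → ℂ → ℂ} {Φ : ℂ → ℂ} {ν : Measure ℂ}
    {p : ℂ} {V : Set ℂ}

theorem forall_lt_of_notMem_support (h : IsMaxModel U A F Φ ν p V) {z : ℂ} (hz : z ∈ V)
    (hzs : z ∉ ν.support) (hzp : z ≠ p) : ∃ i, ∀ k, k ≠ i → (F k z).re < (F i z).re := by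
  rcases h.trichotomy hz with h1 | ⟨i, j, hij, heq, hlt⟩ | ⟨h3, -⟩
  · exact h1
  · obtain ⟨-, -, -, -, hmem, -⟩ := (h.locallyDescribedAt hz hij heq hlt).1
    exact absurd hmem hzs
  · exact absurd h3 hzp

theorem eventually_lt_along (h : IsMaxModel U A F Φ ν p V) {i : Fin r} {u : ℂ}
    (hu : ∀ j, j ≠ i → 0 < (u * (A i p - A j p)).re) :
    ∀ᶠ t : ℝ in 𝓝[>] 0, ∀ k, k ≠ i → (F k (p + t * u)).re < (F i (p + t * u)).re := by
  refine eventually_all.2 fun k ↦ ?_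
  by_cases hk : k = i
  · exact Eventually.of_forall fun _ h' ↦ absurd hk h'
  have hpU := h.subset h.mem
  have h1 : HasDerivAt (fun t : ℝ ↦ p + t * u) u 0 := by
    simpa using ((Complex.ofRealCLM.hasDerivAt (x := (0 : ℝ))).mul_const u).const_add p
  have h2 : HasFDerivAt (fun w ↦ (F i w - F k w).re) (reForm (A i p - A k p))
      (p + (0 : ℝ) * u) := by
    simpa using hasFDerivAt_re_of_hasDerivAt (((h.prim i).2 p hpU).sub ((h.prim k).2 p hpU))
  have h3 := h2.comp_hasDerivAt (0 : ℝ) h1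
  rw [reForm_apply, mul_comm] at h3
  have h4 := (hasDerivAt_iff_tendsto_slope.1 h3).eventually_const_lt (hu k hk)
  filter_upwards [nhdsWithin_mono _ (fun t (ht : (0 : ℝ) < t) ↦ ht.ne') h4, self_mem_nhdsWithin]
    with t ht ht0 _
  have ht0' : (0 : ℝ) < t := ht0
  rw [slope_def_field, sub_zero] at ht
  simp only [Function.comp_apply, Complex.ofReal_zero, zero_mul, add_zero, (h.prim _).1,
    sub_self, Complex.zero_re, sub_zero] at ht
  have := (div_pos_iff_of_pos_right ht0').1 ht
  rw [Complex.sub_re] at this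
  linarith

/-- Close to `p`, the segment from `p + t u` to `p + t v` stays on one side of the tangent line at a
distance comparable to `t`, hence misses the support. Off the support the maximizing index is unique
and locally constant, yet it is `i` at one end and `j` at the other. -/
theorem false_of_same_side (h : IsMaxModel U A F Φ ν p V) {W : Set ℂ} {g : ℂ → ℝ}
    (hW : IsOpen W) (hpW : p ∈ W) (hpΓ : p ∈ ν.support) (hg : DifferentiableAt ℝ g p)
    (hgΓ : ν.support ∩ W = {w ∈ W | g w = 0}) {i j : Fin r} (hij : i ≠ j) {u v : ℂ}
    (hu : ∀ k, k ≠ i → 0 < (u * (A i p - A k p)).re)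
    (hv : ∀ k, k ≠ j → 0 < (v * (A j p - A k p)).re)
    (huv : 0 < fderiv ℝ g p u * fderiv ℝ g p v) : False := by
  set L := fderiv ℝ g p with hL
  have hgp : g p = 0 := by
    have : p ∈ ν.support ∩ W := ⟨hpΓ, hpW⟩
    rw [hgΓ] at this
    exact this.2
  -- along the segments from `u` to `v`, the linear form `L` is bounded away from zero
  obtain ⟨m, hm, hmL⟩ : ∃ m > 0, ∀ θ ∈ Icc (0 : ℝ) 1, m ≤ |L (u + θ * (v - u))| := by
    have e : ∀ θ : ℝ, L (u + θ * (v - u)) = (1 - θ) * L u + θ * L v := fun θ ↦ by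
      rw [← Complex.real_smul, map_add, map_smul, map_sub, smul_eq_mul]; ring
    have hu0 : L u ≠ 0 := fun h0 ↦ by simp [h0] at huv
    have hv0 : L v ≠ 0 := fun h0 ↦ by simp [h0] at huv
    refine ⟨min |L u| |L v|, lt_min (abs_pos.2 hu0) (abs_pos.2 hv0), fun θ hθ ↦ ?_⟩
    have h1 := min_le_left |L u| |L v|
    have h2 := min_le_right |L u| |L v|
    have key : min |L u| |L v| ≤ (1 - θ) * |L u| + θ * |L v| := by
      have := mul_le_mul_of_nonneg_left h1 (sub_nonneg.2 hθ.2)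
      have := mul_le_mul_of_nonneg_left h2 hθ.1
      linarith
    rw [e]
    rcases hu0.lt_or_gt with hn | hn
    · have hn' : L v < 0 := by
        by_contra hc
        exact absurd huv (not_lt.2 (mul_nonpos_of_nonpos_of_nonneg hn.le (not_lt.1 hc)))
      rw [abs_of_neg hn, abs_of_neg hn'] at key ⊢
      refine le_trans ?_ (neg_le_abs _)
      linarith
    · have hn' : 0 < L v := (pos_iff_pos_of_mul_pos huv).1 hn
      rw [abs_of_pos hn, abs_of_pos hn'] at key ⊢
      exact key.trans (le_abs_self _)
  set B := ‖u‖ + ‖v - u‖ + 1 with hB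
  have hB0 : 0 < B := by positivity
  have hball : ∀ᶠ w in 𝓝 p, w ∈ V ∧ w ∈ W ∧ |g w - L (w - p)| ≤ m / (2 * B) * ‖w - p‖ := by
    refine Eventually.and (h.isOpen.mem_nhds h.mem) (Eventually.and (hW.mem_nhds hpW) ?_)
    have := hg.hasFDerivAt.isLittleO.def (by positivity : 0 < m / (2 * B))
    simpa [hgp] using this
  obtain ⟨R, hR, hRball⟩ := Metric.eventually_nhds_iff.1 hball
  have hev : ∀ᶠ t : ℝ in 𝓝[>] 0, t * B < R := by
    have hc : ContinuousAt (fun t : ℝ ↦ t * B) 0 := by fun_prop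
    exact nhdsWithin_le_nhds (hc.eventually_lt_const (by simpa using hR))
  obtain ⟨t, ⟨⟨⟨htR, htu⟩, htv⟩, ht0⟩⟩ := (((hev.and (h.eventually_lt_along hu)).and
    (h.eventually_lt_along hv)).and self_mem_nhdsWithin).exists
  have ht : (0 : ℝ) < t := ht0
  -- Along `c` the linear part of `g` is at least `t m` in absolute value, while the first-order
  -- error is at most `t m / 2`, so `g` cannot vanish.
  set c : ℝ → ℂ := fun θ ↦ p + t * (u + θ * (v - u)) with hc
  have hcc : Continuous c := by fun_prop
  have hnorm : ∀ θ ∈ Icc (0 : ℝ) 1, ‖c θ - p‖ < t * B := fun θ hθ ↦ by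
    have e : c θ - p = t * (u + θ * (v - u)) := by simp [hc]
    rw [e, norm_mul, Complex.norm_real, Real.norm_of_nonneg ht.le]
    refine mul_lt_mul_of_pos_left ?_ ht
    refine (norm_add_le _ _).trans_lt ?_
    rw [norm_mul, Complex.norm_real, Real.norm_of_nonneg hθ.1]
    have := mul_le_mul_of_nonneg_right hθ.2 (norm_nonneg (v - u))
    linarith
  have hmem : ∀ θ ∈ Icc (0 : ℝ) 1, c θ ∈ V ∧ c θ ∉ ν.support := by
    intro θ hθ
    have hn := hnorm θ hθ
    obtain ⟨hcV, hcW, hle⟩ := hRball (y := c θ) (by rw [dist_eq_norm]; linarith)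
    refine ⟨hcV, fun hs ↦ ?_⟩
    have hg0 : g (c θ) = 0 := by
      have : c θ ∈ ν.support ∩ W := ⟨hs, hcW⟩
      rw [hgΓ] at this
      exact this.2
    have e : L (c θ - p) = t * L (u + θ * (v - u)) := by
      have : c θ - p = t • (u + θ * (v - u)) := by
        rw [Complex.real_smul]
        exact add_sub_cancel_left _ _
      rw [this, map_smul, smul_eq_mul]
    rw [hg0, zero_sub, abs_neg, e, abs_mul, abs_of_pos ht] at hle
    have h1 := mul_le_mul_of_nonneg_left (hmL θ hθ) ht.le
    have h2 : m / (2 * B) * ‖c θ - p‖ ≤ m / (2 * B) * (t * B) :=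
      mul_le_mul_of_nonneg_left hn.le (by positivity)
    have h3 : m / (2 * B) * (t * B) = t * m / 2 := by field_simp
    have := mul_pos ht hm
    linarith
  -- Disjoint open sets that would disconnect the segment: `i` is the strict winner, or `i` is
  -- beaten.
  set O₁ : Set ℂ := {z | z ∈ V ∧ ∀ k, k ≠ i → (F k z).re < (F i z).re} with hO₁
  set O₂ : Set ℂ := {z | z ∈ V ∧ ∃ k, (F i z).re < (F k z).re} with hO₂
  have hO₁o : IsOpen O₁ := by
    rw [isOpen_iff_eventually]
    rintro z ⟨hz, hlt⟩
    refine Eventually.and (h.isOpen.mem_nhds hz) (eventually_all.2 fun k ↦ ?_)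
    by_cases hk : k = i
    · exact Eventually.of_forall fun _ h' ↦ absurd hk h'
    · filter_upwards [(h.continuousAt_re k hz).eventually_lt (h.continuousAt_re i hz) (hlt k hk)]
        with w hw _ using hw
  have hO₂o : IsOpen O₂ := by
    rw [isOpen_iff_eventually]
    rintro z ⟨hz, k, hk⟩
    refine Eventually.and (h.isOpen.mem_nhds hz) ?_
    filter_upwards [(h.continuousAt_re i hz).eventually_lt (h.continuousAt_re k hz) hk]
      with w hw using ⟨k, hw⟩
  have hpre : IsPreconnected (c '' Icc 0 1) := isPreconnected_Icc.image c hcc.continuousOn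
  have hcov : c '' Icc 0 1 ⊆ O₁ ∪ O₂ := by
    rintro _ ⟨θ, hθ, rfl⟩
    obtain ⟨hV, hs⟩ := hmem θ hθ
    obtain ⟨l, hl⟩ := h.forall_lt_of_notMem_support hV hs fun hp ↦ hs (hp ▸ hpΓ)
    by_cases hli : l = i
    · exact Or.inl ⟨hV, hli ▸ hl⟩
    · exact Or.inr ⟨hV, l, hl i (Ne.symm hli)⟩
  obtain ⟨z, -, hz1, hz2⟩ := hpre O₁ O₂ hO₁o hO₂o hcov
    ⟨c 0, mem_image_of_mem c ⟨le_rfl, zero_le_one⟩, (hmem 0 ⟨le_rfl, zero_le_one⟩).1, by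
      simpa [hc] using htu⟩
    ⟨c 1, mem_image_of_mem c ⟨zero_le_one, le_rfl⟩, (hmem 1 ⟨zero_le_one, le_rfl⟩).1, j, by
      have := htv i hij
      simpa [hc] using this⟩
  obtain ⟨k, hk⟩ := hz2.2
  by_cases hki : k = i
  · exact lt_irrefl _ (hki ▸ hk)
  · exact lt_asymm hk (hz1.2 k hki)

/-- Each of the three vertices has an exposing direction off the tangent line, and two of the three
must lie on the same side of it. -/
theorem not_hasNormalAt (h : IsMaxModel U A F Φ ν p V) {i j k : Fin r} (hij : i ≠ j)
    (hik : i ≠ k) (hjk : j ≠ k) : ¬ HasNormalAt ν.support p := by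
  rintro ⟨W, g, hW, hpW, hpΓ, hg, hL, hgΓ⟩
  have hgd : DifferentiableAt ℝ g p :=
    (hg.differentiableOn one_ne_zero).differentiableAt (hW.mem_nhds hpW)
  obtain ⟨u, hu, hu0⟩ := (h.exposed i).exists_ne_zero hL
  obtain ⟨v, hv, hv0⟩ := (h.exposed j).exists_ne_zero hL
  obtain ⟨w, hw, hw0⟩ := (h.exposed k).exists_ne_zero hL
  rcases exists_pair_same_sign hu0 hv0 hw0 with h1 | h1 | h1
  · exact h.false_of_same_side hW hpW hpΓ hgd hgΓ hij hu hv h1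
  · exact h.false_of_same_side hW hpW hpΓ hgd hgΓ hik hu hw h1
  · exact h.false_of_same_side hW hpW hpΓ hgd hgΓ hjk hv hw h1

theorem eq_of_not_hasNormalAt (h : IsMaxModel U A F Φ ν p V) {z : ℂ} (hz : z ∈ V)
    (hzs : z ∈ ν.support) (hn : ¬ HasNormalAt ν.support z) : z = p := by
  rcases h.trichotomy hz with ⟨i, hi⟩ | ⟨i, j, hij, heq, hlt⟩ | ⟨h3, -⟩
  · exact absurd hzs (h.notMem_support hz hi)
  · exact absurd (h.locallyDescribedAt hz hij heq hlt).1 hn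
  · exact h3

theorem locallyDescribedAt_of_hasNormalAt (h : IsMaxModel U A F Φ ν p V) {z : ℂ} (hz : z ∈ V)
    (hn : HasNormalAt ν.support z) :
    LocallyDescribedAt A (fun i z ↦ (F i z).re) Φ ν ν.support V z := by
  rcases h.trichotomy hz with ⟨i, hi⟩ | ⟨i, j, hij, heq, hlt⟩ | ⟨rfl, i, j, k, h1, h2, h3⟩
  · obtain ⟨-, -, -, -, hmem, -⟩ := hn
    exact absurd hmem (h.notMem_support hz hi)
  · exact (h.locallyDescribedAt hz hij heq hlt).2
  · exact absurd hn (h.not_hasNormalAt h1 h2 h3)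

theorem exists_eq_of_mem_support (h : IsMaxModel U A F Φ ν p V) {z : ℂ} (hz : z ∈ V)
    (hzs : z ∈ ν.support) : ∃ i j, i ≠ j ∧ (F i z).re = (F j z).re := by
  rcases h.trichotomy hz with ⟨i, hi⟩ | ⟨i, j, hij, heq, -⟩ | ⟨rfl, i, j, k, h1, -, -⟩
  · exact absurd hzs (h.notMem_support hz hi)
  · exact ⟨i, j, hij, heq⟩
  · exact ⟨i, j, h1, by rw [(h.prim i).1, (h.prim j).1]⟩

end IsMaxModel

/-! ### Passage from the hypotheses at `p` to the maximum model -/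

theorem eventually_eq_of_triple {U : Opens ℂ} {p : ℂ} (hp : p ∈ U) {A₁ A₂ A₃ F₁ F₂ F₃ : ℂ → ℂ}
    (h₁ : IsPrimitiveFrom U p A₁ F₁) (h₂ : IsPrimitiveFrom U p A₂ F₂)
    (h₃ : IsPrimitiveFrom U p A₃ F₃) (hne : A₂ p ≠ A₃ p)
    (h : ∀ t : ℝ, A₁ p - A₃ p ≠ t * (A₂ p - A₃ p)) :
    ∀ᶠ z in 𝓝 p, (F₁ z).re = (F₃ z).re → (F₂ z).re = (F₃ z).re → z = p := by
  -- At a triple tie both linearized differences are `o(|z - p|)`; by noncollinearity they are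
  -- independent linear forms, so `z - p = 0`.
  obtain ⟨η, hη, hw⟩ := exists_mul_norm_le_of_forall_ne (sub_ne_zero.2 hne) h
  have key : ∀ {A F B G : ℂ → ℂ}, IsPrimitiveFrom U p A F → IsPrimitiveFrom U p B G →
      ∀ᶠ z in 𝓝 p, (F z).re = (G z).re → |((A p - B p) * (z - p)).re| ≤ η * ‖z - p‖ := by
    intro A F B G hF hG
    have h1 := hasFDerivAt_re_of_hasDerivAt ((hF.2 p hp).sub (hG.2 p hp))
    filter_upwards [h1.isLittleO.def hη] with z hz hre
    refine le_trans (le_of_eq ?_) hz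
    rw [Real.norm_eq_abs, ← abs_neg]
    congr 1
    simp [hF.1, hG.1, hre, reForm_apply]
    ring
  filter_upwards [key h₁ h₃, key h₂ h₃] with z hz1 hz2 hre1 hre2
  exact sub_eq_zero.1 (hw _ (hz1 hre1) (hz2 hre2))

/-- Finitely many conditions that hold near `p` are intersected: distinct coefficients, no triple
tie except at `p`, level curves contained in the chosen segments, and the maximum property on each
`M k`. The sets `M k` disappear from the conclusion; only the functions `F k` matter from here on.
-/
theorem IsPiecewiseAnalytic.exists_isMaxModel {r : ℕ} {U : Opens ℂ} {M : Fin r → Set ℂ}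
    {A F : Fin r → ℂ → ℂ} {Φ : ℂ → ℂ} {T : 𝓓'(U, ℂ)} {ν : Measure ℂ} {p : ℂ}
    (hΦ : IsPiecewiseAnalytic U M A Φ) (hν : IsMeasureOf T ν) (hw : IsWeakDbar U Φ ν)
    (hp : p ∈ U) (hF : ∀ i, IsPrimitiveFrom U p (A i) (F i)) (hi : ∀ i, p ∈ closure (M i))
    (hii : ∀ i j k : Fin r, i ≠ j → i ≠ k → j ≠ k →
      ∀ t : ℝ, A i p - A k p ≠ (t : ℂ) * (A j p - A k p))
    (hiii : ∀ i k : Fin r, i ≠ k → A i p ≠ A k p) :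
    ∃ V, IsMaxModel U A F Φ ν p V ∧ ∃ S : Fin r → Fin r → Set ℂ, ∀ i j, i ≠ j →
      IsLevelSegment U (fun z ↦ (F i z).re) (fun z ↦ (F j z).re) (S i j) ∧
      ∀ z ∈ V, (F i z).re = (F j z).re → z ∈ S i j := by
  obtain ⟨ρ, Ψ, hρU, hloc⟩ := hΦ.exists_localPotential hw hp hF
  obtain ⟨hexp, ρ', hρ', hρ'ρ, hmax⟩ := hloc.exists_ball_forall_le hi hii hiii
  have hseg : ∀ i j, ∃ S, i ≠ j →
      IsLevelSegment U (fun z ↦ (F i z).re) (fun z ↦ (F j z).re) S ∧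
      ∀ᶠ z in 𝓝 p, (F i z).re = (F j z).re → z ∈ S := by
    intro i j
    by_cases hij : i = j
    · exact ⟨∅, fun h ↦ absurd hij h⟩
    · obtain ⟨S, hS⟩ := exists_isLevelSegment hp (hF i) (hF j) (hiii i j hij)
      exact ⟨S, fun _ ↦ hS⟩
  choose S hS using hseg
  have e1 : ∀ᶠ z in 𝓝 p, ∀ i j, i ≠ j → A i z ≠ A j z := by
    refine eventually_all.2 fun i ↦ eventually_all.2 fun j ↦ ?_
    by_cases hij : i = j
    · exact Eventually.of_forall fun _ h ↦ absurd hij h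
    · have hc : ∀ k, ContinuousAt (A k) p := fun k ↦ (hΦ.analytic k p hp).continuousAt
      filter_upwards [((hc i).sub (hc j)).eventually_ne (sub_ne_zero.2 (hiii i j hij))]
        with z hz _ using sub_ne_zero.1 hz
  have e2 : ∀ᶠ z in 𝓝 p, ∀ i j k, i ≠ j → i ≠ k → j ≠ k → (F i z).re = (F k z).re →
      (F j z).re = (F k z).re → z = p := by
    refine eventually_all.2 fun i ↦ eventually_all.2 fun j ↦ eventually_all.2 fun k ↦ ?_
    by_cases hd : i ≠ j ∧ i ≠ k ∧ j ≠ k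
    · filter_upwards [eventually_eq_of_triple hp (hF i) (hF j) (hF k) (hiii j k hd.2.2)
        (hii i j k hd.1 hd.2.1 hd.2.2)] with z hz _ _ _ using hz
    · exact Eventually.of_forall fun _ h1 h2 h3 ↦ absurd ⟨h1, h2, h3⟩ hd
  have e3 : ∀ᶠ z in 𝓝 p, ∀ i j, i ≠ j → (F i z).re = (F j z).re → z ∈ S i j := by
    refine eventually_all.2 fun i ↦ eventually_all.2 fun j ↦ ?_
    by_cases hij : i = j
    · exact Eventually.of_forall fun _ h ↦ absurd hij h
    · filter_upwards [(hS i j hij).2] with z hz _ using hz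
  have e4 : ∀ᶠ z in 𝓝 p, z ∈ ball p ρ' := ball_mem_nhds p hρ'
  obtain ⟨V, hV, hVo, hpV⟩ := _root_.eventually_nhds_iff.1 ((e1.and e2).and (e3.and e4))
  have hball : ball p ρ' ⊆ U := (ball_subset_ball hρ'ρ).trans hρU
  refine ⟨V, ⟨?_, hVo, hpV, fun z hz ↦ hball (hV z hz).2.2, hF,
    fun i ↦ (hΦ.analytic i).differentiableOn, fun i j hij z hz ↦ (hV z hz).1.1 i j hij,
    fun z hz ↦ (hV z hz).1.2, ?_, ⟨T, hν⟩, hw, hexp⟩, S,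
    fun i j hij ↦ ⟨(hS i j hij).1, fun z hz ↦ (hV z hz).2.1 i j hij⟩⟩
  · obtain ⟨j, -⟩ := hloc.dense _ isOpen_ball subset_rfl ⟨p, mem_ball_self hloc.pos⟩
    exact ⟨j⟩
  · have h0 : ∀ᵐ z, z ∉ (U : Set ℂ) \ ⋃ i, M i := measure_eq_zero_iff_ae_notMem.1 hΦ.null
    have h1 := hΦ.eq_sum
    rw [ae_restrict_iff' U.isOpen.measurableSet] at h1
    filter_upwards [h0, h1] with z hz0 hz1 hzV
    have hzb := (hV z hzV).2.2
    have hzM : z ∈ ⋃ i, M i := by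
      by_contra hn
      exact hz0 ⟨hball hzb, hn⟩
    obtain ⟨k, hk⟩ := mem_iUnion.1 hzM
    refine ⟨k, ?_, hmax k z ⟨hzb, hk⟩⟩
    rw [hz1 (hball hzb), Finset.sum_eq_single k, indicator_of_mem hk]
    · intro j _ hjk
      exact indicator_of_notMem (fun hzj ↦ disjoint_left.1 (hΦ.disjoint j k hjk) hzj hk) _
    · simp

end PiecewiseAnalytic

end

/-! ### Proof of the theorem -/

open PiecewiseAnalytic in
theorem corollary4 {r : ℕ} (U : Opens ℂ) (hU : IsSimplyConnected (U : Set ℂ))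
    (M : Fin r → Set ℂ) (A : Fin r → ℂ → ℂ) (Φ : ℂ → ℂ)
    (hΦ : IsPiecewiseAnalytic U M A Φ) (hpos : MemSigma (ofFunction U Φ))
    (p : ℂ) (hp : p ∈ U)
    (hi : ∀ i, p ∈ closure (M i))
    (hii : ∀ i j k : Fin r, i ≠ j → i ≠ k → j ≠ k →
      ∀ t : ℝ, A i p - A k p ≠ (t : ℂ) * (A j p - A k p))
    (hiii : ∀ i k : Fin r, i ≠ k → A i p ≠ A k p) :
    ∃ F : Fin r → ℂ → ℂ, (∀ i, IsPrimitiveFrom U p (A i) (F i)) ∧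
    ∃ ν : Measure ℂ, IsMeasureOf (dbar (ofFunction U Φ)) ν ∧
      (∀ N : Set ℂ, IsOpen N → p ∈ N → IsCompact (closure N) → closure N ⊆ U →
        ∃ a : ℂ → ℂ, AnalyticOnNhd ℂ a N ∧
          ∀ᵐ z ∂(volume.restrict N),
            Integrable (fun w : ℂ ↦ 1 / ((Real.pi : ℂ) * (z - w))) (ν.restrict (closure N)) ∧
            Φ z = cauchyTransform (ν.restrict (closure N)) z + a z) ∧
      ∃ V : Set ℂ, IsOpen V ∧ p ∈ V ∧ V ⊆ U ∧
        (∃ (n : ℕ) (S : Fin n → Set ℂ),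
          (∀ k, ∃ i j : Fin r, i ≠ j ∧
            IsLevelSegment U (fun z ↦ (F i z).re) (fun z ↦ (F j z).re) (S k)) ∧
          ∀ N : Set ℂ, IsOpen N → p ∈ N → IsCompact (closure N) → closure N ⊆ V →
            (ν.restrict (closure N)).support ⊆ ⋃ k, S k) ∧
        {z ∈ ν.support ∩ V | ¬ HasNormalAt ν.support z}.Finite ∧
        ν {z ∈ ν.support ∩ V | ¬ HasNormalAt ν.support z} = 0 ∧
        ∀ z ∈ V, HasNormalAt ν.support z →
          LocallyDescribedAt A (fun i z ↦ (F i z).re) Φ ν ν.support V z := by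
  choose F hF using fun i ↦ exists_isPrimitiveFrom hU hp (hΦ.analytic i)
  obtain ⟨ν, hν⟩ := hpos.exists_isMeasureOf
  have hloc := hΦ.locallyIntegrableOn
  have hw := hν.isWeakDbar hloc
  obtain ⟨V, hV, S, hS⟩ := hΦ.exists_isMaxModel hν hw hp hF hi hii hiii
  refine ⟨F, hF, ν, hν, fun N hN _ hNc hNU ↦ hν.exists_eq_cauchyTransform_add hw hloc hN hNc hNU,
    V, hV.isOpen, hV.mem, hV.subset, ?_, ?_, ?_,
    fun z hz hn ↦ hV.locallyDescribedAt_of_hasNormalAt hz hn⟩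
  -- One segment for each ordered pair of distinct indices suffices, since a point of the support in
  -- `V` is a tie between two of the functions.
  · let e := Fintype.equivFin {x : Fin r × Fin r // x.1 ≠ x.2}
    refine ⟨_, fun k ↦ S (e.symm k).1.1 (e.symm k).1.2, fun k ↦
      ⟨_, _, (e.symm k).2, (hS _ _ (e.symm k).2).1⟩, fun N _ _ _ hNV z hz ↦ ?_⟩
    have hz' := Measure.support_restrict_subset hz
    rw [closure_closure] at hz'
    obtain ⟨i, j, hij, heq⟩ := hV.exists_eq_of_mem_support (hNV hz'.1) hz'.2
    refine mem_iUnion.2 ⟨e ⟨(i, j), hij⟩, ?_⟩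
    rw [e.symm_apply_apply]
    exact (hS i j hij).2 z (hNV hz'.1) heq
  -- A support point without a normal can only be `p`, which settles finiteness and, with the
  -- absence of an atom at `p`, nullity.
  · exact (finite_singleton p).subset fun z hz ↦ hV.eq_of_not_hasNormalAt hz.1.2 hz.1.1 hz.2
  · exact measure_mono_null (fun z hz ↦ hV.eq_of_not_hasNormalAt hz.1.2 hz.1.1 hz.2)
      hV.measure_singleton
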